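/- Let $X,Y,W\in\mathbb{R}[t]$ with $W\neq 0$ and $\gcd(X,Y,W)=1$, put $\phi(t)=\left(\frac{X(t)}{W(t)},\frac{Y(t)}{W(t)}\right)$, and let $\mathcal{C}\subset\mathbb{C}^2$ be the Zariski closure of $\{\phi(t): t\in\mathbb{C},\ W(t)\ne 0\}$. Assume that $\mathcal{C}$ is neither a line nor a circle and that $\phi$ is proper, i.e. only finitely many $t\in\mathbb{C}$ with $W(t)\neq0$ satisfy $\phi(t)=\phi(t')$ for some $t'\neq t$ with $W(t')\neq 0$. Let $d>0$ be real, $U=X'W-XW'$, $V=Y'W-YW'$. The offset $\mathcal{O}_d(\mathcal{C})$ is the Zariski closure in $\mathbb{C}^2$ of the set of all points $$q=\left(\frac{X(t)}{W(t)}\pm d\,\frac{V(t)}{\sqrt{U(t)^2+V(t)^2}},\ \frac{Y(t)}{W(t)}\mp d\,\frac{U(t)}{\sqrt{U(t)^2+V(t)^2}}\right),\qquad t\in\mathbb{C},\ W(t)\neq0,\ U(t)^2+V(t)^2\neq 0;$$ we say that the point $\phi(t)$ generates $q$. An irreducible component of $\mathcal{O}_d(\mathcal{C})$ is simple if all but finitely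 many of its points are generated by exactly one point of $\mathcal{C}$, and special otherwise. Let $P$ and $Q$ in $\mathbb{C}[x,y,t]$ be obtained from $$U(Wx-X)+V(Wy-Y)\quad\text{and}\quad (Wx-X)^2+(Wy-Y)^2-d^2W^2,$$ respectively, by dividing out the content with respect to $t$ (the gcd in $\mathbb{C}[t]$ of the coefficients as a polynomial in $x,y$), and let $H(x,y)=\mathrm{Res}_t(P,Q)$. All equations between polynomials below are up to a nonzero constant factor. Then the following holds. (0) $\mathcal{O}_d(\mathcal{C})$ has one or two irreducible components, at most one of them is special, and if there is only one component then it is simple. So there are polynomials $f_1,f_2\in\mathbb{C}[x,y]$ such that $f_1$ is irreducible and defines a component, $f_2=1$ if there is only one component, $f_2$ is irreducible and defines the other component if there are two, and $f_2$ defines the special component if there is one. Moreover $H=F\cdot G$, where $F$ is an implicit equation of $\mathcal{O}_d(\mathcal{C})$ (its zero set is $\mathcal{O}_d(\mathcal{C})$) and $G$ is a nonzero constant times a (possibly empty) product of linear polynomials whose lines are not contained in $\mathcal{O}_d(\mathcal{C})$. For every such factorization $H=F\cdot G$ and all such $f_1,f_2$: (1) If $\mathcal{O}_d(\mathcal{C})$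 has no special component, then $F=f_1\cdot f_2$; in particular $F$ is square-free. (2) If $\mathcal{O}_d(\mathcal{C})$ has a special component, then $F=f_1\cdot f_2^2$. -/

import Mathlib

noncomputable section

namespace Offset

/-! ### Plane algebraic sets over `ℂ` -/

/-- The complex affine plane. -/
abbrev Plane : Type := Fin 2 → ℂ

/-- Polynomials in `x` (variable `0`) and `y` (variable `1`) with complex coefficients. -/
abbrev PolyXY : Type := MvPolynomial (Fin 2) ℂ

/-- The zero set of a polynomial in the plane. -/
def zeroSet (f : PolyXY) : Set Plane :=
  {p | MvPolynomial.eval p f = 0}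

/-- The Zariski closure of a subset of the plane. -/
def zariskiClosure (S : Set Plane) : Set Plane :=
  MvPolynomial.zeroLocus ℂ (MvPolynomial.vanishingIdeal ℂ S)

/-- Irreducible Zariski closed subsets of the plane. -/
def IsIrreducibleClosed (D : Set Plane) : Prop :=
  zariskiClosure D = D ∧ (MvPolynomial.vanishingIdeal ℂ D).IsPrime

/-- `D` is an irreducible component of `Z`: a maximal irreducible closed subset. -/
def IsComponent (D Z : Set Plane) : Prop :=
  Maximal (fun E : Set Plane => IsIrreducibleClosed E ∧ E ⊆ Z) D

/-- A line with real coefficients (its set of complex points). -/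
def IsLine (Z : Set Plane) : Prop :=
  ∃ a b c : ℝ, (a ≠ 0 ∨ b ≠ 0) ∧ Z = {p | (a : ℂ) * p 0 + (b : ℂ) * p 1 = (c : ℂ)}

/-- A circle with real center and positive radius (its set of complex points). -/
def IsCircle (Z : Set Plane) : Prop :=
  ∃ a b r : ℝ, 0 < r ∧ Z = {p | (p 0 - (a : ℂ)) ^ 2 + (p 1 - (b : ℂ)) ^ 2 = (r : ℂ) ^ 2}

/-! ### Polynomials in `x, y, t` -/

/-- Polynomials in `x, y, t`, written as polynomials in `t` over `ℂ[x, y]`. -/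
abbrev PolyXYT : Type := Polynomial PolyXY

/-- A complex polynomial in `t`, seen as a polynomial in `x, y, t`. -/
def inT (p : Polynomial ℂ) : PolyXYT :=
  p.map MvPolynomial.C

/-- A real polynomial in `t`, seen as a polynomial in `x, y, t`. -/
def realInT (p : Polynomial ℝ) : PolyXYT :=
  inT (p.map Complex.ofRealHom)

/-- The variable `x`. -/
def varX : PolyXYT := Polynomial.C (MvPolynomial.X 0)

/-- The variable `y`. -/
def varY : PolyXYT := Polynomial.C (MvPolynomial.X 1)

/-- `P` is the primitive part of `A` with respect to `t`, i.e. `A = c(t) * P` where `c` is the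
content of `A` with respect to `t` (the gcd of the coefficients of `A` as a polynomial in `x, y`
over `ℂ[t]`). Like the gcd, it is determined up to a nonzero constant. -/
def IsPrimitivePartT (A P : PolyXYT) : Prop :=
  (∃ c : Polynomial ℂ, c ≠ 0 ∧ A = inT c * P) ∧ ∀ e : Polynomial ℂ, inT e ∣ P → IsUnit e

/-! ### Rational parametrizations and offsets -/

/-- A real rational parametrization `t ↦ (X(t)/W(t), Y(t)/W(t))` with `gcd(X, Y, W) = 1`. -/
structure RatParam where
  X : Polynomial ℝ
  Y : Polynomial ℝ
  W : Polynomial ℝ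
  W_ne_zero : W ≠ 0
  gcd_eq_one : ∀ e : Polynomial ℝ, e ∣ X → e ∣ Y → e ∣ W → IsUnit e

namespace RatParam

variable (φ : RatParam)

/-- `U = X' W - X W'`. -/
def U : Polynomial ℝ :=
  Polynomial.derivative φ.X * φ.W - φ.X * Polynomial.derivative φ.W

/-- `V = Y' W - Y W'`. -/
def V : Polynomial ℝ :=
  Polynomial.derivative φ.Y * φ.W - φ.Y * Polynomial.derivative φ.W

/-- The parameter `t` yields an affine point. -/
def IsDefinedAt (t : ℂ) : Prop :=
  Polynomial.aeval t φ.W ≠ 0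

/-- The point `(X(t)/W(t), Y(t)/W(t))`; meaningful where `W(t) ≠ 0`. -/
def point (t : ℂ) : Plane :=
  ![Polynomial.aeval t φ.X / Polynomial.aeval t φ.W,
    Polynomial.aeval t φ.Y / Polynomial.aeval t φ.W]

/-- The curve: Zariski closure of the set of points of the parametrization. -/
def curve : Set Plane :=
  zariskiClosure {p | ∃ t : ℂ, φ.IsDefinedAt t ∧ p = φ.point t}

/-- The parametrization is injective up to finitely many parameter values. -/
def IsProper : Prop :=
  {t : ℂ | φ.IsDefinedAt t ∧
    ∃ t' : ℂ, φ.IsDefinedAt t' ∧ t' ≠ t ∧ φ.point t' = φ.point t}.Finite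

/-- The parameter `t` generates `q` at distance `d`: `q = φ(t) ± d (V, -U) / √(U² + V²)`, where
`W(t) ≠ 0` and `U(t)² + V(t)² ≠ 0`. The two signs are the two square roots `s`. -/
def ParamGenerates (d : ℝ) (t : ℂ) (q : Plane) : Prop :=
  φ.IsDefinedAt t ∧ ∃ s : ℂ, s ≠ 0 ∧
    s ^ 2 = (Polynomial.aeval t φ.U) ^ 2 + (Polynomial.aeval t φ.V) ^ 2 ∧
    q = ![φ.point t 0 + (d : ℂ) * Polynomial.aeval t φ.V / s,
          φ.point t 1 - (d : ℂ) * Polynomial.aeval t φ.U / s]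

/-- The point `p` of the curve generates the offset point `q`. -/
def Generates (d : ℝ) (p q : Plane) : Prop :=
  ∃ t : ℂ, p = φ.point t ∧ φ.ParamGenerates d t q

/-- The offset of the curve at distance `d`. -/
def offset (d : ℝ) : Set Plane :=
  zariskiClosure {q | ∃ t : ℂ, φ.ParamGenerates d t q}

/-- A simple component of the offset: almost every point of it is generated by exactly one point
of the curve. -/
def IsSimpleComponent (d : ℝ) (D : Set Plane) : Prop :=
  IsComponent D (φ.offset d) ∧ {q ∈ D | ¬ ∃! p : Plane, φ.Generates d p q}.Finite

/-- A special component of the offset: a component that is not simple. -/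
def IsSpecialComponent (d : ℝ) (D : Set Plane) : Prop :=
  IsComponent D (φ.offset d) ∧ ¬ φ.IsSimpleComponent d D

/-- The offset has a special component. -/
def HasSpecialComponent (d : ℝ) : Prop :=
  ∃ D : Set Plane, φ.IsSpecialComponent d D

/-- `U (W x - X) + V (W y - Y)`: the equation of the normal line at `t`. -/
def normalPoly : PolyXYT :=
  realInT φ.U * (realInT φ.W * varX - realInT φ.X) +
    realInT φ.V * (realInT φ.W * varY - realInT φ.Y)

/-- `(W x - X)² + (W y - Y)² - d² W²`: the equation of the circle of radius `d` at `t`. -/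
def circlePoly (d : ℝ) : PolyXYT :=
  (realInT φ.W * varX - realInT φ.X) ^ 2 + (realInT φ.W * varY - realInT φ.Y) ^ 2 -
    realInT (Polynomial.C (d ^ 2) * φ.W ^ 2)

/-- `H = F * G`, where `F` is an implicit equation of the offset, and the extraneous factor `G` is
a constant times a (possibly empty) product of linear polynomials, none of whose lines lies in the
offset. -/
def IsNonExtraneousPart (d : ℝ) (H F G : PolyXY) : Prop :=
  H = F * G ∧ zeroSet F = φ.offset d ∧
    ∃ (c : ℂ) (L : Multiset PolyXY), c ≠ 0 ∧ G = MvPolynomial.C c * L.prod ∧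
      ∀ l ∈ L, l.totalDegree = 1 ∧ ¬ zeroSet l ⊆ φ.offset d

/-- `f₁` and `f₂` are implicit equations of the components of the offset: `f₁` is irreducible,
`f₂` is irreducible if there is a second component and `f₂ = 1` otherwise, and a special
component, if there is one, is the one given by `f₂`. -/
structure IsComponentEquations (d : ℝ) (f₁ f₂ : PolyXY) : Prop where
  irreducible_fst : Irreducible f₁
  irreducible_snd : f₂ ≠ 1 → Irreducible f₂
  component_iff : ∀ D : Set Plane,
    IsComponent D (φ.offset d) ↔ D = zeroSet f₁ ∨ (f₂ ≠ 1 ∧ D = zeroSet f₂)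
  distinct : f₂ ≠ 1 → zeroSet f₁ ≠ zeroSet f₂
  special : ∀ D : Set Plane, φ.IsSpecialComponent d D → f₂ ≠ 1 ∧ D = zeroSet f₂

end RatParam

end Offset

end

/-! ### Plane curves: Zariski closure, Nullstellensatz, finiteness of intersections. -/

noncomputable section
namespace Offset

open MvPolynomial

/-! Write E = U² + V². The offset is the closure of the image of the curve of flags (t, s), s² =
E(t), where s selects one of the two unit normals. This curve has a single branch if E is not a
square in ℂ[t], and two branches s = ±S(t) if E = S². The offset of each branch is an irreducible
plane curve (`IsBranch.exists_isEquation`).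

The multiplicity in H of the equation f of a branch is found by restricting to the normal line
through a generic offset point q. Every flag generating q has its tangent parallel to that of the
offset at q, hence shares this normal line. By properness there remain only the given flag and at
most one parameter on the opposite side, at φ(t) + 2d n (`IsEquation.eventually_fiber`). At each
generating parameter P vanishes identically along the line, and this parameter is a simple root of P
at q; so H restricts to the product of the values of Q there, times a factor nonzero at q
(`lineHom_resultant`). Each circle crosses the line transversally, and so does f. Hence the
multiplicity is the number of generating parameters: 1 in the simple case, 2 in the special one
(`IsEquation.simple_or_special`).

Two opposite flags give, after reversing s, a translation of the curve by 2d along its normals.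
Iterating it puts infinitely many points of the curve on one normal, and the curve would be a line
(`IsBranch.not_eventually_translate`). This excludes a double irreducible flag curve, two coinciding
branches and, with 4d in place of 2d, two double branches.

Finally, off the lines given by the leading coefficient of P and by P at bad parameters, a zero of H
is an offset point, so the remaining factors of H are linear
(`subset_offset_or_totalDegree_eq_one`). No branch has a line as its offset
(`IsEquation.not_dvd_affinePoly`), so these lines do not disturb the multiplicities. -/

theorem mem_zeroSet {f : PolyXY} {p : Plane} : p ∈ zeroSet f ↔ eval p f = 0 := Iff.rfl

theorem mem_zariskiClosure {S : Set Plane} {p : Plane} :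
    p ∈ zariskiClosure S ↔ ∀ g : PolyXY, (∀ q ∈ S, eval q g = 0) → eval p g = 0 := by
  simp only [zariskiClosure, mem_zeroLocus_iff, mem_vanishingIdeal_iff, ← coe_aeval_eq_eval,
    RingHom.coe_coe]

theorem subset_zariskiClosure (S : Set Plane) : S ⊆ zariskiClosure S :=
  fun _ hp => mem_zariskiClosure.2 fun _ hg => hg _ hp

theorem zariskiClosure_subset_zeroSet {S : Set Plane} {f : PolyXY} (h : S ⊆ zeroSet f) :
    zariskiClosure S ⊆ zeroSet f :=
  fun _ hp => mem_zariskiClosure.1 hp f h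

theorem zariskiClosure_mono {S T : Set Plane} (h : S ⊆ T) : zariskiClosure S ⊆ zariskiClosure T :=
  fun _ hp => mem_zariskiClosure.2 fun g hg => mem_zariskiClosure.1 hp g fun q hq => hg q (h hq)

theorem zariskiClosure_zeroSet (f : PolyXY) : zariskiClosure (zeroSet f) = zeroSet f :=
  (zariskiClosure_subset_zeroSet subset_rfl).antisymm (subset_zariskiClosure _)

theorem zeroSet_mul (f g : PolyXY) : zeroSet (f * g) = zeroSet f ∪ zeroSet g := by
  ext p; simp [mem_zeroSet]

theorem zeroSet_one : zeroSet 1 = ∅ := by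
  ext p; simp [mem_zeroSet]

theorem zeroSet_subset_of_dvd {f g : PolyXY} (h : f ∣ g) : zeroSet f ⊆ zeroSet g := by
  obtain ⟨k, rfl⟩ := h
  rw [zeroSet_mul]; exact Set.subset_union_left

theorem zeroSet_eq_of_associated {f g : PolyXY} (h : Associated f g) : zeroSet f = zeroSet g :=
  (zeroSet_subset_of_dvd h.dvd).antisymm (zeroSet_subset_of_dvd h.symm.dvd)

theorem vanishingIdeal_zeroSet {f : PolyXY} (hf : Irreducible f) :
    vanishingIdeal ℂ (zeroSet f) = Ideal.span {f} := by
  have h1 : zeroSet f = zeroLocus ℂ (Ideal.span {f}) := by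
    rw [zeroLocus_span]; ext p; simp [mem_zeroSet, aeval_eq_eval]
  have hp : (Ideal.span {f}).IsPrime := (Ideal.span_singleton_prime hf.ne_zero).2 hf.prime
  rw [h1, vanishingIdeal_zeroLocus_eq_radical, hp.radical]

/-- The Nullstellensatz for a plane curve. -/
theorem dvd_of_zeroSet_subset {f g : PolyXY} (hf : Irreducible f) (h : zeroSet f ⊆ zeroSet g) :
    f ∣ g := by
  rw [← Ideal.mem_span_singleton, ← vanishingIdeal_zeroSet hf, mem_vanishingIdeal_iff]
  intro p hp
  rw [aeval_eq_eval]
  exact h hp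

theorem isIrreducibleClosed_zeroSet {f : PolyXY} (hf : Irreducible f) :
    IsIrreducibleClosed (zeroSet f) := by
  refine ⟨zariskiClosure_zeroSet f, ?_⟩
  rw [vanishingIdeal_zeroSet hf]
  exact (Ideal.span_singleton_prime hf.ne_zero).2 hf.prime

theorem IsIrreducibleClosed.subset_or_subset {E : Set Plane} (hE : IsIrreducibleClosed E)
    {f g : PolyXY} (h : E ⊆ zeroSet f ∪ zeroSet g) : E ⊆ zeroSet f ∨ E ⊆ zeroSet g := by
  have : f * g ∈ vanishingIdeal ℂ E := by
    rw [mem_vanishingIdeal_iff]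
    intro p hp
    rw [aeval_eq_eval]
    have := h hp
    rwa [← zeroSet_mul] at this
  refine (hE.2.mem_or_mem this).imp ?_ ?_ <;>
  · intro h p hp
    have := mem_vanishingIdeal_iff.1 h p hp
    rwa [aeval_eq_eval] at this

theorem finite_maximalSpectrum_of_ringKrullDim_le_zero {A : Type*} [CommRing A]
    [IsNoetherianRing A] (h : ringKrullDim A ≤ 0) : Finite (MaximalSpectrum A) := by
  have : Ring.KrullDimLE 0 A := Ring.krullDimLE_iff.2 h
  have : IsArtinianRing A := isArtinianRing_iff_isNoetherianRing_krullDimLE_zero.2 ⟨‹_›, this⟩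
  infer_instance

/-- Two plane curves without a common component meet in finitely many points. -/
theorem finite_inter_zeroSet {f g : PolyXY} (hf : Irreducible f) (h : ¬ f ∣ g) :
    (zeroSet f ∩ zeroSet g).Finite := by
  let I : Ideal PolyXY := Ideal.span {f}
  have hI : I.IsPrime := (Ideal.span_singleton_prime hf.ne_zero).2 hf.prime
  let g' : PolyXY ⧸ I := Ideal.Quotient.mk I g
  have hg' : g' ≠ 0 := by
    simpa [g', Ideal.Quotient.eq_zero_iff_mem, I, Ideal.mem_span_singleton] using h
  let A := (PolyXY ⧸ I) ⧸ Ideal.span {g'}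
  -- f, and then g modulo f, are nonzero elements of a domain; each lowers the dimension by at least
  -- one.
  have hA : ringKrullDim A + 1 + 1 ≤ 2 := by
    have h1 : ringKrullDim A + 1 ≤ ringKrullDim (PolyXY ⧸ I) :=
      ringKrullDim_quotient_succ_le_of_nonZeroDivisor (mem_nonZeroDivisors_of_ne_zero hg')
    have h2 : ringKrullDim (PolyXY ⧸ I) + 1 ≤ ringKrullDim PolyXY :=
      ringKrullDim_quotient_succ_le_of_nonZeroDivisor (mem_nonZeroDivisors_of_ne_zero hf.ne_zero)
    have h3 : ringKrullDim PolyXY = 2 := by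
      rw [MvPolynomial.ringKrullDim_of_isNoetherianRing]; simp
    rw [h3] at h2
    exact (by gcongr : _ ≤ _).trans h2
  have hA0 : ringKrullDim A ≤ 0 := by
    generalize ringKrullDim A = k at hA
    induction k with
    | bot => simp
    | coe k =>
      induction k with
      | top => exact absurd hA (by decide)
      | coe k =>
        have : (k + 1 + 1 : ℕ) ≤ 2 := by
          exact_mod_cast (WithBot.coe_le_coe.1 hA : ((k : ℕ∞) + 1 + 1) ≤ 2)
        have : k = 0 := by omega
        simp [this]
  have : Finite (MaximalSpectrum A) := finite_maximalSpectrum_of_ringKrullDim_le_zero (A := A) hA0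
  let ev (p : (zeroSet f ∩ zeroSet g : Set Plane)) : A →+* ℂ :=
    Ideal.Quotient.lift _ (Ideal.Quotient.lift I (eval p.1) (by
      intro a ha
      obtain ⟨b, rfl⟩ := Ideal.mem_span_singleton.1 ha
      have : eval p.1 f = 0 := p.2.1
      simp [this])) (by
      intro a ha
      obtain ⟨b, rfl⟩ := Ideal.mem_span_singleton.1 ha
      have : eval p.1 g = 0 := p.2.2
      simp [g', this])
  have hev (p) (a : PolyXY) : ev p (Ideal.Quotient.mk _ (Ideal.Quotient.mk _ a)) = eval p.1 a :=
    rfl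
  -- A common zero is recovered from the kernel of its evaluation, which contains X i - p i; so the
  -- common zeros inject into a finite spectrum.
  let m (p : (zeroSet f ∩ zeroSet g : Set Plane)) : MaximalSpectrum A :=
    ⟨RingHom.ker (ev p), RingHom.ker_isMaximal_of_surjective _ fun z =>
      ⟨Ideal.Quotient.mk _ (Ideal.Quotient.mk _ (C z)), by simp [hev]⟩⟩
  have hm : Function.Injective m := by
    intro p q hpq
    have hk : RingHom.ker (ev p) = RingHom.ker (ev q) := congrArg MaximalSpectrum.asIdeal hpq
    ext i
    have : Ideal.Quotient.mk _ (Ideal.Quotient.mk _ (X i - C (p.1 i))) ∈ RingHom.ker (ev p) := by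
      rw [RingHom.mem_ker, hev]; simp
    rw [hk, RingHom.mem_ker, hev] at this
    simp only [map_sub, eval_X, eval_C] at this
    exact (sub_eq_zero.1 this).symm
  exact Set.finite_coe_iff.1 (Finite.of_injective m hm)

/-- The Zariski closure of an infinite subset of an irreducible curve is the whole curve. -/
theorem zariskiClosure_eq_zeroSet {f : PolyXY} (hf : Irreducible f) {S : Set Plane}
    (hS : S.Infinite) (h : S ⊆ zeroSet f) : zariskiClosure S = zeroSet f := by
  refine (zariskiClosure_subset_zeroSet h).antisymm fun p hp => mem_zariskiClosure.2 fun g hg => ?_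
  have : f ∣ g := by
    by_contra hfg
    exact hS ((finite_inter_zeroSet hf hfg).subset fun q hq => ⟨h hq, hg q hq⟩)
  exact zeroSet_subset_of_dvd this hp

theorem zariskiClosure_union_zeroSet {S T : Set Plane} {f g : PolyXY}
    (hS : zariskiClosure S = zeroSet f) (hT : zariskiClosure T = zeroSet g) :
    zariskiClosure (S ∪ T) = zeroSet f ∪ zeroSet g := by
  apply Set.Subset.antisymm
  · rw [← zeroSet_mul]
    apply zariskiClosure_subset_zeroSet
    rw [zeroSet_mul, ← hS, ← hT]
    exact Set.union_subset_union (subset_zariskiClosure _) (subset_zariskiClosure _)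
  · rw [← hS, ← hT]
    exact Set.union_subset (zariskiClosure_mono Set.subset_union_left)
      (zariskiClosure_mono Set.subset_union_right)

theorem exists_irreducible_of_isPrime {I : Ideal PolyXY} (hI : I.IsPrime) (h0 : I ≠ ⊥) :
    ∃ f ∈ I, Irreducible f := by
  obtain ⟨f, hf, hp⟩ := Ideal.IsPrime.exists_mem_prime_of_ne_bot hI h0
  exact ⟨f, hf, hp.irreducible⟩

/-! ### Derivatives -/

theorem hasDerivAt_eval_comp (f : PolyXY) {γ : ℂ → Plane} {v : Plane} {t : ℂ}
    (h : ∀ i, HasDerivAt (fun τ => γ τ i) (v i) t) :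
    HasDerivAt (fun τ => eval (γ τ) f)
      (eval (γ t) (pderiv 0 f) * v 0 + eval (γ t) (pderiv 1 f) * v 1) t := by
  induction f using MvPolynomial.induction_on with
  | C a => simpa using hasDerivAt_const t a
  | add p q hp hq =>
    simp only [map_add]
    exact (hp.add hq).congr_deriv (by ring)
  | mul_X p i hp =>
    simp only [map_mul, eval_X, pderiv_mul]
    refine (hp.mul (h i)).congr_deriv ?_
    fin_cases i <;> simp [pderiv_X] <;> ring

/-- Restriction of polynomials to the line through `q` with direction `v`. -/
def lineHom (q v : Plane) : PolyXY →+* Polynomial ℂ :=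
  eval₂Hom Polynomial.C fun i => Polynomial.C (q i) + Polynomial.C (v i) * Polynomial.X

@[simp]
theorem lineHom_C (q v : Plane) (a : ℂ) : lineHom q v (C a) = Polynomial.C a := by
  simp [lineHom]

@[simp]
theorem lineHom_X (q v : Plane) (i : Fin 2) :
    lineHom q v (X i) = Polynomial.C (q i) + Polynomial.C (v i) * Polynomial.X := by
  simp [lineHom]

theorem evalRingHom_zero_comp_lineHom (q v : Plane) :
    (Polynomial.evalRingHom 0).comp (lineHom q v) = eval q := by
  apply MvPolynomial.ringHom_ext <;> simp

@[simp]
theorem eval_zero_lineHom (q v : Plane) (f : PolyXY) : (lineHom q v f).eval 0 = eval q f := by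
  simpa using congrArg (fun h : PolyXY →+* ℂ => h f) (evalRingHom_zero_comp_lineHom q v)

theorem derivative_lineHom (q v : Plane) (f : PolyXY) :
    Polynomial.derivative (lineHom q v f) =
      lineHom q v (pderiv 0 f) * Polynomial.C (v 0) +
        lineHom q v (pderiv 1 f) * Polynomial.C (v 1) := by
  induction f using MvPolynomial.induction_on with
  | C a => simp
  | add p q hp hq => simp only [map_add, hp, hq]; ring
  | mul_X p i hp =>
    simp only [map_mul, Polynomial.derivative_mul, hp, pderiv_mul, map_add]
    fin_cases i <;> simp [pderiv_X] <;> ring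

/-- The line is transversal to the curve at `q`: the derivative of the restriction is the
directional derivative of `f`. -/
theorem rootMultiplicity_lineHom_eq_one {q v : Plane} {f : PolyXY} (hq : eval q f = 0)
    (hv : eval q (pderiv 0 f) * v 0 + eval q (pderiv 1 f) * v 1 ≠ 0) :
    (lineHom q v f).rootMultiplicity 0 = 1 := by
  have hd : (Polynomial.derivative (lineHom q v f)).eval 0 ≠ 0 := by
    simpa [derivative_lineHom] using hv
  have h0 : lineHom q v f ≠ 0 := by
    intro h; simp [h] at hd
  apply le_antisymm
  · by_contra! h
    have := (Polynomial.one_lt_rootMultiplicity_iff_isRoot h0).1 h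
    exact hd this.2
  · rw [Nat.one_le_iff_ne_zero, ← Nat.pos_iff_ne_zero, Polynomial.rootMultiplicity_pos h0]
    simpa [Polynomial.IsRoot] using hq

theorem totalDegree_pderiv_lt {f : PolyXY} {i : Fin 2} (h : pderiv i f ≠ 0) :
    (pderiv i f).totalDegree < f.totalDegree := by
  obtain ⟨m, hm, hmd⟩ := Finset.exists_mem_eq_sup _ (support_nonempty.2 h)
    fun m : Fin 2 →₀ ℕ => m.degree
  have h1 : (pderiv i f).totalDegree = m.degree := by
    rw [← hmd, totalDegree]; rfl
  rw [mem_support_iff, coeff_pderiv] at hm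
  have := le_totalDegree (mem_support_iff.2 (left_ne_zero_of_mul hm))
  rw [h1]
  have h2 : (m + Finsupp.single i 1).degree = m.degree + 1 := by simp
  have h3 : (m + Finsupp.single i 1).degree ≤ f.totalDegree := this
  omega

theorem totalDegree_le_of_dvd {f g : PolyXY} (hg : g ≠ 0) (h : f ∣ g) :
    f.totalDegree ≤ g.totalDegree := by
  obtain ⟨k, rfl⟩ := h
  rw [totalDegree_mul_of_isDomain (left_ne_zero_of_mul hg) (right_ne_zero_of_mul hg)]
  omega

theorem totalDegree_ne_zero_of_irreducible {f : PolyXY} (hf : Irreducible f) :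
    f.totalDegree ≠ 0 := by
  intro h
  rw [totalDegree_eq_zero_iff_eq_C] at h
  rw [h] at hf
  refine hf.not_isUnit ((isUnit_iff_ne_zero.2 fun h0 => ?_).map C)
  simp [h0] at hf

/-- Divisibility would force both partial derivatives to vanish by degree, and in characteristic
zero `f` would be constant. Consequently the gradient is nonzero at generic points of the curve. -/
theorem exists_not_dvd_pderiv {f : PolyXY} (hf : Irreducible f) : ∃ i, ¬ f ∣ pderiv i f := by
  by_contra! h
  have h0 (i) : pderiv i f = 0 := by
    by_contra h0
    exact absurd (totalDegree_le_of_dvd h0 (h i)) (not_le.2 (totalDegree_pderiv_lt h0))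
  apply totalDegree_ne_zero_of_irreducible hf
  rw [totalDegree_eq_zero_iff]
  intro m hm i
  by_contra hmi
  have : coeff (m - Finsupp.single i 1) (pderiv i f) = 0 := by rw [h0]; simp
  rw [coeff_pderiv, tsub_add_cancel_of_le (by simpa using Nat.one_le_iff_ne_zero.2 hmi)] at this
  refine (mul_ne_zero (mem_support_iff.1 hm) ?_) this
  exact Nat.cast_add_one_ne_zero _

end Offset
end

noncomputable section
namespace Offset

open MvPolynomial

/-! ### Specialization and resultants -/

theorem eval_map_hom {R S : Type*} [CommRing R] [CommRing S] (ρ : R →+* S) (P : Polynomial R)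
    (a : R) : (P.map ρ).eval (ρ a) = ρ (P.eval a) := by
  rw [Polynomial.eval_map, Polynomial.eval₂_at_apply]

theorem eval_map_eval (P : PolyXYT) (q : Plane) (t : ℂ) :
    (P.map (eval q)).eval t = eval q (P.eval (C t)) := by
  simpa using eval_map_hom (eval q) P (C t)

theorem eval_map_lineHom (P : PolyXYT) (q v : Plane) (t : ℂ) :
    (P.map (lineHom q v)).eval (Polynomial.C t) = lineHom q v (P.eval (C t)) := by
  simpa using eval_map_hom (lineHom q v) P (C t)

@[simp]
theorem eval_inT (c : Polynomial ℂ) (t : ℂ) : (inT c).eval (C t) = C (c.eval t) := by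
  rw [inT, eval_map_hom]

@[simp]
theorem map_inT (c : Polynomial ℂ) (q : Plane) : (inT c).map (eval q) = c := by
  have h : (eval q).comp C = RingHom.id ℂ := RingHom.ext fun z => by simp
  rw [inT, Polynomial.map_map, h, Polynomial.map_id]

theorem inT_injective : Function.Injective inT :=
  Polynomial.map_injective _ (C_injective _ _)

theorem inT_ne_zero {c : Polynomial ℂ} (hc : c ≠ 0) : inT c ≠ 0 := by
  rw [← Polynomial.map_zero (C : ℂ →+* PolyXY)]
  exact fun h => hc (inT_injective h)

/-- For coprime specializations with nonvanishing leading coefficient the resultant does not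
vanish. -/
theorem resultant_ne_zero_of_forall_root {p l : Polynomial ℂ} (hp : p ≠ 0) {m : ℕ}
    (hm : l.natDegree ≤ m) (h : ∀ t, p.eval t = 0 → l.eval t ≠ 0) :
    Polynomial.resultant p l p.natDegree m ≠ 0 := by
  rw [Polynomial.resultant_eq_prod_eval _ _ _ hm (IsAlgClosed.splits p)]
  refine mul_ne_zero (pow_ne_zero _ (Polynomial.leadingCoeff_ne_zero.2 hp)) ?_
  rw [Ne, Multiset.prod_eq_zero_iff, Multiset.mem_map]
  rintro ⟨t, ht, h0⟩
  exact h t (Polynomial.isRoot_of_mem_roots ht) h0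

theorem resultant_eq_zero_of_root {p l : Polynomial ℂ} (hp : p ≠ 0) {m : ℕ}
    (hm : l.natDegree ≤ m) {t : ℂ} (h : p.eval t = 0) (h' : l.eval t = 0) :
    Polynomial.resultant p l p.natDegree m = 0 := by
  rw [Polynomial.resultant_eq_prod_eval _ _ _ hm (IsAlgClosed.splits p)]
  refine mul_eq_zero_of_right _ (Multiset.prod_eq_zero_iff.2 (Multiset.mem_map.2 ⟨t, ?_, h'⟩))
  exact (Polynomial.mem_roots hp).2 h

theorem map_ne_zero_of_eval_leadingCoeff {P : PolyXYT} {q : Plane}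
    (h : eval q P.leadingCoeff ≠ 0) : P.map (eval q) ≠ 0 := by
  intro h0
  apply h
  rw [Polynomial.leadingCoeff, ← Polynomial.coeff_map, h0, Polynomial.coeff_zero]

/-- Only the leading coefficient of `P` has to survive specialization: the product formula runs over
the roots of `P`, and `L.natDegree` is still an admissible formal degree for the specialized `L`. -/
theorem eval_resultant_eq_zero_iff {P L : PolyXYT} {q : Plane}
    (h : eval q P.leadingCoeff ≠ 0) :
    eval q (Polynomial.resultant P L) = 0 ↔
      ∃ t, eval q (P.eval (C t)) = 0 ∧ eval q (L.eval (C t)) = 0 := by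
  have h0 := map_ne_zero_of_eval_leadingCoeff h
  rw [← Polynomial.resultant_map_map, ← Polynomial.natDegree_map_of_leadingCoeff_ne_zero _ h]
  simp only [← eval_map_eval]
  constructor
  · intro hr
    by_contra! hc
    exact resultant_ne_zero_of_forall_root h0 Polynomial.natDegree_map_le hc hr
  · rintro ⟨t, h1, h2⟩
    exact resultant_eq_zero_of_root h0 Polynomial.natDegree_map_le h1 h2

/-- If all common roots at `q` of `P` and `L` are simple roots of `P` and stay roots of `P` along a
line through `q`, then the restriction of the resultant to the line is the product of the values of
`L` at these roots, up to a factor that does not vanish at `q`. -/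
theorem lineHom_resultant {P L : PolyXYT} {q v : Plane} (S : Finset ℂ)
    (hlc : eval q P.leadingCoeff ≠ 0)
    (hroot : ∀ t ∈ S, lineHom q v (P.eval (C t)) = 0)
    (hsimple : ∀ t ∈ S, (Polynomial.derivative (P.map (eval q))).eval t ≠ 0)
    (hcommon : ∀ t, eval q (P.eval (C t)) = 0 → eval q (L.eval (C t)) = 0 → t ∈ S) :
    ∃ r : Polynomial ℂ, r.eval 0 ≠ 0 ∧
      lineHom q v (Polynomial.resultant P L) = (∏ t ∈ S, lineHom q v (L.eval (C t))) * r := by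
  set ρ := lineHom q v
  set p := P.map ρ with hp
  set l := L.map ρ with hl
  have hρ : ρ P.leadingCoeff ≠ 0 := by
    intro h0
    apply hlc
    rw [← eval_zero_lineHom q v]
    simp [ρ] at h0
    simp [h0]
  -- The roots in `S` persist along the line, so `P` restricted to it factors as `a * b` with `a`
  -- monic. The resultant of `a` with `l` is the product of values, and that of `b` with `l` is the
  -- witness `r`.
  set a : Polynomial (Polynomial ℂ) := ∏ t ∈ S, (Polynomial.X - Polynomial.C (Polynomial.C t))
    with ha
  have hmonic : a.Monic := Polynomial.monic_prod_X_sub_C _ _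
  have hdvd : a ∣ p := by
    refine Finset.prod_dvd_of_coprime (fun s _ t _ hst => ?_) fun t ht => ?_
    · refine Polynomial.isCoprime_X_sub_C_of_isUnit_sub ?_
      rw [← Polynomial.C_sub]
      exact Polynomial.isUnit_C.2 (sub_ne_zero.2 hst).isUnit
    · rw [Polynomial.dvd_iff_isRoot, Polynomial.IsRoot, hp, eval_map_lineHom]
      exact hroot t ht
  obtain ⟨b, hb⟩ := hdvd
  have hdeg : P.natDegree = a.natDegree + b.natDegree := by
    have hb0 : b ≠ 0 := by
      rintro rfl
      rw [mul_zero] at hb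
      apply hρ
      rw [Polynomial.leadingCoeff, ← Polynomial.coeff_map, ← hp, hb, Polynomial.coeff_zero]
    rw [← Polynomial.natDegree_map_of_leadingCoeff_ne_zero _ hρ, ← hp, hb,
      hmonic.natDegree_mul' hb0]
  have hlead : ρ P.leadingCoeff = b.leadingCoeff := by
    rw [← Polynomial.leadingCoeff_map_of_leadingCoeff_ne_zero _ hρ, ← hp, hb,
      Polynomial.leadingCoeff_monic_mul hmonic]
  set e := Polynomial.evalRingHom (0 : ℂ)
  have he : e.comp ρ = eval q := evalRingHom_zero_comp_lineHom q v
  have heb : e b.leadingCoeff ≠ 0 := by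
    rw [← hlead, ← RingHom.comp_apply, he]; exact hlc
  have hpq : P.map (eval q) = a.map e * b.map e := by
    rw [← Polynomial.map_mul, ← hb, hp, Polynomial.map_map, he]
  have hlq : L.map (eval q) = l.map e := by rw [hl, Polynomial.map_map, he]
  have hae : a.map e = ∏ t ∈ S, (Polynomial.X - Polynomial.C t) := by
    rw [ha, Polynomial.map_prod]
    simp [e]
  refine ⟨Polynomial.resultant b l b.natDegree L.natDegree, ?_, ?_⟩
  · change e _ ≠ 0
    rw [← Polynomial.resultant_map_map, ← Polynomial.natDegree_map_of_leadingCoeff_ne_zero _ heb]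
    refine resultant_ne_zero_of_forall_root ?_
      (Polynomial.natDegree_map_le.trans Polynomial.natDegree_map_le) fun t h1 h2 => ?_
    · intro h0
      apply heb
      rw [Polynomial.leadingCoeff, ← Polynomial.coeff_map, h0, Polynomial.coeff_zero]
    -- A root at `q` shared by `b` and `l` would lie in `S`, hence be a root of both `a` and `b`,
    -- that is, a double root of `P`.
    · have hPt : (P.map (eval q)).eval t = 0 := by rw [hpq, Polynomial.eval_mul, h1, mul_zero]
      rw [← hlq, eval_map_eval] at h2
      have htS := hcommon t (by rwa [← eval_map_eval]) h2
      refine hsimple t htS ?_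
      have hat : (a.map e).eval t = 0 := by
        rw [hae, Polynomial.eval_prod]
        exact Finset.prod_eq_zero htS (by simp)
      rw [hpq, Polynomial.derivative_mul, Polynomial.eval_add, Polynomial.eval_mul,
        Polynomial.eval_mul, h1, hat, mul_zero, zero_mul, add_zero]
  · rw [← Polynomial.resultant_map_map, ← hp, hb, hdeg,
      Polynomial.resultant_mul_left _ _ _ _ Polynomial.natDegree_map_le]
    congr 1
    rw [ha, Polynomial.resultant_prod_left _ _ _ _ (by simp) Polynomial.natDegree_map_le]
    refine Finset.prod_congr rfl fun t _ => ?_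
    rw [Polynomial.natDegree_X_sub_C,
      Polynomial.resultant_X_sub_C_left _ _ _ Polynomial.natDegree_map_le, eval_map_lineHom]

/-! ### Primitive parts with respect to `t` -/

/-- If `P` vanished identically in x, y at some t, the factor X - t would divide it, contrary to
primitivity. -/
theorem IsPrimitivePartT.eval_ne_zero {A P : PolyXYT} (h : IsPrimitivePartT A P) (t : ℂ) :
    P.eval (C t) ≠ 0 := by
  intro h0
  have : inT (Polynomial.X - Polynomial.C t) ∣ P := by
    rw [inT, Polynomial.map_sub, Polynomial.map_X, Polynomial.map_C, Polynomial.dvd_iff_isRoot]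
    exact h0
  exact Polynomial.not_isUnit_X_sub_C t (h.2 _ this)

theorem natDegree_inT (c : Polynomial ℂ) : (inT c).natDegree = c.natDegree :=
  Polynomial.natDegree_map_eq_of_injective (C_injective _ _) c

/-- Factors depending on t alone are split off until none is left; the degree in t decreases. This
supplies a `P` to statements about the offset that mention no resultant. -/
theorem exists_isPrimitivePartT {A : PolyXYT} (hA : A ≠ 0) : ∃ P, IsPrimitivePartT A P := by
  induction hn : A.natDegree using Nat.strong_induction_on generalizing A with
  | _ n ih =>
    by_cases h : ∀ e : Polynomial ℂ, inT e ∣ A → IsUnit e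
    · exact ⟨A, ⟨1, one_ne_zero, by simp [inT]⟩, h⟩
    · push Not at h
      obtain ⟨e, ⟨B, rfl⟩, he⟩ := h
      have he0 : e ≠ 0 := by
        rintro rfl
        simp [inT] at hA
      have hB : B ≠ 0 := right_ne_zero_of_mul hA
      have hd : 0 < e.natDegree := by
        rw [Nat.pos_iff_ne_zero]
        intro h0
        exact he ((Polynomial.isUnit_iff_degree_eq_zero).2
          (by rw [Polynomial.degree_eq_natDegree he0, h0]; rfl))
      rw [Polynomial.natDegree_mul (inT_ne_zero he0) hB, natDegree_inT] at hn
      obtain ⟨P, ⟨c, hc, hBP⟩, hP⟩ := ih B.natDegree (by omega) hB rfl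
      refine ⟨P, ⟨e * c, mul_ne_zero he0 hc, ?_⟩, hP⟩
      rw [hBP, inT, inT, inT, Polynomial.map_mul, mul_assoc]

/-- The affine polynomial `a x + b y + c`. -/
def affinePoly (a b c : ℂ) : PolyXY := C a * X 0 + C b * X 1 + C c

theorem totalDegree_affinePoly_le (a b c : ℂ) : (affinePoly a b c).totalDegree ≤ 1 := by
  have h (z : ℂ) (i : Fin 2) : (C z * X i : PolyXY).totalDegree ≤ 1 :=
    (totalDegree_mul _ _).trans (by simp)
  refine (totalDegree_add _ _).trans (max_le ?_ (by simp))
  exact (totalDegree_add _ _).trans (max_le (h _ _) (h _ _))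

@[simp]
theorem eval_affinePoly (a b c : ℂ) (p : Plane) :
    eval p (affinePoly a b c) = a * p 0 + b * p 1 + c := by
  simp [affinePoly]

end Offset
end

/-! ### Density of infinite subsets of lines and circles; degenerate parametrizations. -/

noncomputable section
namespace Offset

open MvPolynomial

/-- If a subalgebra of functions contains `δ` and all `δ * z i`, then it contains
`δ ^ n * g(z)` for every polynomial `g` and some `n`. -/
theorem exists_pow_mul_eval_mem {T : Type*} (A : Subalgebra ℂ (T → ℂ)) {δ : T → ℂ}
    {z : T → Plane} (hδ : δ ∈ A) (hz : ∀ i, (fun τ => δ τ * z τ i) ∈ A) (g : PolyXY) :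
    ∃ n : ℕ, (fun τ => δ τ ^ n * eval (z τ) g) ∈ A := by
  induction g using MvPolynomial.induction_on with
  | C a =>
    refine ⟨0, ?_⟩
    simp only [pow_zero, one_mul, eval_C]
    exact A.algebraMap_mem a
  | add p q hp hq =>
    obtain ⟨m, hm⟩ := hp
    obtain ⟨n, hn⟩ := hq
    refine ⟨m + n, ?_⟩
    convert A.add_mem (A.mul_mem (A.pow_mem hδ n) hm) (A.mul_mem (A.pow_mem hδ m) hn) using 1
    ext τ
    simp
    ring
  | mul_X p i hp =>
    obtain ⟨m, hm⟩ := hp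
    refine ⟨m + 1, ?_⟩
    convert A.mul_mem hm (hz i) using 1
    ext τ
    simp
    ring

theorem eval_lineHom (q v : Plane) (f : PolyXY) (τ : ℂ) :
    (lineHom q v f).eval τ = eval (fun i => q i + v i * τ) f := by
  have : (Polynomial.evalRingHom τ).comp (lineHom q v) = eval (fun i => q i + v i * τ) := by
    apply MvPolynomial.ringHom_ext <;> simp
  simpa using congrArg (fun h : PolyXY →+* ℂ => h f) this

/-- Functions of a nonzero parameter that are polynomial. -/
def polynomialFunctions : Subalgebra ℂ ({u : ℂ // u ≠ 0} → ℂ) where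
  carrier := {h | ∃ G : Polynomial ℂ, ∀ u, h u = G.eval u.1}
  mul_mem' := by
    rintro f g ⟨F, hF⟩ ⟨G, hG⟩
    exact ⟨F * G, fun u => by simp [hF, hG]⟩
  add_mem' := by
    rintro f g ⟨F, hF⟩ ⟨G, hG⟩
    exact ⟨F + G, fun u => by simp [hF, hG]⟩
  algebraMap_mem' a := ⟨Polynomial.C a, fun u => by simp⟩

/-- A polynomial restricted to the line is a polynomial in one parameter with infinitely many roots.
Since a, b are real and not both zero, a² + b² ≠ 0, so the parameter is recovered by projection. -/
theorem line_subset_zariskiClosure {a b c : ℝ} (hab : a ≠ 0 ∨ b ≠ 0) {S : Set Plane}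
    (hS : S.Infinite) (h : S ⊆ {p | (a : ℂ) * p 0 + (b : ℂ) * p 1 = (c : ℂ)}) :
    {p | (a : ℂ) * p 0 + (b : ℂ) * p 1 = (c : ℂ)} ⊆ zariskiClosure S := by
  intro p hp
  have hab2 : (a : ℂ) ^ 2 + (b : ℂ) ^ 2 ≠ 0 := by
    have : a ^ 2 + b ^ 2 ≠ 0 := by rcases hab with h | h <;> positivity
    exact_mod_cast this
  refine mem_zariskiClosure.2 fun g hg => ?_
  let v : Plane := ![-b, a]
  let τ (q : Plane) : ℂ := (-b * (q 0 - p 0) + a * (q 1 - p 1)) / ((a : ℂ) ^ 2 + (b : ℂ) ^ 2)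
  have hτ (q) (hq : q ∈ S) : (fun i => p i + v i * τ q) = q := by
    have h1 : (a : ℂ) * (q 0 - p 0) + b * (q 1 - p 1) = 0 := by
      have h1 : (a : ℂ) * q 0 + b * q 1 = c := h hq
      have h2 : (a : ℂ) * p 0 + b * p 1 = c := hp
      linear_combination h1 - h2
    ext i
    fin_cases i
    · simp only [v, τ, Fin.zero_eta, Matrix.cons_val_zero]
      field_simp
      linear_combination (-a : ℂ) * h1
    · simp only [v, τ, Fin.mk_one, Matrix.cons_val_one, Matrix.cons_val_zero]
      field_simp
      linear_combination (-b : ℂ) * h1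
  have hz : lineHom p v g = 0 := by
    refine Polynomial.eq_zero_of_infinite_isRoot _ (Set.Infinite.mono ?_
      (hS.image (f := τ) fun q hq q' hq' hqq' => ?_))
    · rintro _ ⟨q, hq, rfl⟩
      rw [Set.mem_ofPred_eq, Polynomial.IsRoot, eval_lineHom, hτ q hq]
      exact hg q hq
    · rw [← hτ q hq, ← hτ q' hq', hqq']
  rw [← eval_zero_lineHom p v, hz, Polynomial.eval_zero]

/-- The circle is parametrized by u = (x - a) + i(y - b), with r² / u = (x - a) - i(y - b). A power
of u turns a polynomial on the circle into a polynomial in u, which has infinitely many roots. -/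
theorem circle_subset_zariskiClosure {a b r : ℂ} (hr : r ≠ 0) {S : Set Plane}
    (hS : S.Infinite) (h : S ⊆ {p | (p 0 - a) ^ 2 + (p 1 - b) ^ 2 = r ^ 2}) :
    {p | (p 0 - a) ^ 2 + (p 1 - b) ^ 2 = r ^ 2} ⊆ zariskiClosure S := by
  intro p hp
  refine mem_zariskiClosure.2 fun g hg => ?_
  let z (u : {u : ℂ // u ≠ 0}) : Plane :=
    ![a + (u.1 + r ^ 2 / u.1) / 2, b - Complex.I * (u.1 - r ^ 2 / u.1) / 2]
  obtain ⟨n, G, hG⟩ := exists_pow_mul_eval_mem polynomialFunctions (δ := fun u => u.1) (z := z)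
    ⟨Polynomial.X, by simp⟩ (by
      intro i
      fin_cases i
      · refine ⟨Polynomial.C a * Polynomial.X +
          Polynomial.C (1 / 2) * (Polynomial.X ^ 2 + Polynomial.C (r ^ 2)), fun u => ?_⟩
        have := u.2
        simp [z]
        field_simp
      · refine ⟨Polynomial.C b * Polynomial.X -
          Polynomial.C (Complex.I / 2) * (Polynomial.X ^ 2 - Polynomial.C (r ^ 2)), fun u => ?_⟩
        have := u.2
        simp [z]
        field_simp) g
  beta_reduce at hG
  have hI : Complex.I ^ 2 = -1 := Complex.I_sq
  have hu (q : Plane) (hq : (q 0 - a) ^ 2 + (q 1 - b) ^ 2 = r ^ 2) :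
      ∃ u : {u : ℂ // u ≠ 0}, z u = q := by
    have hm : ((q 0 - a) + Complex.I * (q 1 - b)) * ((q 0 - a) - Complex.I * (q 1 - b)) = r ^ 2 := by
      linear_combination hq - (q 1 - b) ^ 2 * hI
    have h0 : (q 0 - a) + Complex.I * (q 1 - b) ≠ 0 := by
      intro h0
      rw [h0, zero_mul] at hm
      exact pow_ne_zero 2 hr hm.symm
    refine ⟨⟨_, h0⟩, ?_⟩
    have hdiv : r ^ 2 / ((q 0 - a) + Complex.I * (q 1 - b)) =
        (q 0 - a) - Complex.I * (q 1 - b) := by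
      rw [div_eq_iff h0, ← hm, mul_comm]
    ext i
    fin_cases i
    · simp only [z, hdiv, Fin.zero_eta, Matrix.cons_val_zero]
      ring
    · simp only [z, hdiv, Fin.mk_one, Matrix.cons_val_one, Matrix.cons_val_zero]
      linear_combination (-(q 1 - b)) * hI
  have : Nonempty {u : ℂ // u ≠ 0} := ⟨⟨1, one_ne_zero⟩⟩
  choose! u hu using hu
  have hG0 : G = 0 := by
    refine Polynomial.eq_zero_of_infinite_isRoot _ (Set.Infinite.mono ?_
      (hS.image (f := fun q => (u q).1) fun q hq q' hq' hqq' => ?_))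
    · rintro _ ⟨q, hq, rfl⟩
      rw [Set.mem_ofPred_eq, Polynomial.IsRoot, ← hG, hu q (h hq), hg q hq, mul_zero]
    · rw [← hu q (h hq), ← hu q' (h hq'), Subtype.ext hqq']
  have := hG (u p)
  rw [hu p hp, hG0, Polynomial.eval_zero] at this
  exact (mul_eq_zero.1 this).resolve_left (pow_ne_zero _ (u p).2)

theorem eventually_eq_of_hasDerivAt_zero {f : ℂ → ℂ} {t : ℂ}
    (h : ∀ᶠ τ in nhds t, HasDerivAt f 0 τ) : ∀ᶠ τ in nhds t, f τ = f t := by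
  obtain ⟨r, hr, hb⟩ := Metric.eventually_nhds_iff_ball.1 h
  refine Metric.eventually_nhds_iff_ball.2 ⟨r, hr, fun τ hτ => ?_⟩
  refine Metric.isOpen_ball.is_const_of_deriv_eq_zero (convex_ball t r).isPreconnected
    (fun x hx => (hb x hx).differentiableAt.differentiableWithinAt)
    (fun x hx => (hb x hx).deriv) hτ (Metric.mem_ball_self hr)

theorem infinite_setOf_of_eventually {p : ℂ → Prop} {t : ℂ} (h : ∀ᶠ τ in nhds t, p τ) :
    {τ | p τ}.Infinite :=
  infinite_of_mem_nhds t h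

/-- A real polynomial as a complex polynomial. -/
def toC (p : Polynomial ℝ) : Polynomial ℂ := p.map Complex.ofRealHom

theorem toC_injective : Function.Injective toC :=
  Polynomial.map_injective _ Complex.ofRealHom.injective

theorem aeval_eq_eval_toC (p : Polynomial ℝ) (t : ℂ) : Polynomial.aeval t p = (toC p).eval t := by
  rw [toC, Polynomial.eval_map]; rfl

theorem toC_map_conj (p : Polynomial ℝ) : (toC p).map (starRingEnd ℂ) = toC p := by
  ext i
  simp [toC]

namespace RatParam

variable (φ : RatParam)

def cX : Polynomial ℂ := toC φ.X
def cY : Polynomial ℂ := toC φ.Y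
def cW : Polynomial ℂ := toC φ.W
def cU : Polynomial ℂ := Polynomial.derivative φ.cX * φ.cW - φ.cX * Polynomial.derivative φ.cW
def cV : Polynomial ℂ := Polynomial.derivative φ.cY * φ.cW - φ.cY * Polynomial.derivative φ.cW

/-- The squared speed `U² + V²`. -/
def cE : Polynomial ℂ := φ.cU ^ 2 + φ.cV ^ 2

theorem toC_U : toC φ.U = φ.cU := by
  simp [toC, U, cU, cX, cW, Polynomial.derivative_map]

theorem toC_V : toC φ.V = φ.cV := by
  simp [toC, V, cV, cY, cW, Polynomial.derivative_map]

theorem cW_ne_zero : φ.cW ≠ 0 := by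
  intro h
  exact φ.W_ne_zero (toC_injective (by simpa [toC, cW] using h))

theorem isDefinedAt_iff (t : ℂ) : φ.IsDefinedAt t ↔ φ.cW.eval t ≠ 0 := by
  rw [IsDefinedAt, aeval_eq_eval_toC]; rfl

theorem point_eq (t : ℂ) :
    φ.point t = ![φ.cX.eval t / φ.cW.eval t, φ.cY.eval t / φ.cW.eval t] := by
  simp only [point, aeval_eq_eval_toC]; rfl

theorem point_zero (t : ℂ) : φ.point t 0 = φ.cX.eval t / φ.cW.eval t := by
  simp [point_eq]

theorem point_one (t : ℂ) : φ.point t 1 = φ.cY.eval t / φ.cW.eval t := by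
  simp [point_eq]

theorem finite_cW_root : {t : ℂ | φ.cW.eval t = 0}.Finite :=
  Polynomial.finite_setOfPred_isRoot φ.cW_ne_zero

theorem infinite_points (hφ : φ.IsProper) :
    {p | ∃ t : ℂ, φ.IsDefinedAt t ∧ p = φ.point t}.Infinite := by
  have h1 : (({t : ℂ | φ.cW.eval t = 0} ∪ _)ᶜ : Set ℂ).Infinite :=
    (φ.finite_cW_root.union hφ).infinite_compl
  refine (h1.image (f := φ.point) ?_).mono ?_
  · intro s hs t ht hst
    simp only [Set.mem_compl_iff, Set.mem_union, not_or, Set.mem_ofPred_eq] at hs ht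
    by_contra hne
    exact hs.2 ⟨(φ.isDefinedAt_iff s).2 hs.1, t, (φ.isDefinedAt_iff t).2 ht.1, Ne.symm hne,
      hst.symm⟩
  · rintro _ ⟨t, ht, rfl⟩
    simp only [Set.mem_compl_iff, Set.mem_union, not_or, Set.mem_ofPred_eq] at ht
    exact ⟨t, (φ.isDefinedAt_iff t).2 ht.1, rfl⟩

theorem hasDerivAt_point (t : ℂ) (ht : φ.cW.eval t ≠ 0) (i : Fin 2) :
    HasDerivAt (fun τ => φ.point τ i)
      ((![φ.cU.eval t, φ.cV.eval t] : Plane) i / φ.cW.eval t ^ 2) t := by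
  have h (p : Polynomial ℂ) : HasDerivAt (fun τ => p.eval τ / φ.cW.eval τ)
      ((p.derivative.eval t * φ.cW.eval t - p.eval t * φ.cW.derivative.eval t) /
        φ.cW.eval t ^ 2) t := (p.hasDerivAt t).div (φ.cW.hasDerivAt t) ht
  fin_cases i
  · simpa [point_eq, cU] using h φ.cX
  · simpa [point_eq, cV] using h φ.cY

/-- U and V are real, so a vanishing sum of squares makes both vanish. Then the parametrization is
locally constant, against properness. -/
theorem cE_ne_zero (hφ : φ.IsProper) : φ.cE ≠ 0 := by
  intro h
  have hUV : φ.U ^ 2 + φ.V ^ 2 = 0 := by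
    apply toC_injective
    rw [cE, ← toC_U, ← toC_V] at h
    simpa [toC] using h
  have hUV' (t : ℝ) : φ.U.eval t = 0 ∧ φ.V.eval t = 0 := by
    have : φ.U.eval t ^ 2 + φ.V.eval t ^ 2 = 0 := by
      simpa using congrArg (Polynomial.eval t) hUV
    constructor <;> nlinarith [sq_nonneg (φ.U.eval t), sq_nonneg (φ.V.eval t)]
  have hU : φ.cU = 0 := by
    rw [← toC_U, Polynomial.funext (p := φ.U) (q := 0) fun t => by simp [(hUV' t).1]]; simp [toC]
  have hV : φ.cV = 0 := by
    rw [← toC_V, Polynomial.funext (p := φ.V) (q := 0) fun t => by simp [(hUV' t).2]]; simp [toC]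
  obtain ⟨t, ht⟩ := φ.finite_cW_root.infinite_compl.nonempty
  have hnear : ∀ᶠ τ in nhds t, φ.cW.eval τ ≠ 0 :=
    φ.cW.continuous.continuousAt.eventually_ne ht
  have hconst (i : Fin 2) : ∀ᶠ τ in nhds t, φ.point τ i = φ.point t i := by
    refine eventually_eq_of_hasDerivAt_zero (f := fun τ => φ.point τ i) ?_
    filter_upwards [hnear] with τ hτ
    refine (φ.hasDerivAt_point τ hτ i).congr_deriv ?_
    fin_cases i <;> simp [hU, hV]
  have hinf := infinite_setOf_of_eventually (hnear.and ((hconst 0).and (hconst 1)))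
  refine (hinf.sdiff (Set.finite_singleton t)) (hφ.subset ?_)
  rintro τ ⟨⟨h1, h2, h3⟩, hne⟩
  refine ⟨(φ.isDefinedAt_iff τ).2 h1, t, (φ.isDefinedAt_iff t).2 ht, Ne.symm hne, ?_⟩
  ext i
  fin_cases i
  · exact h2.symm
  · exact h3.symm

theorem isLine_curve_of_real (hφ : φ.IsProper) {a b c : ℝ} (hab : a ≠ 0 ∨ b ≠ 0)
    (h : ∀ t, (a : ℂ) * φ.cX.eval t + b * φ.cY.eval t = c * φ.cW.eval t) : IsLine φ.curve := by
  have hsub : {p | ∃ t : ℂ, φ.IsDefinedAt t ∧ p = φ.point t} ⊆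
      {p : Plane | (a : ℂ) * p 0 + (b : ℂ) * p 1 = (c : ℂ)} := by
    rintro _ ⟨t, ht, rfl⟩
    rw [isDefinedAt_iff] at ht
    rw [Set.mem_ofPred_eq, point_zero, point_one]
    field_simp
    linear_combination h t
  refine ⟨a, b, c, hab, Set.Subset.antisymm ?_
    (line_subset_zariskiClosure hab (φ.infinite_points hφ) hsub)⟩
  have hz : {p : Plane | (a : ℂ) * p 0 + (b : ℂ) * p 1 = (c : ℂ)} =
      zeroSet (affinePoly a b (-c)) := by
    ext p
    simp [mem_zeroSet, ← sub_eq_add_neg, sub_eq_zero]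
  rw [hz] at hsub ⊢
  exact zariskiClosure_subset_zeroSet hsub

/-- A complex linear relation between real polynomials splits into its real and imaginary parts, and
at least one of them is a nontrivial real line. -/
theorem isLine_curve (hφ : φ.IsProper) {a b c : ℂ} (hab : a ≠ 0 ∨ b ≠ 0)
    (h : Polynomial.C a * φ.cX + Polynomial.C b * φ.cY = Polynomial.C c * φ.cW) :
    IsLine φ.curve := by
  have hcoeff (i : ℕ) : a * (φ.X.coeff i : ℂ) + b * (φ.Y.coeff i : ℂ) = c * (φ.W.coeff i : ℂ) := by
    simpa [cX, cY, cW, toC] using congrArg (fun p => Polynomial.coeff p i) h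
  have key (r : ℂ → ℝ) (hr : ∀ i, r a * φ.X.coeff i + r b * φ.Y.coeff i = r c * φ.W.coeff i)
      (hne : r a ≠ 0 ∨ r b ≠ 0) : IsLine φ.curve := by
    refine φ.isLine_curve_of_real hφ (c := r c) hne fun t => ?_
    have : Polynomial.C ((r a : ℝ) : ℂ) * φ.cX + Polynomial.C ((r b : ℝ) : ℂ) * φ.cY =
        Polynomial.C ((r c : ℝ) : ℂ) * φ.cW := by
      ext i
      simp only [Polynomial.coeff_add, Polynomial.coeff_C_mul, cX, cY, cW, toC,
        Polynomial.coeff_map, Complex.ofRealHom_eq_coe]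
      exact_mod_cast hr i
    simpa using congrArg (Polynomial.eval t) this
  have hre (i) : a.re * φ.X.coeff i + b.re * φ.Y.coeff i = c.re * φ.W.coeff i := by
    simpa using congrArg Complex.re (hcoeff i)
  have him (i) : a.im * φ.X.coeff i + b.im * φ.Y.coeff i = c.im * φ.W.coeff i := by
    simpa using congrArg Complex.im (hcoeff i)
  by_cases h0 : a.re ≠ 0 ∨ b.re ≠ 0
  · exact key _ hre h0
  · refine key _ him ?_
    push Not at h0
    refine hab.imp ?_ ?_
    · exact fun ha hai => ha (Complex.ext h0.1 hai)
    · exact fun hb hbi => hb (Complex.ext h0.2 hbi)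

/-- The center may be complex. Conjugation gives the same equation with the conjugate center; the
difference of the two is linear after division by W, and is nontrivial unless the center is real. -/
theorem isLine_or_isCircle_curve (hφ : φ.IsProper) {a b : ℂ} {d : ℝ} (hd : 0 < d)
    (h : (φ.cX - Polynomial.C a * φ.cW) ^ 2 + (φ.cY - Polynomial.C b * φ.cW) ^ 2 =
      Polynomial.C (d : ℂ) ^ 2 * φ.cW ^ 2) : IsLine φ.curve ∨ IsCircle φ.curve := by
  have hconj : (φ.cX - Polynomial.C (starRingEnd ℂ a) * φ.cW) ^ 2 +
      (φ.cY - Polynomial.C (starRingEnd ℂ b) * φ.cW) ^ 2 =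
      Polynomial.C (d : ℂ) ^ 2 * φ.cW ^ 2 := by
    have := congrArg (Polynomial.map (starRingEnd ℂ)) h
    simpa [cX, cY, cW, toC_map_conj] using this
  set a' := starRingEnd ℂ a with ha'
  set b' := starRingEnd ℂ b with hb'
  by_cases hab : a' - a ≠ 0 ∨ b' - b ≠ 0
  · left
    refine φ.isLine_curve hφ (a := 2 * (a' - a)) (b := 2 * (b' - b))
      (c := a' ^ 2 - a ^ 2 + (b' ^ 2 - b ^ 2)) (by simpa using hab) ?_
    apply mul_left_cancel₀ φ.cW_ne_zero
    simp only [map_mul, map_sub, map_add, map_pow]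
    have h2 : (Polynomial.C (2 : ℂ)) = 2 := rfl
    rw [h2]
    linear_combination h - hconj
  · right
    push Not at hab
    have har : ((a.re : ℝ) : ℂ) = a := Complex.conj_eq_iff_re.1 (sub_eq_zero.1 hab.1)
    have hbr : ((b.re : ℝ) : ℂ) = b := Complex.conj_eq_iff_re.1 (sub_eq_zero.1 hab.2)
    have hsub : {p | ∃ t : ℂ, φ.IsDefinedAt t ∧ p = φ.point t} ⊆
        {p : Plane | (p 0 - (a.re : ℂ)) ^ 2 + (p 1 - (b.re : ℂ)) ^ 2 = (d : ℂ) ^ 2} := by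
      rintro _ ⟨t, ht, rfl⟩
      rw [isDefinedAt_iff] at ht
      rw [Set.mem_ofPred_eq, point_zero, point_one, har, hbr]
      have := congrArg (Polynomial.eval t) h
      simp only [Polynomial.eval_add, Polynomial.eval_pow, Polynomial.eval_sub,
        Polynomial.eval_mul, Polynomial.eval_C] at this
      field_simp
      linear_combination this
    refine ⟨a.re, b.re, d, hd, Set.Subset.antisymm ?_ (circle_subset_zariskiClosure
      (by exact_mod_cast hd.ne') (φ.infinite_points hφ) hsub)⟩
    have hz : {p : Plane | (p 0 - (a.re : ℂ)) ^ 2 + (p 1 - (b.re : ℂ)) ^ 2 = (d : ℂ) ^ 2} =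
        zeroSet ((MvPolynomial.X 0 - C (a.re : ℂ)) ^ 2 +
          (MvPolynomial.X 1 - C (b.re : ℂ)) ^ 2 - C ((d : ℂ) ^ 2)) := by
      ext p
      simp only [mem_zeroSet, Set.mem_ofPred_eq, map_sub, map_add, map_pow, eval_X, eval_C,
        sub_eq_zero]
    rw [hz] at hsub ⊢
    exact zariskiClosure_subset_zeroSet hsub

end RatParam
end Offset
end

/-! ### Flags: a parameter together with a choice of unit normal. -/

noncomputable section
namespace Offset

open MvPolynomial Filter

namespace RatParam

variable (φ : RatParam)

/-- The standing assumptions on the curve and the distance. -/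
structure IsAdmissible (d : ℝ) : Prop where
  pos : 0 < d
  not_isLine : ¬ IsLine φ.curve
  not_isCircle : ¬ IsCircle φ.curve
  proper : φ.IsProper

/-- The parameters of the offset: pairs `(t, s)` with `s² = U(t)² + V(t)²`. -/
def flags : Set (ℂ × ℂ) :=
  {e | φ.cW.eval e.1 ≠ 0 ∧ e.2 ≠ 0 ∧ e.2 ^ 2 = φ.cE.eval e.1}

/-- The unit normal at a flag. -/
def nrm (e : ℂ × ℂ) : Plane := ![φ.cV.eval e.1 / e.2, -(φ.cU.eval e.1 / e.2)]

/-- The offset point generated by a flag. -/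
def gen (d : ℝ) (e : ℂ × ℂ) : Plane := φ.point e.1 + (d : ℂ) • φ.nrm e

variable {φ} {d : ℝ}

theorem eval_cE (t : ℂ) : φ.cE.eval t = φ.cU.eval t ^ 2 + φ.cV.eval t ^ 2 := by simp [cE]

theorem paramGenerates_iff {t : ℂ} {q : Plane} :
    φ.ParamGenerates d t q ↔ ∃ s, (t, s) ∈ φ.flags ∧ φ.gen d (t, s) = q := by
  simp only [ParamGenerates, isDefinedAt_iff, aeval_eq_eval_toC, toC_U, toC_V, flags,
    Set.mem_ofPred_eq, eval_cE, ← exists_and_left, and_assoc]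
  refine exists_congr fun s => and_congr_right fun _ => and_congr_right fun _ =>
    and_congr_right fun _ => ?_
  have : φ.gen d (t, s) = ![φ.point t 0 + (d : ℂ) * φ.cV.eval t / s,
      φ.point t 1 - (d : ℂ) * φ.cU.eval t / s] := by
    ext i
    fin_cases i
    · simp [gen, nrm]; ring
    · simp [gen, nrm]; ring
  rw [this, eq_comm]

theorem setOf_paramGenerates :
    {q | ∃ t : ℂ, φ.ParamGenerates d t q} = φ.gen d '' φ.flags := by
  ext q
  simp only [Set.mem_ofPred_eq, paramGenerates_iff, Set.mem_image, Prod.exists]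

theorem offset_eq : φ.offset d = zariskiClosure (φ.gen d '' φ.flags) := by
  rw [offset, setOf_paramGenerates]

theorem generates_iff {p q : Plane} :
    φ.Generates d p q ↔ ∃ e ∈ φ.flags, φ.gen d e = q ∧ φ.point e.1 = p := by
  simp only [Generates, paramGenerates_iff, Prod.exists]
  grind

theorem cE_eval_ne_zero {e : ℂ × ℂ} (he : e ∈ φ.flags) : φ.cE.eval e.1 ≠ 0 := by
  rw [← he.2.2]; exact pow_ne_zero _ he.2.1

theorem nrm_sq {e : ℂ × ℂ} (he : e ∈ φ.flags) : φ.nrm e 0 ^ 2 + φ.nrm e 1 ^ 2 = 1 := by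
  have h0 := he.2.1
  have h := he.2.2
  rw [eval_cE] at h
  simp only [nrm, Matrix.cons_val_zero, Matrix.cons_val_one]
  field_simp
  linear_combination -h

theorem tangent_nrm (e : ℂ × ℂ) :
    φ.cU.eval e.1 * φ.nrm e 0 + φ.cV.eval e.1 * φ.nrm e 1 = 0 := by
  simp only [nrm, Matrix.cons_val_zero, Matrix.cons_val_one]
  ring

theorem neg_mem_flags {e : ℂ × ℂ} (he : e ∈ φ.flags) : (e.1, -e.2) ∈ φ.flags :=
  ⟨he.1, neg_ne_zero.2 he.2.1, by simpa using he.2.2⟩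

theorem nrm_neg (e : ℂ × ℂ) : φ.nrm (e.1, -e.2) = -φ.nrm e := by
  ext i
  fin_cases i <;> simp [nrm, div_neg]

/-- Flags with the same parameter and the same normal are equal. -/
theorem flag_ext {e e' : ℂ × ℂ} (he : e ∈ φ.flags) (he' : e' ∈ φ.flags) (h1 : e.1 = e'.1)
    (h2 : φ.nrm e = φ.nrm e') : e = e' := by
  refine Prod.ext h1 ?_
  have h : e.2 ^ 2 = e'.2 ^ 2 := by rw [he.2.2, he'.2.2, h1]
  rcases sq_eq_sq_iff_eq_or_eq_neg.1 h with h | h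
  · exact h
  · exfalso
    have : e = (e'.1, -e'.2) := Prod.ext h1 h
    rw [this, nrm_neg] at h2
    have hz (i) : φ.nrm e' i = 0 := by
      have := congrFun h2 i
      simp only [Pi.neg_apply] at this
      linear_combination (-1 / 2 : ℂ) * this
    have := nrm_sq he'
    simp [hz] at this

theorem finite_flags_of_finite {T : Set ℂ} (hT : T.Finite) : {e ∈ φ.flags | e.1 ∈ T}.Finite := by
  have hs (t : ℂ) : {s : ℂ | s ^ 2 = φ.cE.eval t}.Finite := by
    have hne : (Polynomial.X ^ 2 - Polynomial.C (φ.cE.eval t)) ≠ 0 :=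
      Polynomial.X_pow_sub_C_ne_zero (by norm_num) _
    refine (Polynomial.finite_setOfPred_isRoot hne).subset fun s hs => ?_
    have : s ^ 2 = φ.cE.eval t := hs
    simp [this]
  refine (hT.biUnion fun t _ => (hs t).image fun s => (t, s)).subset ?_
  rintro ⟨t, s⟩ ⟨h1, h2⟩
  simp only [Set.mem_iUnion]
  exact ⟨t, h2, s, h1.2.2, rfl⟩

/-! ### Branches -/

variable (φ) in
/-- The graph of a square root of `U² + V²`. -/
def rootBranch (S : Polynomial ℂ) : Set (ℂ × ℂ) := {e ∈ φ.flags | e.2 = S.eval e.1}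

variable (φ) in
/-- The irreducible components of the curve of flags. -/
def IsBranch (B : Set (ℂ × ℂ)) : Prop :=
  (B = φ.flags ∧ ¬ IsSquare φ.cE) ∨ ∃ S : Polynomial ℂ, S ^ 2 = φ.cE ∧ B = φ.rootBranch S

theorem isBranch_flags_or :
    φ.IsBranch φ.flags ∨ ∃ S : Polynomial ℂ, S ^ 2 = φ.cE ∧
      φ.flags = φ.rootBranch S ∪ φ.rootBranch (-S) := by
  by_cases h : IsSquare φ.cE
  · right
    obtain ⟨S, hS⟩ := h
    refine ⟨S, by rw [hS, sq], Set.Subset.antisymm (fun e he => ?_)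
      (Set.union_subset (fun e he => he.1) (fun e he => he.1))⟩
    have h2 := he.2.2
    rw [hS, Polynomial.eval_mul, ← sq] at h2
    refine (sq_eq_sq_iff_eq_or_eq_neg.1 h2).imp (fun h => ⟨he, h⟩) (fun h => ⟨he, ?_⟩)
    simpa using h
  · exact Or.inl (Or.inl ⟨rfl, h⟩)

theorem isBranch_rootBranch {S : Polynomial ℂ} (hS : S ^ 2 = φ.cE) :
    φ.IsBranch (φ.rootBranch S) := Or.inr ⟨S, hS, rfl⟩

variable {B : Set (ℂ × ℂ)}

theorem IsBranch.subset_flags (hB : φ.IsBranch B) : B ⊆ φ.flags := by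
  rcases hB with ⟨rfl, -⟩ | ⟨S, -, rfl⟩
  · exact subset_rfl
  · exact fun e he => he.1

/-- The filter of cofinite subsets of `B`. -/
def genericOn (B : Set (ℂ × ℂ)) : Filter (ℂ × ℂ) := cofinite ⊓ 𝓟 B

theorem eventually_genericOn {p : ℂ × ℂ → Prop} :
    (∀ᶠ e in genericOn B, p e) ↔ {e ∈ B | ¬ p e}.Finite := by
  rw [genericOn, eventually_inf_principal, eventually_cofinite]
  simp only [Classical.not_imp]

theorem eventually_mem_genericOn : ∀ᶠ e in genericOn B, e ∈ B := by
  rw [eventually_genericOn]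
  simp

theorem IsBranch.eventually_fst_notMem (hB : φ.IsBranch B) {T : Set ℂ} (hT : T.Finite) :
    ∀ᶠ e in genericOn B, e.1 ∉ T := by
  rw [eventually_genericOn]
  refine (finite_flags_of_finite (φ := φ) hT).subset ?_
  rintro e ⟨h1, h2⟩
  exact ⟨hB.subset_flags h1, not_not.1 h2⟩

theorem IsBranch.exists_mem (hB : φ.IsBranch B) {t : ℂ} (hW : φ.cW.eval t ≠ 0)
    (hE : φ.cE.eval t ≠ 0) : ∃ s, (t, s) ∈ B := by
  rcases hB with ⟨rfl, -⟩ | ⟨S, hS, rfl⟩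
  · obtain ⟨s, hs⟩ := IsAlgClosed.exists_pow_nat_eq (φ.cE.eval t) (n := 2) (by norm_num)
    refine ⟨s, hW, ?_, hs⟩
    rintro rfl
    apply hE
    rw [← hs]; norm_num
  · have hs : S.eval t ^ 2 = φ.cE.eval t := by rw [← hS, Polynomial.eval_pow]
    refine ⟨S.eval t, ⟨hW, ?_, hs⟩, rfl⟩
    intro h
    apply hE
    rw [← hs, show S.eval t = 0 from h]; norm_num

variable (φ) in
/-- The parameters at which the curve or its normal is undefined. -/
def badParams : Set ℂ := {t | φ.cW.eval t = 0 ∨ φ.cE.eval t = 0}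

theorem IsAdmissible.finite_badParams (h : φ.IsAdmissible d) : φ.badParams.Finite :=
  φ.finite_cW_root.union (Polynomial.finite_setOfPred_isRoot (φ.cE_ne_zero h.proper))

theorem IsBranch.infinite_fst (hB : φ.IsBranch B) (h : φ.IsAdmissible d) :
    {t | ∃ s, (t, s) ∈ B}.Infinite := by
  refine h.finite_badParams.infinite_compl.mono fun t ht => ?_
  simp only [badParams, Set.mem_compl_iff, Set.mem_ofPred_eq, not_or] at ht
  exact hB.exists_mem ht.1 ht.2

theorem IsBranch.infinite (hB : φ.IsBranch B) (h : φ.IsAdmissible d) : B.Infinite := by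
  intro hfin
  refine hB.infinite_fst h ((hfin.image Prod.fst).subset ?_)
  rintro t ⟨s, hs⟩
  exact ⟨_, hs, rfl⟩

theorem IsBranch.neBot (hB : φ.IsBranch B) (h : φ.IsAdmissible d) : (genericOn B).NeBot := by
  rw [genericOn, cofinite_inf_principal_neBot_iff]
  exact hB.infinite h

theorem IsBranch.exists_of_eventually (hB : φ.IsBranch B) (h : φ.IsAdmissible d)
    {p : ℂ × ℂ → Prop} (hp : ∀ᶠ e in genericOn B, p e) : ∃ e ∈ B, p e := by
  have := hB.neBot h
  exact (eventually_mem_genericOn.and hp).exists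

/-- Fibers of `gen` may meet both branches, so generic properties are needed on all flags; they are
proved branch by branch. -/
theorem eventually_flags_of_isBranch {p : ℂ × ℂ → Prop}
    (h : ∀ B, φ.IsBranch B → ∀ᶠ e in genericOn B, p e) : ∀ᶠ e in genericOn φ.flags, p e := by
  rcases isBranch_flags_or (φ := φ) with hB | ⟨S, hS, hf⟩
  · exact h _ hB
  · rw [eventually_genericOn, hf]
    refine ((eventually_genericOn.1 (h _ (isBranch_rootBranch hS))).union
      (eventually_genericOn.1 (h _ (isBranch_rootBranch (by rwa [neg_sq]))))).subset ?_
    rintro e ⟨he | he, hp⟩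
    · exact Or.inl ⟨he, hp⟩
    · exact Or.inr ⟨he, hp⟩

/-- A polynomial function on a branch vanishes identically or at finitely many points. -/
theorem IsBranch.eventually_ne_zero (hB : φ.IsBranch B) (a b : Polynomial ℂ)
    (h : ∃ e ∈ B, a.eval e.1 + b.eval e.1 * e.2 ≠ 0) :
    ∀ᶠ e in genericOn B, a.eval e.1 + b.eval e.1 * e.2 ≠ 0 := by
  obtain ⟨e₀, he₀, h0⟩ := h
  rcases hB with ⟨rfl, hsq⟩ | ⟨S, hS, rfl⟩
  -- This is the norm of a + b s. If it vanished with b ≠ 0, then b would divide a and E would be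
  -- the square of the quotient.
  · have hr : a ^ 2 - b ^ 2 * φ.cE ≠ 0 := by
      intro hr
      rw [sub_eq_zero] at hr
      by_cases hb : b = 0
      · have ha : a = 0 := by simpa [hb] using hr
        simp [ha, hb] at h0
      · have hdvd : b ∣ a := (UniqueFactorizationMonoid.pow_dvd_pow_iff_dvd two_ne_zero).1 ⟨_, hr⟩
        obtain ⟨k, rfl⟩ := hdvd
        apply hsq
        refine ⟨k, mul_left_cancel₀ (pow_ne_zero 2 hb) ?_⟩
        rw [← hr]; ring
    rw [eventually_genericOn]
    refine (finite_flags_of_finite (φ := φ) (Polynomial.finite_setOfPred_isRoot hr)).subset ?_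
    rintro e ⟨he, h1⟩
    refine ⟨he, ?_⟩
    rw [not_not] at h1
    have h2 := he.2.2
    simp only [Set.mem_ofPred_eq, Polynomial.IsRoot, Polynomial.eval_sub, Polynomial.eval_mul,
      Polynomial.eval_pow]
    linear_combination (a.eval e.1 - b.eval e.1 * e.2) * h1 + b.eval e.1 ^ 2 * h2
  · have hr : a + b * S ≠ 0 := by
      intro hr
      apply h0
      rw [he₀.2, ← Polynomial.eval_mul, ← Polynomial.eval_add, hr, Polynomial.eval_zero]
    rw [eventually_genericOn]
    refine (finite_flags_of_finite (φ := φ) (Polynomial.finite_setOfPred_isRoot hr)).subset ?_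
    rintro e ⟨he, h1⟩
    refine ⟨he.1, ?_⟩
    rw [not_not, he.2] at h1
    simpa using h1

variable (φ) in
/-- The functions `a(t) + b(t) s` on the curve of flags. -/
def flagFunctions : Subalgebra ℂ (φ.flags → ℂ) where
  carrier := {h | ∃ a b : Polynomial ℂ, ∀ e, h e = a.eval e.1.1 + b.eval e.1.1 * e.1.2}
  mul_mem' := by
    rintro f g ⟨a, b, hf⟩ ⟨a', b', hg⟩
    refine ⟨a * a' + b * b' * φ.cE, a * b' + a' * b, fun e => ?_⟩
    have := e.2.2.2
    simp only [Pi.mul_apply, hf, hg, Polynomial.eval_add, Polynomial.eval_mul]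
    linear_combination b.eval e.1.1 * b'.eval e.1.1 * this
  add_mem' := by
    rintro f g ⟨a, b, hf⟩ ⟨a', b', hg⟩
    refine ⟨a + a', b + b', fun e => ?_⟩
    simp only [Pi.add_apply, hf, hg, Polynomial.eval_add]
    ring
  algebraMap_mem' z := ⟨Polynomial.C z, 0, fun e => by simp⟩

/-- W s is a common denominator of the coordinates of the offset point, and s² = E reduces every
power of s. -/
theorem exists_flagFunction (d : ℝ) (g : PolyXY) :
    ∃ (n : ℕ) (a b : Polynomial ℂ), ∀ e ∈ φ.flags,
      (φ.cW.eval e.1 * e.2) ^ n * eval (φ.gen d e) g = a.eval e.1 + b.eval e.1 * e.2 := by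
  obtain ⟨n, a, b, h⟩ := exists_pow_mul_eval_mem φ.flagFunctions
    (δ := fun e => φ.cW.eval e.1.1 * e.1.2) (z := fun e => φ.gen d e.1) ⟨0, φ.cW, by simp⟩ (by
      intro i
      fin_cases i
      · refine ⟨Polynomial.C (d : ℂ) * φ.cW * φ.cV, φ.cX, fun e => ?_⟩
        have h1 := e.2.1
        have h2 := e.2.2.1
        simp [gen, nrm, point_zero]
        field_simp
        ring
      · refine ⟨-(Polynomial.C (d : ℂ) * φ.cW * φ.cU), φ.cY, fun e => ?_⟩
        have h1 := e.2.1
        have h2 := e.2.2.1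
        simp [gen, nrm, point_one]
        field_simp
        ring) g
  exact ⟨n, a, b, fun e he => h ⟨e, he⟩⟩

/-- A polynomial vanishes at all or at finitely many of the offset points of a branch. -/
theorem IsBranch.eventually_eval_gen_ne_zero (hB : φ.IsBranch B) {g : PolyXY}
    (h : ∃ e ∈ B, eval (φ.gen d e) g ≠ 0) :
    ∀ᶠ e in genericOn B, eval (φ.gen d e) g ≠ 0 := by
  obtain ⟨n, a, b, hab⟩ := exists_flagFunction (φ := φ) d g
  obtain ⟨e₀, he₀, h0⟩ := h
  have := hB.eventually_ne_zero a b ⟨e₀, he₀, by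
    have hf := hB.subset_flags he₀
    rw [← hab _ hf]
    exact mul_ne_zero (pow_ne_zero _ (mul_ne_zero hf.1 hf.2.1)) h0⟩
  filter_upwards [this, eventually_mem_genericOn] with e he hmem h0
  apply he
  rw [← hab _ (hB.subset_flags hmem), h0, mul_zero]

/-- The offset of a branch is not a point. -/
theorem IsBranch.eventually_gen_ne (hB : φ.IsBranch B) (h : φ.IsAdmissible d) (q : Plane) :
    ∀ᶠ e in genericOn B, φ.gen d e ≠ q := by
  have key : ∃ i, ∃ e ∈ B, eval (φ.gen d e) (MvPolynomial.X i - C (q i) : PolyXY) ≠ 0 := by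
    by_contra! hc
    have hc' (e) (he : e ∈ B) (i) : φ.gen d e i = q i := by
      have := hc i e he
      rwa [map_sub, eval_X, eval_C, sub_eq_zero] at this
    -- If the offset of the branch were the point `q`, the curve would satisfy the equation of the
    -- circle of radius d about `q`.
    refine (φ.isLine_or_isCircle_curve h.proper (a := q 0) (b := q 1) h.pos ?_).elim
      h.not_isLine h.not_isCircle
    refine Polynomial.eq_of_infinite_eval_eq _ _ ((hB.infinite_fst h).mono ?_)
    rintro t ⟨s, hs⟩
    have hf := hB.subset_flags hs
    have hW : φ.cW.eval t ≠ 0 := hf.1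
    have h0 := hc' _ hs 0
    have h1 := hc' _ hs 1
    have hn := nrm_sq hf
    simp only [gen, Pi.add_apply, Pi.smul_apply, smul_eq_mul, point_zero, point_one] at h0 h1
    simp only [Set.mem_ofPred_eq, Polynomial.eval_add, Polynomial.eval_pow, Polynomial.eval_sub,
      Polynomial.eval_mul, Polynomial.eval_C, ← h0, ← h1]
    field_simp
    linear_combination (d : ℂ) ^ 2 * φ.cW.eval t ^ 2 * hn
  obtain ⟨i, hi⟩ := key
  filter_upwards [hB.eventually_eval_gen_ne_zero hi] with e he heq
  apply he
  rw [heq]; simp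

theorem IsBranch.eventually_gen_notMem (hB : φ.IsBranch B) (h : φ.IsAdmissible d) {T : Set Plane}
    (hT : T.Finite) : ∀ᶠ e in genericOn B, φ.gen d e ∉ T := by
  have := (eventually_all_finite hT).2 fun q _ => hB.eventually_gen_ne h q
  filter_upwards [this] with e he hmem
  exact he _ hmem rfl

theorem IsBranch.infinite_gen (hB : φ.IsBranch B) (h : φ.IsAdmissible d) :
    (φ.gen d '' B).Infinite := by
  intro hfin
  obtain ⟨e, he, hn⟩ := hB.exists_of_eventually h (hB.eventually_gen_notMem h hfin)
  exact hn ⟨e, he, rfl⟩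

/-- A property of generic flags holds for all flags with the same offset point as a generic one. -/
theorem IsBranch.eventually_fiber (hB : φ.IsBranch B) (h : φ.IsAdmissible d)
    {B' : Set (ℂ × ℂ)} {p : ℂ × ℂ → Prop} (hp : ∀ᶠ e in genericOn B', p e) :
    ∀ᶠ e in genericOn B, ∀ e' ∈ B', φ.gen d e' = φ.gen d e → p e' := by
  filter_upwards [hB.eventually_gen_notMem h ((eventually_genericOn.1 hp).image (φ.gen d))]
    with e he e' he' heq
  by_contra hn
  exact he ⟨e', ⟨he', hn⟩, heq⟩

/-! ### Tangents -/

/-- A local holomorphic section of the projection to t, which makes differentiation along a branch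
possible; its derivative is forced by σ² = E. -/
theorem IsBranch.exists_local (hB : φ.IsBranch B) {e : ℂ × ℂ} (he : e ∈ B) :
    ∃ σ : ℂ → ℂ, σ e.1 = e.2 ∧ ∀ᶠ τ in nhds e.1, (τ, σ τ) ∈ B ∧
      HasDerivAt σ (φ.cE.derivative.eval τ / (2 * σ τ)) τ := by
  have hf := hB.subset_flags he
  have hW : ∀ᶠ τ in nhds e.1, φ.cW.eval τ ≠ 0 := φ.cW.continuous.continuousAt.eventually_ne hf.1
  have hE0 := cE_eval_ne_zero hf
  have hE : ∀ᶠ τ in nhds e.1, φ.cE.eval τ ≠ 0 := φ.cE.continuous.continuousAt.eventually_ne hE0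
  rcases hB with ⟨rfl, -⟩ | ⟨S, hS, rfl⟩
  -- Normalizing E to take the value 1 at the base point keeps nearby values off the cut of the
  -- principal logarithm.
  · let h (τ : ℂ) : ℂ := φ.cE.eval τ / φ.cE.eval e.1
    have hcont : Continuous h := φ.cE.continuous.div_const _
    have h1 : h e.1 = 1 := div_self hE0
    have hslit : ∀ᶠ τ in nhds e.1, h τ ∈ Complex.slitPlane :=
      hcont.continuousAt.eventually_mem
        (Complex.isOpen_slitPlane.mem_nhds (by rw [h1]; exact Complex.one_mem_slitPlane))
    have hσ (τ) (hτ : φ.cE.eval τ ≠ 0) :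
        (e.2 * Complex.exp (Complex.log (h τ) / 2)) ^ 2 = φ.cE.eval τ := by
      rw [mul_pow, ← Complex.exp_nat_mul]
      have : ((2 : ℕ) : ℂ) * (Complex.log (h τ) / 2) = Complex.log (h τ) := by push_cast; ring
      rw [this, Complex.exp_log (div_ne_zero hτ hE0), he.2.2]
      exact mul_div_cancel₀ _ hE0
    refine ⟨fun τ => e.2 * Complex.exp (Complex.log (h τ) / 2), by simp [h1], ?_⟩
    filter_upwards [hW, hE, hslit] with τ hWτ hEτ hs
    have hne : e.2 * Complex.exp (Complex.log (h τ) / 2) ≠ 0 :=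
      mul_ne_zero hf.2.1 (Complex.exp_ne_zero _)
    refine ⟨⟨hWτ, hne, hσ τ hEτ⟩, ?_⟩
    have hd : HasDerivAt h (φ.cE.derivative.eval τ / φ.cE.eval e.1) τ :=
      (φ.cE.hasDerivAt τ).div_const _
    refine ((((hd.clog hs).div_const 2).cexp).const_mul e.2).congr_deriv ?_
    rw [eq_div_iff (mul_ne_zero two_ne_zero hne)]
    have h2 := hσ τ hEτ
    have hq : φ.cE.derivative.eval τ / φ.cE.eval e.1 / h τ =
        φ.cE.derivative.eval τ / φ.cE.eval τ := by
      change _ / (φ.cE.eval τ / φ.cE.eval e.1) = _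
      field_simp
    rw [hq]
    field_simp
    linear_combination φ.cE.derivative.eval τ * h2
  · refine ⟨fun τ => S.eval τ, he.2.symm, ?_⟩
    filter_upwards [hW, hE] with τ hWτ hEτ
    have hs : S.eval τ ^ 2 = φ.cE.eval τ := by rw [← hS, Polynomial.eval_pow]
    have hne : S.eval τ ≠ 0 := by
      intro h0
      apply hEτ
      rw [← hs, h0]; norm_num
    refine ⟨⟨⟨hWτ, hne, hs⟩, rfl⟩, (S.hasDerivAt τ).congr_deriv ?_⟩
    rw [eq_div_iff (mul_ne_zero two_ne_zero hne), ← hS, Polynomial.derivative_sq]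
    simp
    ring

variable (φ) in
/-- The offset point moves with velocity `speed * (U, V)`. -/
def speed (d : ℝ) (e : ℂ × ℂ) : ℂ :=
  1 / φ.cW.eval e.1 ^ 2 + d * (φ.cU.eval e.1 * φ.cV.derivative.eval e.1 -
    φ.cU.derivative.eval e.1 * φ.cV.eval e.1) / e.2 ^ 3

/-- The derivative of a unit normal is tangential, so the offset point moves parallel to the curve.
-/
theorem hasDerivAt_gen {σ : ℂ → ℂ} {t : ℂ} (hf : (t, σ t) ∈ φ.flags)
    (hσ : HasDerivAt σ (φ.cE.derivative.eval t / (2 * σ t)) t) (i : Fin 2) :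
    HasDerivAt (fun τ => φ.gen d (τ, σ τ) i)
      (φ.speed d (t, σ t) * (![φ.cU.eval t, φ.cV.eval t] : Plane) i) t := by
  have h0 : σ t ≠ 0 := hf.2.1
  have hW : φ.cW.eval t ≠ 0 := hf.1
  have hs : σ t ^ 2 = φ.cU.eval t ^ 2 + φ.cV.eval t ^ 2 := by rw [← eval_cE]; exact hf.2.2
  have hE' : φ.cE.derivative.eval t = 2 * (φ.cU.eval t * φ.cU.derivative.eval t +
      φ.cV.eval t * φ.cV.derivative.eval t) := by
    simp [cE, Polynomial.derivative_sq]; ring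
  have hp := φ.hasDerivAt_point t hW i
  rw [hE'] at hσ
  fin_cases i
  · have := (((φ.cV.hasDerivAt t).div hσ h0).const_mul (d : ℂ))
    refine (hp.add this).congr_deriv ?_
    simp [speed]
    field_simp
    linear_combination (d : ℂ) * φ.cW.eval t ^ 2 * φ.cV.derivative.eval t * hs
  · have := ((((φ.cU.hasDerivAt t).div hσ h0).neg).const_mul (d : ℂ))
    refine (hp.add this).congr_deriv ?_
    simp [speed]
    field_simp
    linear_combination (-d : ℂ) * φ.cW.eval t ^ 2 * φ.cU.derivative.eval t * hs

/-- W² s³ times the speed has the form a(t) + b(t) s, so it vanishes identically or finitely often.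
Identical vanishing would make `gen` locally constant, but each of its values is taken finitely
often on a branch. -/
theorem IsBranch.eventually_speed_ne_zero (hB : φ.IsBranch B) (h : φ.IsAdmissible d) :
    ∀ᶠ e in genericOn B, φ.speed d e ≠ 0 := by
  let a : Polynomial ℂ := Polynomial.C (d : ℂ) * φ.cW ^ 2 *
    (φ.cU * φ.cV.derivative - φ.cU.derivative * φ.cV)
  have hnum (e) (he : e ∈ φ.flags) : a.eval e.1 + φ.cE.eval e.1 * e.2 =
      φ.speed d e * (φ.cW.eval e.1 ^ 2 * e.2 ^ 3) := by
    have h1 := he.1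
    have h2 := he.2.1
    rw [← he.2.2]
    simp [a, speed]
    field_simp
    ring
  by_cases hex : ∃ e ∈ B, φ.speed d e ≠ 0
  · obtain ⟨e₀, he₀, h0⟩ := hex
    have hf := hB.subset_flags he₀
    have := hB.eventually_ne_zero a φ.cE ⟨e₀, he₀, by
      rw [hnum _ hf]
      exact mul_ne_zero h0 (mul_ne_zero (pow_ne_zero _ hf.1) (pow_ne_zero _ hf.2.1))⟩
    filter_upwards [this, eventually_mem_genericOn] with e he hmem h0
    apply he
    rw [hnum _ (hB.subset_flags hmem), h0, zero_mul]
  · exfalso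
    push Not at hex
    obtain ⟨e, he⟩ := (hB.infinite h).nonempty
    obtain ⟨σ, hσ, hloc⟩ := hB.exists_local he
    have hconst (i : Fin 2) :
        ∀ᶠ τ in nhds e.1, φ.gen d (τ, σ τ) i = φ.gen d (e.1, σ e.1) i := by
      refine eventually_eq_of_hasDerivAt_zero (f := fun τ => φ.gen d (τ, σ τ) i) ?_
      filter_upwards [hloc] with τ hτ
      refine (hasDerivAt_gen (hB.subset_flags hτ.1) hτ.2 i).congr_deriv ?_
      rw [hex _ hτ.1, zero_mul]
    have hinf := infinite_setOf_of_eventually (hloc.and ((hconst 0).and (hconst 1)))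
    have hfin := eventually_genericOn.1 (hB.eventually_gen_ne h (φ.gen d (e.1, σ e.1)))
    refine hinf ((hfin.image Prod.fst).subset ?_)
    rintro τ ⟨h1, h2, h3⟩
    refine ⟨(τ, σ τ), ⟨h1.1, ?_⟩, rfl⟩
    rw [not_not]
    ext i
    fin_cases i
    · exact h2
    · exact h3

/-- The tangent of the offset is parallel to the tangent of the curve. -/
theorem IsBranch.gradient_mul_tangent (hB : φ.IsBranch B) {f : PolyXY}
    (hf : ∀ e ∈ B, eval (φ.gen d e) f = 0) {e : ℂ × ℂ} (he : e ∈ B) (hs : φ.speed d e ≠ 0) :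
    eval (φ.gen d e) (pderiv 0 f) * φ.cU.eval e.1 +
      eval (φ.gen d e) (pderiv 1 f) * φ.cV.eval e.1 = 0 := by
  obtain ⟨σ, hσ, hloc⟩ := hB.exists_local he
  have hself := hloc.self_of_nhds
  have hd := hasDerivAt_eval_comp f (γ := fun τ => φ.gen d (τ, σ τ))
    (v := fun i => φ.speed d (e.1, σ e.1) * (![φ.cU.eval e.1, φ.cV.eval e.1] : Plane) i)
    (hasDerivAt_gen (hB.subset_flags hself.1) hself.2)
  have h0 : HasDerivAt (fun τ => eval (φ.gen d (τ, σ τ)) f) 0 e.1 := by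
    refine (hasDerivAt_const e.1 (0 : ℂ)).congr_of_eventuallyEq ?_
    filter_upwards [hloc] with τ hτ
    exact hf _ hτ.1
  have := hd.unique h0
  have he' : (e.1, σ e.1) = e := Prod.ext rfl hσ
  rw [he'] at this
  refine (mul_eq_zero.1 ?_).resolve_left hs
  simp only [Matrix.cons_val_zero, Matrix.cons_val_one] at this
  linear_combination this

end RatParam
end Offset
end

/-! ### The normal and circle polynomials; the resultant does not vanish. -/

noncomputable section
namespace Offset

open MvPolynomial Filter

theorem affinePoly_eq_zero_iff {a b c : ℂ} : affinePoly a b c = 0 ↔ a = 0 ∧ b = 0 ∧ c = 0 := by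
  constructor
  · intro h
    have h0 := congrArg (eval (![0, 0] : Plane)) h
    have h1 := congrArg (eval (![1, 0] : Plane)) h
    have h2 := congrArg (eval (![0, 1] : Plane)) h
    simp at h0 h1 h2
    simpa [h0] using And.intro h1 h2
  · rintro ⟨rfl, rfl, rfl⟩
    simp [affinePoly]

namespace RatParam

variable {φ : RatParam} {d : ℝ} {B : Set (ℂ × ℂ)}

theorem eval_normalPoly (t : ℂ) : φ.normalPoly.eval (C t) =
    affinePoly (φ.cU.eval t * φ.cW.eval t) (φ.cV.eval t * φ.cW.eval t)
      (-(φ.cU.eval t * φ.cX.eval t + φ.cV.eval t * φ.cY.eval t)) := by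
  have h (p : Polynomial ℝ) : realInT p = inT (toC p) := rfl
  simp only [normalPoly, h, toC_U, toC_V, varX, varY, affinePoly, Polynomial.eval_add,
    Polynomial.eval_mul, Polynomial.eval_sub, eval_inT, Polynomial.eval_C, cX, cY, cW, map_mul,
    map_neg, map_add]
  ring

theorem eval_circlePoly (t : ℂ) : (φ.circlePoly d).eval (C t) =
    (C (φ.cW.eval t) * MvPolynomial.X 0 - C (φ.cX.eval t)) ^ 2 +
      (C (φ.cW.eval t) * MvPolynomial.X 1 - C (φ.cY.eval t)) ^ 2 -
      C ((d : ℂ) ^ 2 * φ.cW.eval t ^ 2) := by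
  have h (p : Polynomial ℝ) : realInT p = inT (toC p) := rfl
  have hd : toC (Polynomial.C (d ^ 2) * φ.W ^ 2) = Polynomial.C ((d : ℂ) ^ 2) * φ.cW ^ 2 := by
    simp [toC, cW]
  simp only [circlePoly, h, hd, varX, varY, Polynomial.eval_add, Polynomial.eval_pow,
    Polynomial.eval_mul, Polynomial.eval_sub, eval_inT, Polynomial.eval_C, cX, cY, cW]

theorem notMem_badParams {t : ℂ} : t ∉ φ.badParams ↔ φ.cW.eval t ≠ 0 ∧ φ.cE.eval t ≠ 0 := by
  simp [badParams]

theorem fst_notMem_badParams {e : ℂ × ℂ} (he : e ∈ φ.flags) : e.1 ∉ φ.badParams :=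
  notMem_badParams.2 ⟨he.1, cE_eval_ne_zero he⟩

theorem eval_normalPoly_gen {e : ℂ × ℂ} (he : e ∈ φ.flags) :
    eval (φ.gen d e) (φ.normalPoly.eval (C e.1)) = 0 := by
  have h1 := he.1
  have h2 := tangent_nrm (φ := φ) e
  simp only [eval_normalPoly, eval_affinePoly, gen, Pi.add_apply, Pi.smul_apply, smul_eq_mul,
    point_zero, point_one]
  field_simp
  linear_combination φ.cW.eval e.1 * d * h2

theorem eval_circlePoly_gen {e : ℂ × ℂ} (he : e ∈ φ.flags) :
    eval (φ.gen d e) ((φ.circlePoly d).eval (C e.1)) = 0 := by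
  have h1 := he.1
  have h2 := nrm_sq he
  simp only [eval_circlePoly, map_add, map_sub, map_mul, map_pow, eval_X, eval_C, gen,
    Pi.add_apply, Pi.smul_apply, smul_eq_mul, point_zero, point_one]
  field_simp
  linear_combination (d : ℂ) ^ 2 * φ.cW.eval e.1 ^ 2 * h2

/-- A point on the normal at `t` is `φ(t) + l (V, -U)`. -/
theorem exists_of_eval_normalPoly {t : ℂ} (ht : t ∉ φ.badParams) {q : Plane}
    (hn : eval q (φ.normalPoly.eval (C t)) = 0) :
    ∃ l : ℂ, q 0 = φ.point t 0 + l * φ.cV.eval t ∧ q 1 = φ.point t 1 - l * φ.cU.eval t := by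
  obtain ⟨hW, hE⟩ := notMem_badParams.1 ht
  rw [eval_normalPoly, eval_affinePoly] at hn
  rw [eval_cE] at hE
  refine ⟨(φ.cV.eval t * (q 0 - φ.point t 0) - φ.cU.eval t * (q 1 - φ.point t 1)) /
    (φ.cU.eval t ^ 2 + φ.cV.eval t ^ 2), ?_, ?_⟩
  · rw [point_zero, point_one]
    field_simp
    linear_combination φ.cU.eval t * hn
  · rw [point_zero, point_one]
    field_simp
    linear_combination φ.cV.eval t * hn

/-- On the normal, q = φ(t) + l (V, -U), and the circle gives l² E = d²; so s = d / l is the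
required root. This is the converse of `eval_normalPoly_gen` and `eval_circlePoly_gen`. -/
theorem exists_flag_of_eval {t : ℂ} (hd : 0 < d) (ht : t ∉ φ.badParams) {q : Plane}
    (hn : eval q (φ.normalPoly.eval (C t)) = 0)
    (hc : eval q ((φ.circlePoly d).eval (C t)) = 0) :
    ∃ s, (t, s) ∈ φ.flags ∧ φ.gen d (t, s) = q := by
  obtain ⟨l, h0, h1⟩ := exists_of_eval_normalPoly ht hn
  obtain ⟨hW, hE⟩ := notMem_badParams.1 ht
  have hd' : (d : ℂ) ≠ 0 := by exact_mod_cast hd.ne'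
  simp only [eval_circlePoly, map_add, map_sub, map_mul, map_pow, eval_X, eval_C, h0, h1,
    point_zero, point_one] at hc
  have hl : l ^ 2 * φ.cE.eval t = (d : ℂ) ^ 2 := by
    rw [eval_cE]
    field_simp at hc
    apply mul_left_cancel₀ (pow_ne_zero 2 hW)
    linear_combination hc
  have hl0 : l ≠ 0 := by
    rintro rfl
    apply pow_ne_zero 2 hd'
    rw [← hl]; ring
  refine ⟨d / l, ⟨hW, div_ne_zero hd' hl0, ?_⟩, ?_⟩
  · simp only [div_pow]
    rw [← hl]
    field_simp
  · ext i
    fin_cases i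
    · simp [gen, nrm, h0]
      field_simp
    · simp [gen, nrm, h1]
      field_simp
      ring

/-- At a good parameter W ≠ 0 and (U, V) ≠ 0, so the normal polynomial is not identically zero there
and its content does not vanish. -/
theorem exists_eval_normalPoly_eq {P : PolyXYT} (hP : IsPrimitivePartT φ.normalPoly P) {t : ℂ}
    (ht : t ∉ φ.badParams) : ∃ k : ℂ, k ≠ 0 ∧ φ.normalPoly.eval (C t) = C k * P.eval (C t) := by
  obtain ⟨⟨c, -, hc⟩, -⟩ := hP
  obtain ⟨hW, hE⟩ := notMem_badParams.1 ht
  have h : φ.normalPoly.eval (C t) = C (c.eval t) * P.eval (C t) := by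
    rw [hc, Polynomial.eval_mul, eval_inT]
  refine ⟨c.eval t, fun h0 => ?_, h⟩
  rw [h0, C_0, zero_mul, eval_normalPoly, affinePoly_eq_zero_iff] at h
  apply hE
  rw [eval_cE, (mul_eq_zero.1 h.1).resolve_right hW, (mul_eq_zero.1 h.2.1).resolve_right hW]
  norm_num

/-- On a vertical line W y - Y takes both values 0 and 1, and the equation cannot hold for both. -/
theorem circlePoly_eval_ne_zero {t : ℂ} (ht : φ.cW.eval t ≠ 0) (x : ℂ) :
    ∃ y, eval ![x, y] ((φ.circlePoly d).eval (C t)) ≠ 0 := by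
  by_contra! h
  have h0 := h (φ.cY.eval t / φ.cW.eval t)
  have h1 := h ((φ.cY.eval t + 1) / φ.cW.eval t)
  simp only [eval_circlePoly, map_add, map_sub, map_mul, map_pow, eval_X, eval_C,
    Matrix.cons_val_zero, Matrix.cons_val_one] at h0 h1
  rw [mul_div_cancel₀ _ ht] at h0 h1
  have : (1 : ℂ) = 0 := by linear_combination h1 - h0
  exact one_ne_zero this

theorem exists_eval_circlePoly_eq {Q : PolyXYT}
    (hQ : ∃ c : Polynomial ℂ, c ≠ 0 ∧ φ.circlePoly d = inT c * Q) {t : ℂ}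
    (ht : t ∉ φ.badParams) :
    ∃ k : ℂ, k ≠ 0 ∧ (φ.circlePoly d).eval (C t) = C k * Q.eval (C t) := by
  obtain ⟨c, -, hc⟩ := hQ
  obtain ⟨hW, hE⟩ := notMem_badParams.1 ht
  have h : (φ.circlePoly d).eval (C t) = C (c.eval t) * Q.eval (C t) := by
    rw [hc, Polynomial.eval_mul, eval_inT]
  refine ⟨c.eval t, fun h0 => ?_, h⟩
  obtain ⟨y, hy⟩ := circlePoly_eval_ne_zero (d := d) hW 0
  apply hy
  rw [h, h0]; simp

theorem eval_eq_zero_iff_normalPoly {P : PolyXYT} (hP : IsPrimitivePartT φ.normalPoly P) {t : ℂ}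
    (ht : t ∉ φ.badParams) (q : Plane) :
    eval q (P.eval (C t)) = 0 ↔ eval q (φ.normalPoly.eval (C t)) = 0 := by
  obtain ⟨k, hk, h⟩ := exists_eval_normalPoly_eq hP ht
  simp [h, hk]

theorem eval_eq_zero_iff_circlePoly {Q : PolyXYT}
    (hQ : ∃ c : Polynomial ℂ, c ≠ 0 ∧ φ.circlePoly d = inT c * Q) {t : ℂ}
    (ht : t ∉ φ.badParams) (q : Plane) :
    eval q (Q.eval (C t)) = 0 ↔ eval q ((φ.circlePoly d).eval (C t)) = 0 := by
  obtain ⟨k, hk, h⟩ := exists_eval_circlePoly_eq hQ ht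
  simp [h, hk]

/-- The primitive part of the normal polynomial is affine in `x, y`. -/
theorem exists_eq_of_isPrimitivePartT {P : PolyXYT} (hP : IsPrimitivePartT φ.normalPoly P) :
    ∃ a b c : Polynomial ℂ, P = inT a * varX + inT b * varY + inT c := by
  obtain ⟨⟨k, hk, hkP⟩, -⟩ := hP
  have h (p : Polynomial ℝ) : realInT p = inT (toC p) := rfl
  have hmap (q : Plane) : φ.cU * (φ.cW * Polynomial.C (q 0) - φ.cX) +
      φ.cV * (φ.cW * Polynomial.C (q 1) - φ.cY) = k * P.map (eval q) := by
    have := congrArg (Polynomial.map (eval q)) hkP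
    simpa [normalPoly, h, toC_U, toC_V, varX, varY, cX, cY, cW] using this
  -- The coefficients of an affine polynomial are determined by its values at (0, 0), (1, 0) and (0,
  -- 1).
  have h0 := hmap ![0, 0]
  have h1 := hmap ![1, 0]
  have h2 := hmap ![0, 1]
  refine ⟨P.map (eval ![1, 0]) - P.map (eval ![0, 0]), P.map (eval ![0, 1]) - P.map (eval ![0, 0]),
    P.map (eval ![0, 0]), mul_left_cancel₀ (inT_ne_zero hk) ?_⟩
  have hm (p q : Polynomial ℂ) : inT (p * q) = inT p * inT q := Polynomial.map_mul _
  have hs (p q : Polynomial ℂ) : inT (p - q) = inT p - inT q := Polynomial.map_sub _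
  have hU : φ.cU * φ.cW = k * (P.map (eval ![1, 0]) - P.map (eval ![0, 0])) := by
    simp at h0 h1
    linear_combination h1 - h0
  have hV : φ.cV * φ.cW = k * (P.map (eval ![0, 1]) - P.map (eval ![0, 0])) := by
    simp at h0 h2
    linear_combination h2 - h0
  have hX : -(φ.cU * φ.cX) - (φ.cV * φ.cY) = k * P.map (eval ![0, 0]) := by
    simp at h0
    linear_combination h0
  rw [mul_add, mul_add, ← mul_assoc, ← mul_assoc, ← hm, ← hm, ← hm, ← hU, ← hV, ← hX, ← hkP,
    normalPoly, h, h, h, h, h, toC_U, toC_V, hs, hm, hm, ← neg_one_mul, hm, hm, hm]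
  have : inT (-1) = -1 := by simp [inT]
  rw [this, cX, cY, cW]
  ring

theorem exists_affinePoly_eval {P : PolyXYT} (hP : IsPrimitivePartT φ.normalPoly P) (t : ℂ) :
    ∃ a b c : ℂ, P.eval (C t) = affinePoly a b c := by
  obtain ⟨a, b, c, h⟩ := exists_eq_of_isPrimitivePartT hP
  exact ⟨a.eval t, b.eval t, c.eval t, by simp [h, affinePoly, varX, varY]⟩

theorem exists_affinePoly_leadingCoeff {P : PolyXYT} (hP : IsPrimitivePartT φ.normalPoly P) :
    ∃ a b c : ℂ, P.leadingCoeff = affinePoly a b c := by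
  obtain ⟨a, b, c, h⟩ := exists_eq_of_isPrimitivePartT hP
  refine ⟨a.coeff P.natDegree, b.coeff P.natDegree, c.coeff P.natDegree, ?_⟩
  have hc (n : ℕ) : P.coeff n = affinePoly (a.coeff n) (b.coeff n) (c.coeff n) := by
    simp [h, inT, affinePoly, varX, varY]
  exact hc _

theorem leadingCoeff_ne_zero {P : PolyXYT} (hP : IsPrimitivePartT φ.normalPoly P) :
    P.leadingCoeff ≠ 0 := by
  intro h
  rw [Polynomial.leadingCoeff_eq_zero] at h
  exact hP.eval_ne_zero 0 (by simp [h])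

theorem exists_eval_ne_zero {g : PolyXY} (hg : g ≠ 0) : ∃ p, eval p g ≠ 0 := by
  by_contra! h
  exact hg (MvPolynomial.funext fun p => by simpa using h p)

/-- A point is sought where the leading coefficient of `P` and `P` at the bad parameters are nonzero
and which no good parameter generates. The abscissa is chosen so that only finitely many good
parameters generate a point above it; the ordinate then avoids finitely many nonzero polynomials. -/
theorem IsAdmissible.resultant_ne_zero (h : φ.IsAdmissible d) {P Q : PolyXYT}
    (hP : IsPrimitivePartT φ.normalPoly P)
    (hQ : ∃ c : Polynomial ℂ, c ≠ 0 ∧ φ.circlePoly d = inT c * Q) :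
    Polynomial.resultant P Q ≠ 0 := by
  classical
  let T := h.finite_badParams.toFinset
  let R : PolyXY := P.leadingCoeff * ∏ t ∈ T, P.eval (C t)
  have hR : R ≠ 0 := mul_ne_zero (leadingCoeff_ne_zero hP)
    (Finset.prod_ne_zero_iff.2 fun t _ => hP.eval_ne_zero t)
  obtain ⟨t₁, ht₁⟩ := h.finite_badParams.infinite_compl.nonempty
  obtain ⟨hW₁, hE₁⟩ := notMem_badParams.1 ht₁
  -- `K` at `p` is the value at t₁ of the polynomial `k` below, which is therefore nonzero.
  let K : PolyXY := C (φ.cE.eval t₁) * (C (φ.cW.eval t₁) * MvPolynomial.X 0 - C (φ.cX.eval t₁)) ^ 2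
    - C ((d : ℂ) ^ 2 * φ.cW.eval t₁ ^ 2 * φ.cV.eval t₁ ^ 2)
  have hK : K ≠ 0 := by
    intro h0
    have e0 := congrArg (eval (![φ.cX.eval t₁ / φ.cW.eval t₁, 0] : Plane)) h0
    have e1 := congrArg (eval (![(φ.cX.eval t₁ + 1) / φ.cW.eval t₁, 0] : Plane)) h0
    simp only [K, map_sub, map_mul, map_pow, eval_X, eval_C, map_zero,
      Matrix.cons_val_zero] at e0 e1
    rw [mul_div_cancel₀ _ hW₁] at e0 e1
    apply hE₁
    linear_combination e1 - e0
  obtain ⟨p, hp⟩ := exists_eval_ne_zero (mul_ne_zero hR hK)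
  rw [map_mul] at hp
  -- Squaring x = X/W + d V/s and using s² = E shows that a good parameter generating a point of
  -- abscissa `p 0` is a root of `k`.
  let k : Polynomial ℂ := φ.cE * (φ.cW * Polynomial.C (p 0) - φ.cX) ^ 2 -
    Polynomial.C ((d : ℂ) ^ 2) * φ.cW ^ 2 * φ.cV ^ 2
  have hk : k ≠ 0 := by
    intro h0
    apply right_ne_zero_of_mul hp
    have := congrArg (Polynomial.eval t₁) h0
    simpa [k, K] using this
  let θ := lineHom ![p 0, 0] ![0, 1]
  have hθ (g : PolyXY) (y : ℂ) : (θ g).eval y = eval ![p 0, y] g := by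
    rw [eval_lineHom]
    congr 2
    ext i
    fin_cases i <;> simp
  have hθ0 {g : PolyXY} {y : ℂ} (hg : eval ![p 0, y] g ≠ 0) : θ g ≠ 0 := by
    intro h0
    rw [← hθ, h0] at hg
    simp at hg
  let T' := {t ∈ k.roots.toFinset | t ∉ φ.badParams}
  have hM : θ R * ∏ t ∈ T', θ (Q.eval (C t)) ≠ 0 := by
    refine mul_ne_zero (hθ0 (y := p 1) ?_) (Finset.prod_ne_zero_iff.2 fun t ht => ?_)
    · have : ![p 0, p 1] = p := by ext i; fin_cases i <;> rfl
      rw [this]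
      exact left_ne_zero_of_mul hp
    · have ht' := (Finset.mem_filter.1 ht).2
      obtain ⟨y, hy⟩ := circlePoly_eval_ne_zero (d := d) (notMem_badParams.1 ht').1 (p 0)
      exact hθ0 (y := y) ((eval_eq_zero_iff_circlePoly hQ ht' _).not.2 hy)
  obtain ⟨y, hy⟩ : ∃ y, (θ R * ∏ t ∈ T', θ (Q.eval (C t))).eval y ≠ 0 := by
    by_contra! hc
    exact hM (Polynomial.funext fun y => by simpa using hc y)
  rw [Polynomial.eval_mul, Polynomial.eval_prod, hθ, map_mul, map_prod, mul_assoc] at hy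
  simp only [hθ] at hy
  have hlc := left_ne_zero_of_mul hy
  have h1 := Finset.prod_ne_zero_iff.1 (left_ne_zero_of_mul (right_ne_zero_of_mul hy))
  have h2 := Finset.prod_ne_zero_iff.1 (right_ne_zero_of_mul (right_ne_zero_of_mul hy))
  intro hres
  obtain ⟨t, hPt, hQt⟩ := (eval_resultant_eq_zero_iff (P := P) (L := Q) hlc).1 (by simp [hres])
  by_cases ht : t ∈ φ.badParams
  · exact h1 t (by simpa [T] using ht) hPt
  · refine h2 t (Finset.mem_filter.2 ⟨?_, ht⟩) hQt
    rw [Multiset.mem_toFinset, Polynomial.mem_roots hk, Polynomial.IsRoot]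
    obtain ⟨s, hs, hgen⟩ := exists_flag_of_eval h.pos ht
      ((eval_eq_zero_iff_normalPoly hP ht _).1 hPt) ((eval_eq_zero_iff_circlePoly hQ ht _).1 hQt)
    have hx : p 0 = φ.cX.eval t / φ.cW.eval t + d * (φ.cV.eval t / s) := by
      have := congrFun hgen 0
      simpa [gen, nrm, point_zero] using this.symm
    have hW : φ.cW.eval t ≠ 0 := hs.1
    have hs0 : s ≠ 0 := hs.2.1
    have hs2 : s ^ 2 = φ.cE.eval t := hs.2.2
    simp only [k, hx, Polynomial.eval_sub, Polynomial.eval_mul, Polynomial.eval_pow,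
      Polynomial.eval_C, ← hs2]
    field_simp
    ring

/-! ### Equations of branches -/

variable (φ d B) in
/-- `f` is an irreducible equation of the offset of the branch `B`. -/
def IsEquation (f : PolyXY) : Prop :=
  Irreducible f ∧ zariskiClosure (φ.gen d '' B) = zeroSet f

theorem IsEquation.eval_gen {f : PolyXY} (hf : φ.IsEquation d B f) {e : ℂ × ℂ} (he : e ∈ B) :
    eval (φ.gen d e) f = 0 := by
  have := subset_zariskiClosure _ (Set.mem_image_of_mem (φ.gen d) he)
  rwa [hf.2] at this

theorem IsEquation.dvd_iff {f g : PolyXY} (hf : φ.IsEquation d B f) :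
    f ∣ g ↔ ∀ e ∈ B, eval (φ.gen d e) g = 0 := by
  constructor
  · rintro ⟨k, rfl⟩ e he
    rw [map_mul, hf.eval_gen he, zero_mul]
  · intro h
    apply dvd_of_zeroSet_subset hf.1
    rw [← hf.2]
    apply zariskiClosure_subset_zeroSet
    rintro _ ⟨e, he, rfl⟩
    exact h e he

theorem IsEquation.eventually_ne_zero {f g : PolyXY} (hf : φ.IsEquation d B f)
    (hB : φ.IsBranch B) (hg : ¬ f ∣ g) : ∀ᶠ e in genericOn B, eval (φ.gen d e) g ≠ 0 := by
  rw [hf.dvd_iff] at hg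
  push Not at hg
  exact hB.eventually_eval_gen_ne_zero hg

theorem IsAdmissible.exists_isPrimitivePartT_normalPoly (h : φ.IsAdmissible d) :
    ∃ P, IsPrimitivePartT φ.normalPoly P := by
  obtain ⟨t, ht⟩ := h.finite_badParams.infinite_compl.nonempty
  obtain ⟨hW, hE⟩ := notMem_badParams.1 ht
  have hn : φ.normalPoly ≠ 0 := by
    intro h0
    have := eval_normalPoly (φ := φ) t
    rw [h0, Polynomial.eval_zero, eq_comm, affinePoly_eq_zero_iff] at this
    apply hE
    rw [eval_cE, (mul_eq_zero.1 this.1).resolve_right hW,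
      (mul_eq_zero.1 this.2.1).resolve_right hW]
    norm_num
  exact exists_isPrimitivePartT hn

/-- Allows the circle polynomial itself in the role of `Q`, which need only be a quotient by a
polynomial in t. -/
theorem circlePoly_eq_inT_mul :
    ∃ c : Polynomial ℂ, c ≠ 0 ∧ φ.circlePoly d = inT c * φ.circlePoly d :=
  ⟨1, one_ne_zero, by simp [inT]⟩

/-- The vanishing ideal is prime because two polynomials not vanishing on the branch are both
nonzero at a generic flag. It is nonzero because a multiple of the resultant vanishes on the offset
points; a prime element of it cuts out the closure. -/
theorem IsBranch.exists_isEquation (hB : φ.IsBranch B) (h : φ.IsAdmissible d) :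
    ∃ f, φ.IsEquation d B f := by
  obtain ⟨P, hP⟩ := h.exists_isPrimitivePartT_normalPoly
  -- The leading coefficient is included because the root criterion for the resultant is available
  -- only where it does not vanish.
  have hR := mul_ne_zero (leadingCoeff_ne_zero hP) (h.resultant_ne_zero hP circlePoly_eq_inT_mul)
  have hI : (vanishingIdeal ℂ (φ.gen d '' B)).IsPrime := by
    constructor
    · rw [Ne, Ideal.eq_top_iff_one, mem_vanishingIdeal_iff]
      intro h1
      obtain ⟨e, he⟩ := (hB.infinite h).nonempty
      simpa using h1 _ (Set.mem_image_of_mem _ he)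
    · intro f g hfg
      by_contra! hc
      simp only [mem_vanishingIdeal_iff, not_forall, Set.mem_image, aeval_eq_eval] at hc
      obtain ⟨⟨_, ⟨e₁, he₁, rfl⟩, h1⟩, ⟨_, ⟨e₂, he₂, rfl⟩, h2⟩⟩ := hc
      obtain ⟨e, he, h3⟩ := hB.exists_of_eventually h
        ((hB.eventually_eval_gen_ne_zero ⟨e₁, he₁, h1⟩).and
          (hB.eventually_eval_gen_ne_zero ⟨e₂, he₂, h2⟩))
      have := hfg _ (Set.mem_image_of_mem _ he)
      rw [aeval_eq_eval] at this
      exact mul_ne_zero h3.1 h3.2 (by simpa using this)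
  obtain ⟨f, hfI, hf⟩ := exists_irreducible_of_isPrime hI fun hbot => by
    refine hR (?_ : _ ∈ (⊥ : Ideal PolyXY))
    rw [← hbot, mem_vanishingIdeal_iff]
    rintro _ ⟨e, he, rfl⟩
    have he' := hB.subset_flags he
    rw [aeval_eq_eval]
    change eval _ _ = 0
    rw [map_mul]
    by_cases hlc : eval (φ.gen d e) P.leadingCoeff = 0
    · rw [hlc, zero_mul]
    · rw [(eval_resultant_eq_zero_iff hlc).2 ⟨e.1, ?_, eval_circlePoly_gen he'⟩, mul_zero]
      rw [eval_eq_zero_iff_normalPoly hP (fst_notMem_badParams he')]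
      exact eval_normalPoly_gen he'
  refine ⟨f, hf, zariskiClosure_eq_zeroSet hf (hB.infinite_gen h) ?_⟩
  intro q hq
  have := hfI q hq
  rwa [aeval_eq_eval] at this

/-- The offset of a branch is not a line. -/
theorem IsEquation.not_dvd_affinePoly {f : PolyXY} (hf : φ.IsEquation d B f)
    (hB : φ.IsBranch B) (h : φ.IsAdmissible d) {a b c : ℂ} (h0 : affinePoly a b c ≠ 0) :
    ¬ f ∣ affinePoly a b c := by
  intro hdvd
  have hvan := hf.dvd_iff.1 hdvd
  have hab : a ≠ 0 ∨ b ≠ 0 := by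
    by_contra! hab
    obtain ⟨rfl, rfl⟩ := hab
    obtain ⟨e, he⟩ := (hB.infinite h).nonempty
    have := hvan e he
    simp at this
    exact h0 (by simp [affinePoly, this])
  -- If the offset lies on a x + b y + c = 0, the tangent is annihilated by (a, b), so the curve
  -- lies on the two lines a x + b y + c = ±d ρ with ρ² = a² + b². The product of the two equations
  -- vanishes, hence one of them does; ρ = 0 is allowed.
  obtain ⟨ρ, hρ⟩ := IsAlgClosed.exists_pow_nat_eq (a ^ 2 + b ^ 2) (n := 2) (by norm_num)
  let L : Polynomial ℂ := Polynomial.C a * φ.cX + Polynomial.C b * φ.cY + Polynomial.C c * φ.cW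
  have hprod : (L - Polynomial.C (d * ρ) * φ.cW) * (L + Polynomial.C (d * ρ) * φ.cW) = 0 := by
    have hfin := eventually_genericOn.1 (hB.eventually_speed_ne_zero h)
    refine Polynomial.eq_zero_of_infinite_isRoot _
      (((hB.infinite_fst h).sdiff (hfin.image Prod.fst)).mono ?_)
    rintro t ⟨⟨s, hs⟩, hsp⟩
    have hspeed : φ.speed d (t, s) ≠ 0 := by
      intro h0
      exact hsp ⟨(t, s), ⟨hs, by simpa using h0⟩, rfl⟩
    have htan := hB.gradient_mul_tangent hvan hs hspeed
    have hv := hvan _ hs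
    have hflag := hB.subset_flags hs
    have hW : φ.cW.eval t ≠ 0 := hflag.1
    have hs0 : s ≠ 0 := hflag.2.1
    have hs2 : s ^ 2 = φ.cU.eval t ^ 2 + φ.cV.eval t ^ 2 := by rw [← eval_cE]; exact hflag.2.2
    have htan' : a * φ.cU.eval t + b * φ.cV.eval t = 0 := by
      simpa [affinePoly, pderiv_mul, pderiv_X] using htan
    simp only [eval_affinePoly, gen, nrm, Pi.add_apply, Pi.smul_apply, smul_eq_mul, point_zero,
      point_one, Matrix.cons_val_zero, Matrix.cons_val_one] at hv
    field_simp at hv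
    simp only [Set.mem_ofPred_eq, Polynomial.IsRoot, L, Polynomial.eval_mul, Polynomial.eval_add,
      Polynomial.eval_sub, Polynomial.eval_C]
    apply mul_left_cancel₀ (pow_ne_zero 2 hs0)
    have hv' : s * (a * φ.cX.eval t + b * φ.cY.eval t + c * φ.cW.eval t) =
        -(d * φ.cW.eval t * (a * φ.cV.eval t - b * φ.cU.eval t)) := by
      linear_combination hv
    have hv2 := congrArg (fun z : ℂ => z ^ 2) hv'
    beta_reduce at hv2
    linear_combination hv2 - (d : ℂ) ^ 2 * φ.cW.eval t ^ 2 * s ^ 2 * hρ -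
      (d : ℂ) ^ 2 * φ.cW.eval t ^ 2 * (a ^ 2 + b ^ 2) * hs2 -
      (d : ℂ) ^ 2 * φ.cW.eval t ^ 2 * (a * φ.cU.eval t + b * φ.cV.eval t) * htan'
  apply h.not_isLine
  rcases mul_eq_zero.1 hprod with h1 | h1
  · refine φ.isLine_curve h.proper (c := d * ρ - c) hab ?_
    simp only [L, map_sub] at h1 ⊢
    linear_combination h1
  · refine φ.isLine_curve h.proper (c := -(d * ρ) - c) hab ?_
    simp only [L, map_sub, map_neg] at h1 ⊢
    linear_combination h1

end RatParam
end Offset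
end

/-! ### Generic fibers of the offset map. -/

noncomputable section
namespace Offset

open MvPolynomial Filter

theorem rootMultiplicity_prod {ι : Type*} (S : Finset ι) (p : ι → Polynomial ℂ) (z : ℂ)
    (h : ∀ i ∈ S, p i ≠ 0) :
    (∏ i ∈ S, p i).rootMultiplicity z = ∑ i ∈ S, (p i).rootMultiplicity z := by
  classical
  induction S using Finset.induction with
  | empty => simp [Polynomial.rootMultiplicity_eq_zero]
  | insert a S ha ih =>
    rw [Finset.prod_insert ha, Finset.sum_insert ha, Polynomial.rootMultiplicity_mul,
      ih fun i hi => h i (Finset.mem_insert_of_mem hi)]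
    exact mul_ne_zero (h a (Finset.mem_insert_self _ _))
      (Finset.prod_ne_zero_iff.2 fun i hi => h i (Finset.mem_insert_of_mem hi))

theorem rootMultiplicity_pow_eq (p : Polynomial ℂ) (hp : p ≠ 0) (z : ℂ) (n : ℕ) :
    (p ^ n).rootMultiplicity z = n * p.rootMultiplicity z := by
  have := rootMultiplicity_prod (Finset.range n) (fun _ => p) z fun _ _ => hp
  simpa using this

namespace RatParam

variable {φ : RatParam} {d : ℝ} {B : Set (ℂ × ℂ)} {f : PolyXY} {P Q : PolyXYT}

variable (φ) in
/-- The parametrization is injective at `t`. -/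
def IsInjectiveAt (t : ℂ) : Prop :=
  ∀ t', φ.IsDefinedAt t' → φ.point t' = φ.point t → t' = t

theorem IsBranch.eventually_isInjectiveAt (hB : φ.IsBranch B) (h : φ.IsAdmissible d) :
    ∀ᶠ e in genericOn B, φ.IsInjectiveAt e.1 := by
  filter_upwards [hB.eventually_fst_notMem h.proper, eventually_mem_genericOn] with e he hmem t ht hpt
  by_contra hne
  exact he ⟨(φ.isDefinedAt_iff _).2 (hB.subset_flags hmem).1, t, ht, hne, hpt⟩

theorem isDefinedAt_fst {e : ℂ × ℂ} (he : e ∈ φ.flags) : φ.IsDefinedAt e.1 :=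
  (φ.isDefinedAt_iff _).2 he.1

variable (φ d) in
/-- `e'` generates the same offset point as `e`, from the opposite side. -/
def IsOpposite (e e' : ℂ × ℂ) : Prop :=
  φ.nrm e' = -φ.nrm e ∧ φ.point e'.1 = φ.point e.1 + (2 * d : ℂ) • φ.nrm e

/-- Tangents annihilated by the same nonzero covector are parallel, so the normals have zero cross
product. Their dot product c then satisfies c² = 1, because both have square sum 1. -/
theorem nrm_eq_or_eq_neg {e e' : ℂ × ℂ} (he : e ∈ φ.flags) (he' : e' ∈ φ.flags) {g₀ g₁ : ℂ}
    (hg : g₀ ≠ 0 ∨ g₁ ≠ 0) (h : g₀ * φ.cU.eval e.1 + g₁ * φ.cV.eval e.1 = 0)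
    (h' : g₀ * φ.cU.eval e'.1 + g₁ * φ.cV.eval e'.1 = 0) :
    φ.nrm e' = φ.nrm e ∨ φ.nrm e' = -φ.nrm e := by
  have hn := nrm_sq he
  have hn' := nrm_sq he'
  have hs := he.2.1
  have hs' := he'.2.1
  have hcross : φ.nrm e 0 * φ.nrm e' 1 - φ.nrm e 1 * φ.nrm e' 0 = 0 := by
    have hUV : φ.cU.eval e.1 * φ.cV.eval e'.1 - φ.cV.eval e.1 * φ.cU.eval e'.1 = 0 := by
      rcases hg with hg | hg
      · apply mul_left_cancel₀ hg
        linear_combination φ.cV.eval e'.1 * h - φ.cV.eval e.1 * h'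
      · apply mul_left_cancel₀ hg
        linear_combination φ.cU.eval e.1 * h' - φ.cU.eval e'.1 * h
    simp only [nrm, Matrix.cons_val_zero, Matrix.cons_val_one]
    field_simp
    linear_combination hUV
  set c := φ.nrm e 0 * φ.nrm e' 0 + φ.nrm e 1 * φ.nrm e' 1 with hc
  have hc2 : (c - 1) * (c + 1) = 0 := by
    rw [hc]
    linear_combination (φ.nrm e' 0 ^ 2 + φ.nrm e' 1 ^ 2) * hn + hn' -
      (φ.nrm e 0 * φ.nrm e' 1 - φ.nrm e 1 * φ.nrm e' 0) * hcross
  have h0 : φ.nrm e' 0 = c * φ.nrm e 0 := by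
    rw [hc]
    linear_combination (-φ.nrm e' 0) * hn - φ.nrm e 1 * hcross
  have h1 : φ.nrm e' 1 = c * φ.nrm e 1 := by
    rw [hc]
    linear_combination (-φ.nrm e' 1) * hn + φ.nrm e 0 * hcross
  refine (mul_eq_zero.1 hc2).imp (fun hc1 => ?_) (fun hc1 => ?_)
  · have : c = 1 := by linear_combination hc1
    ext i
    fin_cases i
    · simpa [this] using h0
    · simpa [this] using h1
  · have : c = -1 := by linear_combination hc1
    ext i
    fin_cases i
    · simpa [this] using h0
    · simpa [this] using h1

/-- The flags that generate the same offset point as a generic flag `e` are `e` and the flags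
opposite to `e`. -/
theorem IsEquation.eventually_fiber (hf : φ.IsEquation d B f) (hB : φ.IsBranch B)
    (h : φ.IsAdmissible d) : ∀ᶠ e in genericOn B, ∀ e' ∈ φ.flags, φ.gen d e' = φ.gen d e →
      φ.speed d e' ≠ 0 ∧ φ.IsInjectiveAt e'.1 ∧ (e' = e ∨ φ.IsOpposite d e e') := by
  -- The second flag may lie on another branch. If f does not vanish on that branch, only finitely
  -- many of its flags give points of f = 0; otherwise the tangent of f can be computed along it.
  have hgood : ∀ᶠ e in genericOn φ.flags, φ.speed d e ≠ 0 ∧ φ.IsInjectiveAt e.1 ∧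
      (eval (φ.gen d e) f = 0 → ∃ B', φ.IsBranch B' ∧ e ∈ B' ∧
        ∀ e' ∈ B', eval (φ.gen d e') f = 0) := by
    refine eventually_flags_of_isBranch fun B' hB' => ?_
    have h3 : ∀ᶠ e in genericOn B', eval (φ.gen d e) f = 0 → ∃ B', φ.IsBranch B' ∧ e ∈ B' ∧
        ∀ e' ∈ B', eval (φ.gen d e') f = 0 := by
      by_cases hz : ∀ e' ∈ B', eval (φ.gen d e') f = 0
      · filter_upwards [eventually_mem_genericOn] with e he _
        exact ⟨B', hB', he, hz⟩
      · push Not at hz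
        filter_upwards [hB'.eventually_eval_gen_ne_zero hz] with e he h0
        exact absurd h0 he
    filter_upwards [hB'.eventually_speed_ne_zero h, hB'.eventually_isInjectiveAt h, h3]
      with e h1 h2 h3 using ⟨h1, h2, h3⟩
  obtain ⟨i, hi⟩ := exists_not_dvd_pderiv hf.1
  filter_upwards [hB.eventually_fiber h hgood, hf.eventually_ne_zero hB hi,
    eventually_mem_genericOn] with e hfib hgrad he e' he' hgen
  have heF := hB.subset_flags he
  obtain ⟨hsp, hinj, hbr⟩ := hfib e' he' hgen
  obtain ⟨hsp₀, hinj₀, -⟩ := hfib e heF rfl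
  refine ⟨hsp, hinj, ?_⟩
  obtain ⟨B', hB', heB', hz⟩ := hbr (by rw [hgen]; exact hf.eval_gen he)
  have ht := hB.gradient_mul_tangent (fun _ => hf.eval_gen) he hsp₀
  have ht' := hB'.gradient_mul_tangent hz heB' hsp
  rw [hgen] at ht'
  have hg : eval (φ.gen d e) (pderiv 0 f) ≠ 0 ∨ eval (φ.gen d e) (pderiv 1 f) ≠ 0 := by
    fin_cases i
    · exact Or.inl hgrad
    · exact Or.inr hgrad
  refine (nrm_eq_or_eq_neg heF he' hg ht ht').imp (fun hn => ?_) (fun hn => ⟨hn, ?_⟩)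
  · refine flag_ext he' heF (hinj₀ _ (isDefinedAt_fst he') ?_) hn
    simpa [gen, hn] using hgen
  · rw [gen, gen, hn] at hgen
    rw [two_mul, add_smul, ← add_assoc, ← hgen, smul_neg]
    abel

/-- The gradient annihilates the tangent. If it annihilated the normal too it would be zero, as E ≠
0 makes the two independent. -/
theorem IsEquation.gradient_mul_nrm_ne_zero (hf : φ.IsEquation d B f) (hB : φ.IsBranch B)
    (h : φ.IsAdmissible d) : ∀ᶠ e in genericOn B,
      eval (φ.gen d e) (pderiv 0 f) * φ.nrm e 0 + eval (φ.gen d e) (pderiv 1 f) * φ.nrm e 1 ≠ 0 := by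
  obtain ⟨i, hi⟩ := exists_not_dvd_pderiv hf.1
  filter_upwards [hB.eventually_speed_ne_zero h, hf.eventually_ne_zero hB hi,
    eventually_mem_genericOn] with e hsp hgrad he h0
  have heF := hB.subset_flags he
  have ht := hB.gradient_mul_tangent (fun _ => hf.eval_gen) he hsp
  have hE := cE_eval_ne_zero heF
  have hs := heF.2.1
  rw [eval_cE] at hE
  simp only [nrm, Matrix.cons_val_zero, Matrix.cons_val_one] at h0
  field_simp at h0
  have e0 : eval (φ.gen d e) (pderiv 0 f) = 0 := by
    apply mul_left_cancel₀ hE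
    linear_combination φ.cU.eval e.1 * ht + φ.cV.eval e.1 * h0
  have e1 : eval (φ.gen d e) (pderiv 1 f) = 0 := by
    apply mul_left_cancel₀ hE
    linear_combination φ.cV.eval e.1 * ht - φ.cU.eval e.1 * h0
  fin_cases i
  · exact hgrad e0
  · exact hgrad e1

/-! ### The order of the resultant along a normal -/

theorem lineHom_affinePoly (q v : Plane) (a b c : ℂ) : lineHom q v (affinePoly a b c) =
    Polynomial.C (a * q 0 + b * q 1 + c) + Polynomial.C (a * v 0 + b * v 1) * Polynomial.X := by
  simp [affinePoly]
  ring

theorem tangent_nrm_of_eq_or_eq_neg {e e' : ℂ × ℂ}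
    (hn : φ.nrm e' = φ.nrm e ∨ φ.nrm e' = -φ.nrm e) :
    φ.cU.eval e'.1 * φ.nrm e 0 + φ.cV.eval e'.1 * φ.nrm e 1 = 0 := by
  have := tangent_nrm (φ := φ) e'
  rcases hn with hn | hn
  · rwa [hn] at this
  · rw [hn] at this
    simp only [Pi.neg_apply] at this
    linear_combination -this

/-- Flags with the same offset point and parallel normals have the same normal line, so `P` at e'.1
vanishes on all of it. -/
theorem lineHom_eval_eq_zero (hP : IsPrimitivePartT φ.normalPoly P) {e e' : ℂ × ℂ}
    (he' : e' ∈ φ.flags) (hgen : φ.gen d e' = φ.gen d e)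
    (hn : φ.nrm e' = φ.nrm e ∨ φ.nrm e' = -φ.nrm e) :
    lineHom (φ.gen d e) (φ.nrm e) (P.eval (C e'.1)) = 0 := by
  obtain ⟨k, hk, hkP⟩ := exists_eval_normalPoly_eq hP (fst_notMem_badParams he')
  have h1 : lineHom (φ.gen d e) (φ.nrm e) (φ.normalPoly.eval (C e'.1)) = 0 := by
    have h0 := eval_normalPoly_gen (d := d) he'
    rw [eval_normalPoly, hgen, eval_affinePoly] at h0
    rw [eval_normalPoly, lineHom_affinePoly, h0]
    have : φ.cU.eval e'.1 * φ.cW.eval e'.1 * φ.nrm e 0 +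
        φ.cV.eval e'.1 * φ.cW.eval e'.1 * φ.nrm e 1 = 0 := by
      linear_combination φ.cW.eval e'.1 * tangent_nrm_of_eq_or_eq_neg hn
    rw [this]
    simp
  rw [hkP, map_mul, lineHom_C] at h1
  exact (mul_eq_zero.1 h1).resolve_left (by simpa using hk)

/-- The t-derivative of the normal polynomial at the offset point is -W s² times the speed, so a
moving offset point gives a simple root. -/
theorem derivative_eval_ne_zero (hP : IsPrimitivePartT φ.normalPoly P) {e : ℂ × ℂ}
    (he : e ∈ φ.flags) (hsp : φ.speed d e ≠ 0) :
    (Polynomial.derivative (P.map (eval (φ.gen d e)))).eval e.1 ≠ 0 := by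
  intro h0
  have hroot : (P.map (eval (φ.gen d e))).eval e.1 = 0 := by
    rw [eval_map_eval, eval_eq_zero_iff_normalPoly hP (fst_notMem_badParams he)]
    exact eval_normalPoly_gen he
  obtain ⟨⟨c, -, hc⟩, -⟩ := hP
  have h (p : Polynomial ℝ) : realInT p = inT (toC p) := rfl
  set q := φ.gen d e with hq
  have hmap : φ.cU * (φ.cW * Polynomial.C (q 0) - φ.cX) +
      φ.cV * (φ.cW * Polynomial.C (q 1) - φ.cY) = c * P.map (eval q) := by
    have := congrArg (Polynomial.map (eval q)) hc
    simpa [normalPoly, h, toC_U, toC_V, varX, varY, cX, cY, cW] using this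
  have hder := congrArg (fun p => (Polynomial.derivative p).eval e.1) hmap
  have hW := he.1
  have hs := he.2.1
  have hs2 : e.2 ^ 2 = φ.cU.eval e.1 ^ 2 + φ.cV.eval e.1 ^ 2 := by rw [← eval_cE]; exact he.2.2
  have hq0 : q 0 = φ.cX.eval e.1 / φ.cW.eval e.1 + d * (φ.cV.eval e.1 / e.2) := by
    simp only [hq, gen, nrm, Pi.add_apply, Pi.smul_apply, smul_eq_mul, point_zero,
      Matrix.cons_val_zero]
  have hq1 : q 1 = φ.cY.eval e.1 / φ.cW.eval e.1 - d * (φ.cU.eval e.1 / e.2) := by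
    simp only [hq, gen, nrm, Pi.add_apply, Pi.smul_apply, smul_eq_mul, point_one,
      Matrix.cons_val_one, Matrix.cons_val_zero]
    ring
  have hU : φ.cU.eval e.1 = φ.cX.derivative.eval e.1 * φ.cW.eval e.1 -
      φ.cX.eval e.1 * φ.cW.derivative.eval e.1 := by simp [cU]
  have hV : φ.cV.eval e.1 = φ.cY.derivative.eval e.1 * φ.cW.eval e.1 -
      φ.cY.eval e.1 * φ.cW.derivative.eval e.1 := by simp [cV]
  simp only [Polynomial.derivative_add, Polynomial.derivative_mul, Polynomial.derivative_sub,
    Polynomial.derivative_C, Polynomial.eval_add, Polynomial.eval_mul, Polynomial.eval_sub,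
    Polynomial.eval_C, hroot, h0, mul_zero, add_zero] at hder
  apply hsp
  apply mul_left_cancel₀ (mul_ne_zero hW (pow_ne_zero 2 hs))
  rw [mul_zero, ← neg_eq_zero, ← hder, hq0, hq1, speed]
  generalize φ.cU.derivative.eval e.1 = U' at *
  generalize φ.cV.derivative.eval e.1 = V' at *
  have hX' : φ.cX.derivative.eval e.1 = (φ.cU.eval e.1 + φ.cX.eval e.1 * φ.cW.derivative.eval e.1) /
      φ.cW.eval e.1 := by
    rw [eq_div_iff hW]; linear_combination -hU
  have hY' : φ.cY.derivative.eval e.1 = (φ.cV.eval e.1 + φ.cY.eval e.1 * φ.cW.derivative.eval e.1) /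
      φ.cW.eval e.1 := by
    rw [eq_div_iff hW]; linear_combination -hV
  rw [hX', hY']
  field_simp
  linear_combination -e.2 * hs2

/-- The gradient of the circle polynomial at the point is 2 W² d times the normal of `e'`, whose
product with the normal of `e` is ±1. -/
theorem rootMultiplicity_lineHom_circle
    (hQ : ∃ c : Polynomial ℂ, c ≠ 0 ∧ φ.circlePoly d = inT c * Q) (hd : 0 < d) {e e' : ℂ × ℂ}
    (he : e ∈ φ.flags) (he' : e' ∈ φ.flags) (hgen : φ.gen d e' = φ.gen d e)
    (hn : φ.nrm e' = φ.nrm e ∨ φ.nrm e' = -φ.nrm e) :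
    (lineHom (φ.gen d e) (φ.nrm e) (Q.eval (C e'.1))).rootMultiplicity 0 = 1 := by
  have hbad := fst_notMem_badParams he'
  obtain ⟨k, hk, hkQ⟩ := exists_eval_circlePoly_eq hQ hbad
  have hd' : (d : ℂ) ≠ 0 := by exact_mod_cast hd.ne'
  apply rootMultiplicity_lineHom_eq_one
  · rw [eval_eq_zero_iff_circlePoly hQ hbad, ← hgen]
    exact eval_circlePoly_gen he'
  · have hW := he'.1
    have hpd (i : Fin 2) : eval (φ.gen d e) (pderiv i ((φ.circlePoly d).eval (C e'.1))) =
        k * eval (φ.gen d e) (pderiv i (Q.eval (C e'.1))) := by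
      rw [hkQ, pderiv_C_mul]; simp
    have h0 := hpd 0
    have h1 := hpd 1
    rw [eval_circlePoly] at h0 h1
    simp [pderiv_X] at h0 h1
    rw [← hgen] at h0 h1 ⊢
    simp only [gen, Pi.add_apply, Pi.smul_apply, smul_eq_mul, point_zero, point_one] at h0 h1
    have hns := nrm_sq he
    intro hz
    have hgrad : (2 : ℂ) * φ.cW.eval e'.1 ^ 2 * d *
        (φ.nrm e' 0 * φ.nrm e 0 + φ.nrm e' 1 * φ.nrm e 1) = 0 := by
      field_simp at h0 h1
      simp only [gen] at hz
      linear_combination φ.nrm e 0 * h0 + φ.nrm e 1 * h1 + k * hz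
    have hW2 : (2 : ℂ) * φ.cW.eval e'.1 ^ 2 * d ≠ 0 :=
      mul_ne_zero (mul_ne_zero two_ne_zero (pow_ne_zero 2 hW)) hd'
    have hdot := (mul_eq_zero.1 hgrad).resolve_left hW2
    rcases hn with hn | hn
    · rw [hn] at hdot
      have : (1 : ℂ) = 0 := by linear_combination hdot - hns
      exact one_ne_zero this
    · rw [hn] at hdot
      simp only [Pi.neg_apply] at hdot
      have : (1 : ℂ) = 0 := by linear_combination -hdot - hns
      exact one_ne_zero this

/-- The order of the resultant at a generic offset point along the normal is the number of
parameters that generate the point. -/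
theorem rootMultiplicity_lineHom_resultant (h : φ.IsAdmissible d)
    (hP : IsPrimitivePartT φ.normalPoly P)
    (hQ : ∃ c : Polynomial ℂ, c ≠ 0 ∧ φ.circlePoly d = inT c * Q) {e : ℂ × ℂ}
    (he : e ∈ φ.flags) (hlc : eval (φ.gen d e) P.leadingCoeff ≠ 0)
    (hbad : ∀ t ∈ φ.badParams, eval (φ.gen d e) (P.eval (C t)) ≠ 0) (S : Finset ℂ)
    (hS : ∀ t ∈ S, ∃ e' ∈ φ.flags, e'.1 = t ∧ φ.gen d e' = φ.gen d e ∧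
      (φ.nrm e' = φ.nrm e ∨ φ.nrm e' = -φ.nrm e) ∧ φ.speed d e' ≠ 0)
    (hfib : ∀ e' ∈ φ.flags, φ.gen d e' = φ.gen d e → e'.1 ∈ S) :
    (lineHom (φ.gen d e) (φ.nrm e) (Polynomial.resultant P Q)).rootMultiplicity 0 = S.card := by
  obtain ⟨r, hr, hH⟩ := lineHom_resultant (L := Q) (v := φ.nrm e) S hlc
    (by
      intro t ht
      obtain ⟨e', he', rfl, hgen, hn, -⟩ := hS t ht
      exact lineHom_eval_eq_zero hP he' hgen hn)
    (by
      intro t ht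
      obtain ⟨e', he', rfl, hgen, -, hsp⟩ := hS t ht
      rw [← hgen]
      exact derivative_eval_ne_zero hP he' hsp)
    (by
      intro t hPt hQt
      by_cases ht : t ∈ φ.badParams
      · exact absurd hPt (hbad t ht)
      · obtain ⟨s, hs, hgen⟩ := exists_flag_of_eval h.pos ht
          ((eval_eq_zero_iff_normalPoly hP ht _).1 hPt)
          ((eval_eq_zero_iff_circlePoly hQ ht _).1 hQt)
        exact hfib _ hs hgen)
  have hone (t) (ht : t ∈ S) :
      (lineHom (φ.gen d e) (φ.nrm e) (Q.eval (C t))).rootMultiplicity 0 = 1 := by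
    obtain ⟨e', he', rfl, hgen, hn, -⟩ := hS t ht
    exact rootMultiplicity_lineHom_circle hQ h.pos he he' hgen hn
  have hne (t) (ht : t ∈ S) : lineHom (φ.gen d e) (φ.nrm e) (Q.eval (C t)) ≠ 0 := by
    intro h0
    have := hone t ht
    rw [h0] at this
    simp at this
  have hr0 : r ≠ 0 := by
    rintro rfl
    simp at hr
  rw [hH, Polynomial.rootMultiplicity_mul (mul_ne_zero (Finset.prod_ne_zero_iff.2 hne) hr0),
    rootMultiplicity_prod _ _ _ hne, Finset.sum_congr rfl hone,
    Polynomial.rootMultiplicity_eq_zero hr]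
  simp

/-- The multiplicity of an irreducible equation of a branch in the resultant is the number of flags
that generate a generic point of the branch, which is one or two. -/
theorem IsEquation.eventually_multiplicity (hf : φ.IsEquation d B f) (hB : φ.IsBranch B)
    (h : φ.IsAdmissible d) (hP : IsPrimitivePartT φ.normalPoly P)
    (hQ : ∃ c : Polynomial ℂ, c ≠ 0 ∧ φ.circlePoly d = inT c * Q) {m : ℕ} {g : PolyXY}
    (hH : Polynomial.resultant P Q = f ^ m * g) (hg : ¬ f ∣ g) :
    ∀ᶠ e in genericOn B,
      (m = 1 ∧ ∀ e' ∈ φ.flags, φ.gen d e' = φ.gen d e → e' = e) ∨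
      (m = 2 ∧ ∃ e' ∈ φ.flags, φ.gen d e' = φ.gen d e ∧ φ.IsOpposite d e e') := by
  classical
  have hlc : ¬ f ∣ P.leadingCoeff := by
    obtain ⟨a, b, c, hl⟩ := exists_affinePoly_leadingCoeff hP
    rw [hl]
    exact hf.not_dvd_affinePoly hB h (hl ▸ leadingCoeff_ne_zero hP)
  have hbad : ∀ᶠ e in genericOn B, ∀ t ∈ φ.badParams, eval (φ.gen d e) (P.eval (C t)) ≠ 0 := by
    refine (eventually_all_finite h.finite_badParams).2 fun t _ => ?_
    obtain ⟨a, b, c, hl⟩ := exists_affinePoly_eval hP t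
    refine hf.eventually_ne_zero hB ?_
    rw [hl]
    exact hf.not_dvd_affinePoly hB h (hl ▸ hP.eval_ne_zero t)
  filter_upwards [hf.eventually_fiber hB h, hf.eventually_ne_zero hB hlc, hbad,
    hf.eventually_ne_zero hB hg, hf.gradient_mul_nrm_ne_zero hB h, eventually_mem_genericOn]
    with e hfib hlce hbade hge hgrad he
  have heF := hB.subset_flags he
  -- The order of the resultant along the normal, read off from its factorization: `f` vanishes to
  -- order one and `g` does not vanish.
  have hm : (lineHom (φ.gen d e) (φ.nrm e) (Polynomial.resultant P Q)).rootMultiplicity 0 = m := by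
    have h1 := rootMultiplicity_lineHom_eq_one (hf.eval_gen he) hgrad
    have h2 : (lineHom (φ.gen d e) (φ.nrm e) g).rootMultiplicity 0 = 0 :=
      Polynomial.rootMultiplicity_eq_zero (by simpa using hge)
    have hf0 : lineHom (φ.gen d e) (φ.nrm e) f ≠ 0 := by
      intro h0
      rw [h0] at h1
      simp at h1
    have hg0 : lineHom (φ.gen d e) (φ.nrm e) g ≠ 0 := by
      intro h0
      apply hge
      rw [← eval_zero_lineHom _ (φ.nrm e), h0, Polynomial.eval_zero]
    rw [hH, map_mul, map_pow,
      Polynomial.rootMultiplicity_mul (mul_ne_zero (pow_ne_zero _ hf0) hg0),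
      rootMultiplicity_pow_eq _ hf0, h1, h2]
    simp
  by_cases huniq : ∀ e' ∈ φ.flags, φ.gen d e' = φ.gen d e → e' = e
  · left
    refine ⟨?_, huniq⟩
    rw [← hm, rootMultiplicity_lineHom_resultant h hP hQ heF hlce hbade {e.1}]
    · simp
    · intro t ht
      rw [Finset.mem_singleton] at ht
      exact ⟨e, heF, ht.symm, rfl, Or.inl rfl, (hfib e heF rfl).1⟩
    · intro e' he' hgen
      rw [huniq e' he' hgen]
      simp
  · right
    push Not at huniq
    obtain ⟨e', he', hgen, hne⟩ := huniq
    have hopp := (hfib e' he' hgen).2.2.resolve_left hne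
    refine ⟨?_, e', he', hgen, hopp⟩
    -- The two curve points differ by 2d times a unit normal, so the parameters are distinct and are
    -- counted twice.
    have hne1 : e.1 ≠ e'.1 := by
      intro heq
      have h2 := hopp.2
      rw [← heq, left_eq_add, smul_eq_zero] at h2
      have hd' : (d : ℂ) ≠ 0 := by exact_mod_cast h.pos.ne'
      have h3 := h2.resolve_left (mul_ne_zero two_ne_zero hd')
      have := nrm_sq heF
      rw [h3] at this
      simp at this
    rw [← hm, rootMultiplicity_lineHom_resultant h hP hQ heF hlce hbade {e.1, e'.1}]
    · rw [Finset.card_pair hne1]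
    · intro t ht
      rw [Finset.mem_insert, Finset.mem_singleton] at ht
      rcases ht with rfl | rfl
      · exact ⟨e, heF, rfl, rfl, Or.inl rfl, (hfib e heF rfl).1⟩
      · exact ⟨e', he', rfl, hgen, Or.inr hopp.1, (hfib e' he' hgen).1⟩
    · intro e'' he'' hgen''
      rw [Finset.mem_insert, Finset.mem_singleton]
      -- Every flag opposite to `e` lies over the same curve point as `e'`, so injectivity gives the
      -- same parameter.
      refine (hfib e'' he'' hgen'').2.2.imp (fun h => by rw [h]) fun hopp'' => ?_
      refine (hfib e' he' hgen).2.1 _ (isDefinedAt_fst he'') ?_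
      rw [hopp.2, hopp''.2]

end RatParam
end Offset
end

noncomputable section
namespace Offset

open MvPolynomial Filter

namespace RatParam

variable {φ : RatParam} {d : ℝ} {B : Set (ℂ × ℂ)} {f : PolyXY} {P Q : PolyXYT}

/-! ### The image of a branch -/

/-- If `L` vanishes along a branch, then for all but finitely many points of the offset of the
branch, `L` and the normal polynomial have a common root. -/
theorem IsEquation.finite_not_exists_root (hf : φ.IsEquation d B f) (hB : φ.IsBranch B)
    (h : φ.IsAdmissible d) {L : PolyXYT} (hL : ∀ e ∈ B, eval (φ.gen d e) (L.eval (C e.1)) = 0) :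
    {q ∈ zeroSet f | ¬ ∃ t ∉ φ.badParams, eval q (φ.normalPoly.eval (C t)) = 0 ∧
      eval q (L.eval (C t)) = 0}.Finite := by
  obtain ⟨P, hP⟩ := h.exists_isPrimitivePartT_normalPoly
  have hlc : ¬ f ∣ P.leadingCoeff := by
    obtain ⟨a, b, c, hl⟩ := exists_affinePoly_leadingCoeff hP
    rw [hl]
    exact hf.not_dvd_affinePoly hB h (hl ▸ leadingCoeff_ne_zero hP)
  have hev (t : ℂ) : ¬ f ∣ P.eval (C t) := by
    obtain ⟨a, b, c, hl⟩ := exists_affinePoly_eval hP t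
    rw [hl]
    exact hf.not_dvd_affinePoly hB h (hl ▸ hP.eval_ne_zero t)
  -- The resultant then vanishes on the whole curve f = 0. The points discarded lie on lines, namely
  -- the leading coefficient and `P` at bad parameters, each meeting f = 0 finitely often.
  have hres : f ∣ Polynomial.resultant P L := by
    refine (hf.1.prime.dvd_or_dvd ((hf.dvd_iff (g := P.leadingCoeff * _)).2 ?_)).resolve_left hlc
    intro e he
    have he' := hB.subset_flags he
    rw [map_mul]
    by_cases hlc : eval (φ.gen d e) P.leadingCoeff = 0
    · rw [hlc, zero_mul]
    · rw [(eval_resultant_eq_zero_iff hlc).2 ⟨e.1, ?_, hL e he⟩, mul_zero]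
      rw [eval_eq_zero_iff_normalPoly hP (fst_notMem_badParams he')]
      exact eval_normalPoly_gen he'
  refine ((finite_inter_zeroSet hf.1 hlc).union
    (h.finite_badParams.biUnion fun t _ => finite_inter_zeroSet hf.1 (hev t))).subset ?_
  rintro q ⟨hq, hno⟩
  by_contra hc
  simp only [Set.mem_union, Set.mem_inter_iff, Set.mem_iUnion, not_or, not_and, not_exists] at hc
  obtain ⟨t, hPt, hLt⟩ := (eval_resultant_eq_zero_iff (hc.1 hq)).1 (zeroSet_subset_of_dvd hres hq)
  by_cases ht : t ∈ φ.badParams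
  · exact hc.2 t ht hq hPt
  · exact hno ⟨t, ht, (eval_eq_zero_iff_normalPoly hP ht q).1 hPt, hLt⟩

theorem IsEquation.finite_notMem_gen_flags (hf : φ.IsEquation d B f) (hB : φ.IsBranch B)
    (h : φ.IsAdmissible d) : {q ∈ zeroSet f | q ∉ φ.gen d '' φ.flags}.Finite := by
  refine (hf.finite_not_exists_root hB h (L := φ.circlePoly d)
    fun e he => eval_circlePoly_gen (hB.subset_flags he)).subset ?_
  rintro q ⟨hq, hno⟩
  refine ⟨hq, ?_⟩
  rintro ⟨t, ht, hn, hc⟩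
  obtain ⟨s, hs, hgen⟩ := exists_flag_of_eval h.pos ht hn hc
  exact hno ⟨_, hs, hgen⟩

theorem IsEquation.finite_notMem_gen_rootBranch {S : Polynomial ℂ} (hS : S ^ 2 = φ.cE)
    (hf : φ.IsEquation d (φ.rootBranch S) f) (h : φ.IsAdmissible d) :
    {q ∈ zeroSet f | q ∉ φ.gen d '' φ.rootBranch S}.Finite := by
  -- The circle polynomial does not see the sign of s. At φ(t) + l (V, -U) this `L` equals W S (l S
  -- - d), which selects s = S.
  let L : PolyXYT := inT φ.cV * (inT φ.cW * varX - inT φ.cX) -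
    inT φ.cU * (inT φ.cW * varY - inT φ.cY) - inT (Polynomial.C (d : ℂ) * φ.cW * S)
  have hL (q : Plane) (t : ℂ) : eval q (L.eval (C t)) =
      φ.cV.eval t * (φ.cW.eval t * q 0 - φ.cX.eval t) -
        φ.cU.eval t * (φ.cW.eval t * q 1 - φ.cY.eval t) - d * φ.cW.eval t * S.eval t := by
    simp [L, varX, varY]
  have hS' (t : ℂ) : S.eval t ^ 2 = φ.cU.eval t ^ 2 + φ.cV.eval t ^ 2 := by
    rw [← eval_cE, ← hS, Polynomial.eval_pow]
  refine (hf.finite_not_exists_root (isBranch_rootBranch hS) h (L := L) fun e he => ?_).subset ?_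
  · have hW := he.1.1
    have hs0 := he.1.2.1
    have hs := hS' e.1
    rw [← he.2] at hs
    simp only [hL, gen, nrm, Pi.add_apply, Pi.smul_apply, smul_eq_mul, point_zero, point_one,
      Matrix.cons_val_zero, Matrix.cons_val_one, ← he.2]
    field_simp
    linear_combination -(d : ℂ) * φ.cW.eval e.1 * hs
  · rintro q ⟨hq, hno⟩
    refine ⟨hq, ?_⟩
    rintro ⟨t, ht, hn, hc⟩
    obtain ⟨l, h0, h1⟩ := exists_of_eval_normalPoly ht hn
    obtain ⟨hW, hE⟩ := notMem_badParams.1 ht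
    have hs := hS' t
    have hs0 : S.eval t ≠ 0 := by
      intro h0
      rw [eval_cE, ← hs, h0] at hE
      norm_num at hE
    rw [hL, h0, h1, point_zero, point_one] at hc
    have hl : l * S.eval t = d := by
      field_simp at hc
      apply mul_left_cancel₀ (mul_ne_zero hW hs0)
      linear_combination hc + φ.cW.eval t * l * hs
    have hl' : l = d / S.eval t := by rw [eq_div_iff hs0, hl]
    refine hno ⟨(t, S.eval t), ⟨⟨hW, hs0, ?_⟩, rfl⟩, ?_⟩
    · rw [eval_cE]; exact hs
    · ext i
      fin_cases i
      · simp [gen, nrm, h0, hl']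
        field_simp
      · simp [gen, nrm, h1, hl']
        field_simp
        ring

/-! ### Translations along the normal -/

/-- Either the parametrization is injective at a parameter over `p`, or all parameters over `p` lie
in the finite set excluded by properness. -/
theorem IsAdmissible.finite_fiber_point (h : φ.IsAdmissible d) (p : Plane) :
    {t | φ.IsDefinedAt t ∧ φ.point t = p}.Finite := by
  by_cases hinj : ∃ t₀, φ.IsInjectiveAt t₀ ∧ φ.point t₀ = p
  · obtain ⟨t₀, ht₀, rfl⟩ := hinj
    exact (Set.finite_singleton t₀).subset fun t ht => ht₀ t ht.1 ht.2
  · refine h.proper.subset fun t ht => ⟨ht.1, ?_⟩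
    push Not at hinj
    have : ¬ φ.IsInjectiveAt t := fun hi => hinj t hi ht.2
    simp only [IsInjectiveAt, not_forall] at this
    obtain ⟨t', h1, h2, h3⟩ := this
    exact ⟨t', h1, h3, h2⟩

/-- A curve that is not a line is not invariant under translation along its normals. -/
theorem IsBranch.not_eventually_translate (hB : φ.IsBranch B) (h : φ.IsAdmissible d) {c : ℂ}
    (hc : c ≠ 0) : ¬ ∀ᶠ e in genericOn B, ∃ e' ∈ B, φ.nrm e' = φ.nrm e ∧
      φ.point e'.1 = φ.point e.1 + c • φ.nrm e := by
  intro hev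
  rw [eventually_genericOn] at hev
  set Z := {e ∈ B | ¬ ∃ e' ∈ B, φ.nrm e' = φ.nrm e ∧ φ.point e'.1 = φ.point e.1 + c • φ.nrm e}
  -- Parameters from which some iterate of the translation could reach the exceptional set `Z`.
  -- There are countably many, since `Z` and the fibers are finite, so a starting parameter remains.
  let T : Set ℂ := φ.badParams ∪ ⋃ z ∈ Z, ⋃ n : ℕ,
    {t | φ.IsDefinedAt t ∧ φ.point t = φ.point z.1 - (n * c) • φ.nrm z}
  have hT : T.Countable := h.finite_badParams.countable.union
    (hev.countable.biUnion fun z _ => Set.countable_iUnion fun n =>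
      (h.finite_fiber_point _).countable)
  obtain ⟨t, ht⟩ : ∃ t, t ∉ T := by
    by_contra! hall
    exact not_countable_complex (hT.mono fun t _ => hall t)
  have htbad : t ∉ φ.badParams := fun hb => ht (Or.inl hb)
  obtain ⟨hW, hE⟩ := notMem_badParams.1 htbad
  obtain ⟨s, hs⟩ := hB.exists_mem hW hE
  set e₀ : ℂ × ℂ := (t, s)
  have hflag := hB.subset_flags hs
  have hchain (n : ℕ) : ∃ e ∈ B, φ.nrm e = φ.nrm e₀ ∧
      φ.point e.1 = φ.point e₀.1 + (n * c) • φ.nrm e₀ := by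
    induction n with
    | zero => exact ⟨e₀, hs, rfl, by simp⟩
    | succ n ih =>
      obtain ⟨e, he, hn, hp⟩ := ih
      have heZ : e ∉ Z := by
        intro heZ
        refine ht (Or.inr ?_)
        simp only [Set.mem_iUnion]
        refine ⟨e, heZ, n, isDefinedAt_fst hflag, ?_⟩
        rw [hp, hn, add_sub_cancel_right]
      have : ∃ e' ∈ B, φ.nrm e' = φ.nrm e ∧ φ.point e'.1 = φ.point e.1 + c • φ.nrm e := by
        by_contra hno
        exact heZ ⟨he, hno⟩
      obtain ⟨e', he', hn', hp'⟩ := this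
      refine ⟨e', he', hn'.trans hn, ?_⟩
      rw [hp', hp, hn, add_assoc, ← add_smul]
      push_cast
      ring_nf
  choose e he hn hp using hchain
  let a := φ.cU.eval t
  let b := φ.cV.eval t
  have hn2 := nrm_sq hflag
  -- The chain provides infinitely many distinct parameters whose points lie on the normal line at
  -- `t`, so the equation of this line vanishes along the whole curve.
  have hL : Polynomial.C a * (φ.cX - Polynomial.C (φ.point t 0) * φ.cW) +
      Polynomial.C b * (φ.cY - Polynomial.C (φ.point t 1) * φ.cW) = 0 := by
    refine Polynomial.eq_zero_of_infinite_isRoot _ (Set.infinite_of_injective_forall_mem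
      (f := fun n => (e n).1) (fun m n hmn => ?_) fun n => ?_)
    · have h1 : φ.point (e m).1 = φ.point (e n).1 := congrArg φ.point hmn
      rw [hp, hp, add_right_inj] at h1
      have h2 : (((m : ℂ) - n) * c) • φ.nrm e₀ = 0 := by
        rw [sub_mul, sub_smul, h1, sub_self]
      rcases smul_eq_zero.1 h2 with h3 | h3
      · have := (mul_eq_zero.1 h3).resolve_right hc
        exact_mod_cast sub_eq_zero.1 this
      · rw [h3] at hn2
        simp at hn2
    · have hWn := (hB.subset_flags (he n)).1
      have h0 := congrFun (hp n) 0
      have h1 := congrFun (hp n) 1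
      simp only [Pi.add_apply, Pi.smul_apply, smul_eq_mul] at h0 h1
      have htan : a * φ.nrm e₀ 0 + b * φ.nrm e₀ 1 = 0 := tangent_nrm (φ := φ) e₀
      have hX : φ.cX.eval (e n).1 = φ.point (e n).1 0 * φ.cW.eval (e n).1 := by
        rw [point_zero]; field_simp
      have hY : φ.cY.eval (e n).1 = φ.point (e n).1 1 * φ.cW.eval (e n).1 := by
        rw [point_one]; field_simp
      simp only [Set.mem_ofPred_eq, Polynomial.IsRoot, Polynomial.eval_add, Polynomial.eval_mul,
        Polynomial.eval_sub, Polynomial.eval_C, hX, hY, h0, h1]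
      linear_combination φ.cW.eval (e n).1 * n * c * htan
  apply h.not_isLine
  refine φ.isLine_curve h.proper (a := a) (b := b) (c := a * φ.point t 0 + b * φ.point t 1) ?_ ?_
  · by_contra! hab
    rw [eval_cE] at hE
    exact hE (by rw [show φ.cU.eval t = 0 from hab.1, show φ.cV.eval t = 0 from hab.2]; norm_num)
  · simp only [map_add, map_mul]
    linear_combination hL

/-! ### Double branches -/

variable (φ d B) in
/-- Generic offset points of the branch are generated by two opposite flags. -/
def IsDouble : Prop :=
  ∀ᶠ e in genericOn B, ∃ e' ∈ φ.flags, φ.gen d e' = φ.gen d e ∧ φ.IsOpposite d e e'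

theorem two_mul_ne_zero (h : φ.IsAdmissible d) : (2 * d : ℂ) ≠ 0 :=
  mul_ne_zero two_ne_zero (by exact_mod_cast h.pos.ne')

theorem IsOpposite.neg {e e' : ℂ × ℂ} (ho : φ.IsOpposite d e e') :
    φ.nrm (e'.1, -e'.2) = φ.nrm e := by
  rw [nrm_neg, ho.1, neg_neg]

/-- Reversing s stays inside the flag curve and turns the opposite flag into a translate by 2d along
the normal. -/
theorem IsBranch.not_isDouble_flags (hB : φ.IsBranch φ.flags) (h : φ.IsAdmissible d) :
    ¬ φ.IsDouble d φ.flags := by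
  intro hd
  refine hB.not_eventually_translate h (two_mul_ne_zero h) ?_
  filter_upwards [hd] with e ⟨e', he', _, ho⟩
  exact ⟨_, neg_mem_flags he', ho.neg, ho.2⟩

theorem neg_mem_rootBranch {S : Polynomial ℂ} {e : ℂ × ℂ} (he : e ∈ φ.rootBranch S) :
    (e.1, -e.2) ∈ φ.rootBranch (-S) :=
  ⟨neg_mem_flags he.1, by simp [he.2]⟩

theorem neg_mem_rootBranch' {S : Polynomial ℂ} {e : ℂ × ℂ} (he : e ∈ φ.rootBranch (-S)) :
    (e.1, -e.2) ∈ φ.rootBranch S := by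
  simpa using neg_mem_rootBranch he

theorem mem_rootBranch_or {S : Polynomial ℂ} (hS : S ^ 2 = φ.cE) {e : ℂ × ℂ} (he : e ∈ φ.flags) :
    e ∈ φ.rootBranch S ∨ e ∈ φ.rootBranch (-S) := by
  have h2 := he.2.2
  rw [← hS, Polynomial.eval_pow] at h2
  refine (sq_eq_sq_iff_eq_or_eq_neg.1 h2).imp (fun h => ⟨he, h⟩) (fun h => ⟨he, ?_⟩)
  simpa using h

/-- The two branches of a reducible offset differ. -/
theorem IsEquation.zeroSet_ne {S : Polynomial ℂ} (hS : S ^ 2 = φ.cE) (h : φ.IsAdmissible d)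
    {f₁ f₂ : PolyXY} (hf₁ : φ.IsEquation d (φ.rootBranch S) f₁)
    (hf₂ : φ.IsEquation d (φ.rootBranch (-S)) f₂) : zeroSet f₁ ≠ zeroSet f₂ := by
  intro heq
  have hB := isBranch_rootBranch hS
  refine hB.not_eventually_translate h (two_mul_ne_zero h) ?_
  filter_upwards [hf₁.eventually_fiber hB h, eventually_mem_genericOn,
    hB.eventually_gen_notMem h (hf₂.finite_notMem_gen_rootBranch (by rwa [neg_sq]) h)]
    with e hfib he hcov
  have : φ.gen d e ∈ φ.gen d '' φ.rootBranch (-S) := by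
    by_contra hno
    exact hcov ⟨heq ▸ hf₁.eval_gen he, hno⟩
  obtain ⟨e', he', hgen⟩ := this
  -- The flag on the branch -S cannot be `e`, where s = S ≠ 0, so it is opposite. Reversed, it lies
  -- on the branch S and is the translate by 2d.
  rcases (hfib e' he'.1 hgen).2.2 with rfl | ho
  · exfalso
    have h1 := he.2
    have h2 := he'.2
    rw [h1, Polynomial.eval_neg] at h2
    apply he.1.2.1
    rw [h1]
    linear_combination (1 / 2 : ℂ) * h2
  · exact ⟨_, neg_mem_rootBranch' he', ho.neg, ho.2⟩

/-- The opposite flag cannot lie on the other branch, because the equation of that branch is nonzero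
at generic offset points of this one. -/
theorem IsDouble.eventually_mem {S : Polynomial ℂ} (hS : S ^ 2 = φ.cE) (h : φ.IsAdmissible d)
    {f₁ f₂ : PolyXY} (hf₁ : φ.IsEquation d (φ.rootBranch S) f₁)
    (hf₂ : φ.IsEquation d (φ.rootBranch (-S)) f₂) (hd : φ.IsDouble d (φ.rootBranch S)) :
    ∀ᶠ e in genericOn (φ.rootBranch S), ∃ e' ∈ φ.rootBranch S, φ.gen d e' = φ.gen d e ∧
      φ.IsOpposite d e e' := by
  have hB := isBranch_rootBranch hS
  have hndvd : ¬ f₁ ∣ f₂ := fun hdvd => hf₁.zeroSet_ne hS h hf₂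
    (zeroSet_eq_of_associated (hf₁.1.associated_of_dvd hf₂.1 hdvd))
  filter_upwards [hd, hf₁.eventually_ne_zero hB hndvd] with e ⟨e', he', hgen, ho⟩ hne
  refine ⟨e', (mem_rootBranch_or hS he').resolve_right fun he'' => hne ?_, hgen, ho⟩
  rw [← hgen]
  exact hf₂.eval_gen he''

theorem eventually_neg_rootBranch {S : Polynomial ℂ} {p : ℂ × ℂ → Prop}
    (hp : ∀ᶠ e in genericOn (φ.rootBranch (-S)), p e) :
    ∀ᶠ e in genericOn (φ.rootBranch S), p (e.1, -e.2) := by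
  rw [eventually_genericOn] at hp ⊢
  refine (hp.image fun e => (e.1, -e.2)).subset ?_
  rintro e ⟨he, hn⟩
  exact ⟨(e.1, -e.2), ⟨neg_mem_rootBranch he, hn⟩, by simp⟩

/-- At most one of the two branches of a reducible offset is double. -/
theorem IsDouble.not_isDouble_neg {S : Polynomial ℂ} (hS : S ^ 2 = φ.cE) (h : φ.IsAdmissible d)
    (hd : φ.IsDouble d (φ.rootBranch S)) : ¬ φ.IsDouble d (φ.rootBranch (-S)) := by
  intro hd'
  have hS' : (-S) ^ 2 = φ.cE := by rwa [neg_sq]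
  have hB := isBranch_rootBranch hS
  have hB' := isBranch_rootBranch hS'
  obtain ⟨f₁, hf₁⟩ := hB.exists_isEquation h
  obtain ⟨f₂, hf₂⟩ := hB'.exists_isEquation h
  have h1 := hd.eventually_mem hS h hf₁ hf₂
  have h2 := hd'.eventually_mem hS' h hf₂ (by rwa [neg_neg])
  refine hB.not_eventually_translate h (mul_ne_zero two_ne_zero (two_mul_ne_zero h)) ?_
  filter_upwards [h1, hB.eventually_fiber h (eventually_neg_rootBranch h2)]
    with e ⟨e', he', hgen, ho⟩ hfib
  -- Opposite on S, reversal to -S, opposite on -S, reversal back to S: both displacements are 2d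
  -- along the same normal, 4d in all.
  obtain ⟨e'', he'', -, ho''⟩ := hfib e' he' hgen
  refine ⟨_, neg_mem_rootBranch' he'', ho''.neg.trans ho.neg, ?_⟩
  have := ho''.2
  simp only at this ⊢
  rw [this, ho.neg, ho.2, add_assoc, ← add_smul]
  ring_nf

end RatParam
end Offset
end

/-! ### Irreducible components and factorization in ℂ[x, y]. -/

noncomputable section
namespace Offset

open MvPolynomial Filter

theorem zeroSet_eq_of_subset {f g : PolyXY} (hf : Irreducible f) (hg : Irreducible g)
    (h : zeroSet f ⊆ zeroSet g) : zeroSet f = zeroSet g :=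
  zeroSet_eq_of_associated (hf.associated_of_dvd hg (dvd_of_zeroSet_subset hf h))

/-- The two curves may coincide; the case `f = g` serves an offset with one component. -/
theorem isComponent_union_iff {f g : PolyXY} (hf : Irreducible f) (hg : Irreducible g)
    {D : Set Plane} :
    IsComponent D (zeroSet f ∪ zeroSet g) ↔ D = zeroSet f ∨ D = zeroSet g := by
  have key {f g : PolyXY} (hf : Irreducible f) (hg : Irreducible g) :
      IsComponent (zeroSet f) (zeroSet f ∪ zeroSet g) := by
    refine ⟨⟨isIrreducibleClosed_zeroSet hf, Set.subset_union_left⟩, fun E hE hfE => ?_⟩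
    rcases hE.1.subset_or_subset hE.2 with h | h
    · exact h
    · rw [zeroSet_eq_of_subset hf hg (hfE.trans h)]
      exact h
  constructor
  · intro hD
    refine (hD.1.1.subset_or_subset hD.1.2).imp (fun h => ?_) (fun h => ?_)
    · exact h.antisymm (hD.2 ⟨isIrreducibleClosed_zeroSet hf, Set.subset_union_left⟩ h)
    · exact h.antisymm (hD.2 ⟨isIrreducibleClosed_zeroSet hg, Set.subset_union_right⟩ h)
  · rintro (rfl | rfl)
    · exact key hf hg
    · rw [Set.union_comm]
      exact key hg hf

theorem isUnit_iff_eq_C {u : PolyXY} : IsUnit u ↔ ∃ c : ℂ, c ≠ 0 ∧ u = C c := by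
  rw [MvPolynomial.isUnit_iff_eq_C_of_isReduced]
  simp only [isUnit_iff_ne_zero]

theorem exists_eq_C_mul_prod {G : PolyXY} (hG : G ≠ 0) :
    ∃ (c : ℂ) (L : Multiset PolyXY), c ≠ 0 ∧ G = C c * L.prod ∧ ∀ l ∈ L, Irreducible l ∧ l ∣ G := by
  obtain ⟨L, hL, u, hu⟩ := WfDvdMonoid.exists_factors G hG
  obtain ⟨c, hc, huc⟩ := isUnit_iff_eq_C.1 u.isUnit
  refine ⟨c, L, hc, by rw [← hu, huc, mul_comm], fun l hl => ⟨hL l hl, ?_⟩⟩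
  rw [← hu]
  exact (Multiset.dvd_prod hl).mul_right _

theorem isUnit_of_forall_irreducible {u : PolyXY} (hu : u ≠ 0)
    (h : ∀ k, Irreducible k → ¬ k ∣ u) : IsUnit u := by
  by_contra hn
  obtain ⟨k, hk, hdvd⟩ := WfDvdMonoid.exists_irreducible_factor hn hu
  exact h k hk hdvd

theorem squarefree_mul_of_irreducible {R : Type*} [CommRing R] [IsDomain R]
    [UniqueFactorizationMonoid R] {a b : R} (ha : Irreducible a) (hb : Irreducible b)
    (h : ¬ a ∣ b) : Squarefree (a * b) :=
  squarefree_mul_iff.2 ⟨ha.isRelPrime_iff_not_dvd.2 h, ha.squarefree, hb.squarefree⟩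

theorem squarefree_C_mul {f : PolyXY} {c : ℂ} (hc : c ≠ 0) (hf : Squarefree f) :
    Squarefree (C c * f) := by
  intro x hx
  exact hf x (((isUnit_iff_eq_C.2 ⟨c, hc, rfl⟩ : IsUnit (C c : PolyXY)).dvd_mul_left).1 hx)

namespace RatParam

variable {φ : RatParam} {d : ℝ} {B : Set (ℂ × ℂ)} {f : PolyXY} {P Q : PolyXYT}

/-! ### The components of the offset -/

theorem IsAdmissible.exists_offset_eq (h : φ.IsAdmissible d) :
    (∃ f, φ.IsBranch φ.flags ∧ φ.IsEquation d φ.flags f ∧ φ.offset d = zeroSet f ∪ zeroSet f) ∨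
    ∃ S f₁ f₂, S ^ 2 = φ.cE ∧ φ.IsEquation d (φ.rootBranch S) f₁ ∧
      φ.IsEquation d (φ.rootBranch (-S)) f₂ ∧ φ.offset d = zeroSet f₁ ∪ zeroSet f₂ := by
  rcases isBranch_flags_or (φ := φ) with hB | ⟨S, hS, hflags⟩
  · obtain ⟨f, hf⟩ := hB.exists_isEquation h
    exact Or.inl ⟨f, hB, hf, by rw [offset_eq, hf.2, Set.union_self]⟩
  · obtain ⟨f₁, hf₁⟩ := (isBranch_rootBranch hS).exists_isEquation h
    obtain ⟨f₂, hf₂⟩ := (isBranch_rootBranch (by rwa [neg_sq] : (-S) ^ 2 = _)).exists_isEquation h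
    refine Or.inr ⟨S, f₁, f₂, hS, hf₁, hf₂, ?_⟩
    rw [offset_eq, hflags, Set.image_union, zariskiClosure_union_zeroSet hf₁.2 hf₂.2]

theorem IsAdmissible.exists_isEquation_offset_eq (h : φ.IsAdmissible d) :
    ∃ B₁ B₂ f₁ f₂, φ.IsBranch B₁ ∧ φ.IsBranch B₂ ∧ φ.IsEquation d B₁ f₁ ∧
      φ.IsEquation d B₂ f₂ ∧ φ.offset d = zeroSet f₁ ∪ zeroSet f₂ := by
  rcases h.exists_offset_eq with ⟨f, hB, hf, ho⟩ | ⟨S, f₁, f₂, hS, hf₁, hf₂, ho⟩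
  · exact ⟨_, _, f, f, hB, hB, hf, hf, ho⟩
  · exact ⟨_, _, f₁, f₂, isBranch_rootBranch hS, isBranch_rootBranch (by rwa [neg_sq]), hf₁, hf₂,
      ho⟩

theorem IsAdmissible.exists_isBranch_of_isComponent (h : φ.IsAdmissible d) {D : Set Plane}
    (hD : IsComponent D (φ.offset d)) :
    ∃ B, φ.IsBranch B ∧ zariskiClosure (φ.gen d '' B) = D := by
  obtain ⟨B₁, B₂, f₁, f₂, hB₁, hB₂, hf₁, hf₂, ho⟩ := h.exists_isEquation_offset_eq
  rw [ho, isComponent_union_iff hf₁.1 hf₂.1] at hD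
  rcases hD with rfl | rfl
  · exact ⟨B₁, hB₁, hf₁.2⟩
  · exact ⟨B₂, hB₂, hf₂.2⟩

theorem IsEquation.isComponent (hf : φ.IsEquation d B f) (hB : φ.IsBranch B)
    (h : φ.IsAdmissible d) : IsComponent (zeroSet f) (φ.offset d) := by
  obtain ⟨B₁, B₂, f₁, f₂, hB₁, hB₂, hf₁, hf₂, ho⟩ := h.exists_isEquation_offset_eq
  have hsub : zeroSet f ⊆ zeroSet f₁ ∪ zeroSet f₂ := by
    rw [← hf.2, ← ho, offset_eq]
    exact zariskiClosure_mono (Set.image_mono hB.subset_flags)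
  rw [ho, isComponent_union_iff hf₁.1 hf₂.1]
  exact ((isIrreducibleClosed_zeroSet hf.1).subset_or_subset hsub).imp
    (zeroSet_eq_of_subset hf.1 hf₁.1) (zeroSet_eq_of_subset hf.1 hf₂.1)

/-- All but finitely many points of the component are generated by flags, possibly of another branch
with the same offset. Multiplicity one gives a generic point a single flag. -/
theorem IsEquation.isSimpleComponent (hf : φ.IsEquation d B f) (hB : φ.IsBranch B)
    (h : φ.IsAdmissible d) (hP : IsPrimitivePartT φ.normalPoly P)
    (hQ : ∃ c : Polynomial ℂ, c ≠ 0 ∧ φ.circlePoly d = inT c * Q) {g : PolyXY}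
    (hH : Polynomial.resultant P Q = f ^ 1 * g) (hg : ¬ f ∣ g) :
    φ.IsSimpleComponent d (zeroSet f) := by
  refine ⟨hf.isComponent hB h, ?_⟩
  have huniq : ∀ᶠ e in genericOn φ.flags, eval (φ.gen d e) f = 0 →
      ∀ e' ∈ φ.flags, φ.gen d e' = φ.gen d e → e' = e := by
    refine eventually_flags_of_isBranch fun B' hB' => ?_
    by_cases hz : ∀ e ∈ B', eval (φ.gen d e) f = 0
    -- A branch on which `f` vanishes has `f` as its equation, so the multiplicity count applies to
    -- it as well.
    · have hf' : φ.IsEquation d B' f := ⟨hf.1, zariskiClosure_eq_zeroSet hf.1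
        (hB'.infinite_gen h) (by rintro _ ⟨e, he, rfl⟩; exact hz e he)⟩
      filter_upwards [hf'.eventually_multiplicity hB' h hP hQ hH hg] with e he _
      exact (he.resolve_right fun h2 => absurd h2.1 (by norm_num)).2
    · push Not at hz
      filter_upwards [hB'.eventually_eval_gen_ne_zero hz] with e he h0
      exact absurd h0 he
  refine ((hf.finite_notMem_gen_flags hB h).union
    ((eventually_genericOn.1 huniq).image (φ.gen d))).subset ?_
  rintro q ⟨hq, hno⟩
  by_contra hc
  simp only [Set.mem_union, not_or] at hc
  have hmem : q ∈ φ.gen d '' φ.flags := by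
    by_contra hm
    exact hc.1 ⟨hq, hm⟩
  obtain ⟨e, he, rfl⟩ := hmem
  apply hno
  refine ⟨φ.point e.1, generates_iff.2 ⟨e, he, rfl, rfl⟩, fun p hp => ?_⟩
  obtain ⟨e', he', hgen, rfl⟩ := generates_iff.1 hp
  have : e' = e := by
    by_contra hne
    exact hc.2 ⟨e, ⟨he, fun hall => hne (hall hq e' he' hgen)⟩, rfl⟩
  rw [this]

/-- Opposite flags lie over curve points that differ by 2d times a unit normal, so a generic offset
point has two generating points. -/
theorem IsEquation.isSpecialComponent (hf : φ.IsEquation d B f) (hB : φ.IsBranch B)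
    (h : φ.IsAdmissible d) (hd : φ.IsDouble d B) : φ.IsSpecialComponent d (zeroSet f) := by
  refine ⟨hf.isComponent hB h, fun hs => ?_⟩
  obtain ⟨e, he, ⟨e', he', hgen, ho⟩, hn⟩ := hB.exists_of_eventually h
    (hd.and (hB.eventually_gen_notMem h hs.2))
  have heF := hB.subset_flags he
  refine hn ⟨hf.eval_gen he, fun hu => ?_⟩
  have heq : φ.point e'.1 = φ.point e.1 :=
    hu.unique (generates_iff.2 ⟨e', he', hgen, rfl⟩) (generates_iff.2 ⟨e, heF, rfl, rfl⟩)
  rw [ho.2, add_eq_left, smul_eq_zero] at heq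
  have h3 := heq.resolve_left (two_mul_ne_zero h)
  have := nrm_sq heF
  rw [h3] at this
  simp at this

/-- Simple components appear in the resultant with multiplicity one, special components with
multiplicity two. -/
theorem IsEquation.simple_or_special (hf : φ.IsEquation d B f) (hB : φ.IsBranch B)
    (h : φ.IsAdmissible d) (hP : IsPrimitivePartT φ.normalPoly P)
    (hQ : ∃ c : Polynomial ℂ, c ≠ 0 ∧ φ.circlePoly d = inT c * Q) {m : ℕ} {g : PolyXY}
    (hH : Polynomial.resultant P Q = f ^ m * g) (hg : ¬ f ∣ g) :
    (m = 1 ∧ φ.IsSimpleComponent d (zeroSet f)) ∨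
      (m = 2 ∧ φ.IsSpecialComponent d (zeroSet f) ∧ φ.IsDouble d B) := by
  have hev := hf.eventually_multiplicity hB h hP hQ hH hg
  obtain ⟨e, -, ⟨rfl, -⟩ | ⟨rfl, -⟩⟩ := hB.exists_of_eventually h hev
  · exact Or.inl ⟨rfl, hf.isSimpleComponent hB h hP hQ hH hg⟩
  · have hd : φ.IsDouble d B := by
      filter_upwards [hev] with e he
      exact (he.resolve_left fun h1 => absurd h1.1 (by norm_num)).2
    exact Or.inr ⟨rfl, hf.isSpecialComponent hB h hd, hd⟩

theorem IsEquation.isDouble_of_isSpecialComponent (hf : φ.IsEquation d B f) (hB : φ.IsBranch B)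
    (h : φ.IsAdmissible d) (hs : φ.IsSpecialComponent d (zeroSet f)) : φ.IsDouble d B := by
  obtain ⟨P, hP⟩ := h.exists_isPrimitivePartT_normalPoly
  obtain ⟨m, g, hg, hH⟩ := WfDvdMonoid.max_power_factor
    (h.resultant_ne_zero hP circlePoly_eq_inT_mul) hf.1
  rcases hf.simple_or_special hB h hP circlePoly_eq_inT_mul hH hg with h1 | h2
  · exact absurd h1.2 hs.2
  · exact h2.2.2

/-- Special components come from double branches. The irreducible flag curve is never double, and of
the branches ±S at most one is; its equation is put second. -/
theorem IsAdmissible.exists_isComponentEquations (h : φ.IsAdmissible d) :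
    ∃ f₁ f₂, φ.IsComponentEquations d f₁ f₂ := by
  rcases h.exists_offset_eq with ⟨f, hB, hf, ho⟩ | ⟨S, f₁, f₂, hS, hf₁, hf₂, ho⟩
  · refine ⟨f, 1, hf.1, fun h1 => absurd rfl h1, fun D => ?_, fun h1 => absurd rfl h1,
      fun D hD => ?_⟩
    · rw [ho, isComponent_union_iff hf.1 hf.1]
      simp
    · exfalso
      have hD' := hD.1
      rw [ho, isComponent_union_iff hf.1 hf.1, or_self] at hD'
      subst hD'
      exact hB.not_isDouble_flags h (hf.isDouble_of_isSpecialComponent hB h hD)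
  · have hS' : (-S) ^ 2 = φ.cE := by rwa [neg_sq]
    have hne := hf₁.zeroSet_ne hS h hf₂
    have hcomp (D : Set Plane) : IsComponent D (φ.offset d) ↔ D = zeroSet f₁ ∨ D = zeroSet f₂ := by
      rw [ho, isComponent_union_iff hf₁.1 hf₂.1]
    by_cases hs : φ.IsSpecialComponent d (zeroSet f₁)
    · have hd := hf₁.isDouble_of_isSpecialComponent (isBranch_rootBranch hS) h hs
      refine ⟨f₂, f₁, hf₂.1, fun _ => hf₁.1, fun D => ?_, fun _ => hne.symm, fun D hD => ?_⟩
      · rw [hcomp, or_comm]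
        simp [hf₁.1.ne_one]
      · refine ⟨hf₁.1.ne_one, ((hcomp D).1 hD.1).resolve_right ?_⟩
        rintro rfl
        exact hd.not_isDouble_neg hS h
          (hf₂.isDouble_of_isSpecialComponent (isBranch_rootBranch hS') h hD)
    · refine ⟨f₁, f₂, hf₁.1, fun _ => hf₂.1, fun D => ?_, fun _ => hne, fun D hD => ?_⟩
      · rw [hcomp]
        simp [hf₂.1.ne_one]
      · refine ⟨hf₂.1.ne_one, ((hcomp D).1 hD.1).resolve_left ?_⟩
        rintro rfl
        exact hs hD

/-! ### The factors of the resultant -/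

theorem IsComponentEquations.offset_eq {f₁ f₂ : PolyXY} (hf : φ.IsComponentEquations d f₁ f₂)
    (h : φ.IsAdmissible d) : φ.offset d = zeroSet (f₁ * f₂) := by
  obtain ⟨B₁, B₂, g₁, g₂, hB₁, hB₂, hg₁, hg₂, ho⟩ := h.exists_isEquation_offset_eq
  apply Set.Subset.antisymm
  · have key {g : PolyXY} (hg : IsComponent (zeroSet g) (φ.offset d)) :
        zeroSet g ⊆ zeroSet (f₁ * f₂) := by
      rw [zeroSet_mul]
      rcases (hf.component_iff _).1 hg with h1 | ⟨-, h1⟩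
      · rw [h1]; exact Set.subset_union_left
      · rw [h1]; exact Set.subset_union_right
    rw [ho]
    exact Set.union_subset (key (hg₁.isComponent hB₁ h)) (key (hg₂.isComponent hB₂ h))
  · rw [zeroSet_mul]
    refine Set.union_subset ((hf.component_iff _).2 (Or.inl rfl)).1.2 ?_
    by_cases h2 : f₂ = 1
    · simp [h2, zeroSet_one]
    · exact ((hf.component_iff _).2 (Or.inr ⟨h2, rfl⟩)).1.2

/-- An irreducible factor of the resultant defines a component of the offset or is linear. -/
theorem subset_offset_or_totalDegree_eq_one (h : φ.IsAdmissible d)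
    (hP : IsPrimitivePartT φ.normalPoly P)
    (hQ : ∃ c : Polynomial ℂ, c ≠ 0 ∧ φ.circlePoly d = inT c * Q) {k : PolyXY}
    (hk : Irreducible k) (hdvd : k ∣ Polynomial.resultant P Q) :
    zeroSet k ⊆ φ.offset d ∨ k.totalDegree = 1 := by
  classical
  obtain ⟨f₁, f₂, hf⟩ := h.exists_isComponentEquations
  have hlin {a b c : ℂ} (h0 : affinePoly a b c ≠ 0) (hka : k ∣ affinePoly a b c) :
      k.totalDegree = 1 := by
    have h1 := (totalDegree_le_of_dvd h0 hka).trans (totalDegree_affinePoly_le a b c)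
    have h2 := totalDegree_ne_zero_of_irreducible hk
    omega
  -- Off the zero sets of the leading coefficient and of `P` at the bad parameters, a zero of the
  -- resultant comes from a flag. Both kinds of exceptional factors are affine in x, y.
  have hprod : k ∣ f₁ * f₂ * (P.leadingCoeff * ∏ t ∈ h.finite_badParams.toFinset, P.eval (C t)) := by
    refine dvd_of_zeroSet_subset hk fun q hq => ?_
    by_contra hc
    rw [mem_zeroSet, map_mul, map_mul (eval q) P.leadingCoeff, map_prod] at hc
    have hlc := left_ne_zero_of_mul (right_ne_zero_of_mul hc)
    have hbad := Finset.prod_ne_zero_iff.1 (right_ne_zero_of_mul (right_ne_zero_of_mul hc))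
    obtain ⟨t, hPt, hQt⟩ := (eval_resultant_eq_zero_iff hlc).1 (zeroSet_subset_of_dvd hdvd hq)
    have ht : t ∉ φ.badParams := fun ht => hbad t (by simpa using ht) hPt
    obtain ⟨s, hs, hgen⟩ := exists_flag_of_eval h.pos ht
      ((eval_eq_zero_iff_normalPoly hP ht _).1 hPt) ((eval_eq_zero_iff_circlePoly hQ ht _).1 hQt)
    apply left_ne_zero_of_mul hc
    change q ∈ zeroSet (f₁ * f₂)
    rw [← hf.offset_eq h, RatParam.offset_eq]
    exact subset_zariskiClosure _ ⟨_, hs, hgen⟩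
  rcases hk.prime.dvd_or_dvd hprod with h1 | h1
  · left
    rw [hf.offset_eq h]
    exact zeroSet_subset_of_dvd h1
  · right
    rcases hk.prime.dvd_or_dvd h1 with h2 | h2
    · obtain ⟨a, b, c, hl⟩ := exists_affinePoly_leadingCoeff hP
      rw [hl] at h2
      exact hlin (hl ▸ leadingCoeff_ne_zero hP) h2
    · obtain ⟨t, -, h3⟩ := (hk.prime.dvd_finsetProd_iff _).1 h2
      obtain ⟨a, b, c, hl⟩ := exists_affinePoly_eval hP t
      rw [hl] at h3
      exact hlin (hl ▸ hP.eval_ne_zero t) h3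

theorem IsComponentEquations.not_dvd {f₁ f₂ : PolyXY} (hf : φ.IsComponentEquations d f₁ f₂)
    (h2 : f₂ ≠ 1) : ¬ f₁ ∣ f₂ := fun hdvd => hf.distinct h2
  (zeroSet_eq_of_associated (hf.irreducible_fst.associated_of_dvd (hf.irreducible_snd h2) hdvd))

/-- An irreducible equation of a component has multiplicity one or two in the resultant, according
to the type of the component. -/
theorem IsAdmissible.exists_eq_pow_mul (h : φ.IsAdmissible d)
    (hP : IsPrimitivePartT φ.normalPoly P)
    (hQ : ∃ c : Polynomial ℂ, c ≠ 0 ∧ φ.circlePoly d = inT c * Q) (hf : Irreducible f)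
    (hc : IsComponent (zeroSet f) (φ.offset d)) :
    ∃ (m : ℕ) (g : PolyXY), Polynomial.resultant P Q = f ^ m * g ∧ ¬ f ∣ g ∧
      (m = 1 ∧ ¬ φ.IsSpecialComponent d (zeroSet f) ∨
        m = 2 ∧ φ.IsSpecialComponent d (zeroSet f)) := by
  obtain ⟨B, hB, hcl⟩ := h.exists_isBranch_of_isComponent hc
  obtain ⟨m, g, hg, hH⟩ := WfDvdMonoid.max_power_factor (h.resultant_ne_zero hP hQ) hf
  refine ⟨m, g, hH, hg, ?_⟩
  have hfe : φ.IsEquation d B f := ⟨hf, hcl⟩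
  exact (hfe.simple_or_special hB h hP hQ hH hg).imp (fun h1 => ⟨h1.1, fun hs => hs.2 h1.2⟩)
    fun h2 => ⟨h2.1, h2.2.1⟩

theorem IsComponentEquations.irreducible_cases {f₁ f₂ : PolyXY}
    (hf : φ.IsComponentEquations d f₁ f₂) (h : φ.IsAdmissible d) {k : PolyXY} (hk : Irreducible k)
    (hsub : zeroSet k ⊆ φ.offset d) : Associated k f₁ ∨ (f₂ ≠ 1 ∧ Associated k f₂) := by
  rw [hf.offset_eq h] at hsub
  rcases hk.prime.dvd_or_dvd (dvd_of_zeroSet_subset hk hsub) with h1 | h1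
  · exact Or.inl (hk.associated_of_dvd hf.irreducible_fst h1)
  · have h2 : f₂ ≠ 1 := by
      rintro rfl
      exact hk.not_isUnit (isUnit_of_dvd_one h1)
    exact Or.inr ⟨h2, hk.associated_of_dvd (hf.irreducible_snd h2) h1⟩

/-- F collects the full powers of `f₁` and `f₂` in the resultant. The irreducible factors of the
cofactor then define no subset of the offset, so they are linear. -/
theorem IsAdmissible.exists_isNonExtraneousPart (h : φ.IsAdmissible d)
    (hP : IsPrimitivePartT φ.normalPoly P)
    (hQ : ∃ c : Polynomial ℂ, c ≠ 0 ∧ φ.circlePoly d = inT c * Q) :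
    ∃ F G, φ.IsNonExtraneousPart d (Polynomial.resultant P Q) F G := by
  obtain ⟨f₁, f₂, hf⟩ := h.exists_isComponentEquations
  have hH0 := h.resultant_ne_zero hP hQ
  have key (F G : PolyXY) (hFG : Polynomial.resultant P Q = F * G)
      (hF : zeroSet F = zeroSet (f₁ * f₂)) (h1 : ¬ f₁ ∣ G) (h2 : f₂ ≠ 1 → ¬ f₂ ∣ G) :
      φ.IsNonExtraneousPart d (Polynomial.resultant P Q) F G := by
    have hG0 : G ≠ 0 := by
      rintro rfl
      exact hH0 (by rw [hFG, mul_zero])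
    obtain ⟨c, L, hc, hGL, hL⟩ := exists_eq_C_mul_prod hG0
    refine ⟨hFG, by rw [hF, hf.offset_eq h], c, L, hc, hGL, fun l hl => ?_⟩
    obtain ⟨hirr, hdvd⟩ := hL l hl
    have hno : ¬ zeroSet l ⊆ φ.offset d := by
      intro hsub
      rcases hf.irreducible_cases h hirr hsub with ha | ⟨hne, ha⟩
      · exact h1 (ha.symm.dvd.trans hdvd)
      · exact h2 hne (ha.symm.dvd.trans hdvd)
    exact ⟨(subset_offset_or_totalDegree_eq_one h hP hQ hirr
      (hFG ▸ hdvd.mul_left F)).resolve_left hno, hno⟩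
  have hzp (f : PolyXY) {m : ℕ} (hm : m ≠ 0) : zeroSet (f ^ m) = zeroSet f := by
    ext p
    simp [mem_zeroSet, hm]
  obtain ⟨m, g, hH, hg, hm⟩ := h.exists_eq_pow_mul hP hQ hf.irreducible_fst
    ((hf.component_iff _).2 (Or.inl rfl))
  have hm0 : m ≠ 0 := by rcases hm with hm | hm <;> rw [hm.1] <;> norm_num
  by_cases h2 : f₂ = 1
  · refine ⟨f₁ ^ m, g, key _ _ hH ?_ hg fun h3 => absurd h2 h3⟩
    rw [hzp f₁ hm0, h2, mul_one]
  · obtain ⟨n, g', hH', hg', hn⟩ := h.exists_eq_pow_mul hP hQ (hf.irreducible_snd h2)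
      ((hf.component_iff _).2 (Or.inr ⟨h2, rfl⟩))
    have hn0 : n ≠ 0 := by rcases hn with hn | hn <;> rw [hn.1] <;> norm_num
    have hcop : ¬ f₁ ∣ f₂ ^ n := fun hd => hf.not_dvd h2 (hf.irreducible_fst.prime.dvd_of_dvd_pow hd)
    have hdvd : f₁ ^ m ∣ g' :=
      hf.irreducible_fst.prime.pow_dvd_of_dvd_mul_left m hcop (hH' ▸ hH ▸ dvd_mul_right _ _)
    obtain ⟨u, rfl⟩ := hdvd
    have hgu : g = f₂ ^ n * u := by
      apply mul_left_cancel₀ (pow_ne_zero m hf.irreducible_fst.ne_zero)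
      rw [← hH, hH']; ring
    refine ⟨f₁ ^ m * f₂ ^ n, u, key _ _ (by rw [hH']; ring) ?_ ?_ fun _ => ?_⟩
    · rw [zeroSet_mul, zeroSet_mul, hzp _ hm0, hzp _ hn0]
    · exact fun hd => hg (hgu ▸ hd.mul_left _)
    · exact fun hd => hg' (hd.mul_left _)

/-- G does not contribute to the multiplicity of `f`: a linear factor divisible by `f` would be
associated to `f`, and its line would lie in the offset. -/
theorem IsNonExtraneousPart.exists_eq_pow_mul {H F G : PolyXY}
    (hFG : φ.IsNonExtraneousPart d H F G) (hf : Irreducible f) (hsub : zeroSet f ⊆ φ.offset d)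
    {m : ℕ} {g : PolyXY} (hH : H = f ^ m * g) (hg : ¬ f ∣ g) :
    ∃ g', F = f ^ m * g' ∧ ¬ f ∣ g' := by
  obtain ⟨hHFG, -, c, L, hc, hGL, hL⟩ := hFG
  have hG : ¬ f ∣ G := by
    intro hd
    rw [hGL] at hd
    rcases hf.prime.dvd_or_dvd hd with h1 | h1
    · exact hf.not_isUnit (isUnit_of_dvd_unit h1 (isUnit_iff_eq_C.2 ⟨c, hc, rfl⟩))
    · obtain ⟨l, hl, h2⟩ := hf.prime.exists_mem_multiset_dvd h1
      obtain ⟨hdeg, hno⟩ := hL l hl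
      obtain ⟨k, rfl⟩ := h2
      have h0 : f * k ≠ 0 := by
        intro h0
        rw [h0] at hdeg
        simp at hdeg
      rw [totalDegree_mul_of_isDomain hf.ne_zero (right_ne_zero_of_mul h0)] at hdeg
      have hfd := totalDegree_ne_zero_of_irreducible hf
      have hk := totalDegree_eq_zero_iff_eq_C.1 (show k.totalDegree = 0 by omega)
      have hku : IsUnit k := by
        rw [isUnit_iff_eq_C]
        refine ⟨_, fun hz => ?_, hk⟩
        rw [hz, C_0] at hk
        exact right_ne_zero_of_mul h0 hk
      exact hno (zeroSet_eq_of_associated (associated_mul_unit_right f k hku) ▸ hsub)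
  have hdvd : f ^ m ∣ F :=
    hf.prime.pow_dvd_of_dvd_mul_right m hG (hHFG ▸ hH ▸ dvd_mul_right _ _)
  obtain ⟨g', rfl⟩ := hdvd
  refine ⟨g', rfl, fun hd => hg ?_⟩
  have : g = g' * G := by
    apply mul_left_cancel₀ (pow_ne_zero m hf.ne_zero)
    rw [← hH, hHFG, mul_assoc]
  rw [this]
  exact hd.mul_right _

/-- The zero set of F is the offset, so every irreducible factor of F is associated to `f₁` or `f₂`.
Once their full powers are removed, a constant remains. -/
theorem IsNonExtraneousPart.exists_eq_C_mul (h : φ.IsAdmissible d)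
    (hP : IsPrimitivePartT φ.normalPoly P)
    (hQ : ∃ c : Polynomial ℂ, c ≠ 0 ∧ φ.circlePoly d = inT c * Q) {F G f₁ f₂ : PolyXY}
    (hFG : φ.IsNonExtraneousPart d (Polynomial.resultant P Q) F G)
    (hf : φ.IsComponentEquations d f₁ f₂) :
    ∃ (c : ℂ) (n : ℕ), c ≠ 0 ∧ F = C c * (f₁ * f₂ ^ n) ∧
      (f₂ ≠ 1 → n = 1 ∧ ¬ φ.IsSpecialComponent d (zeroSet f₂) ∨
        n = 2 ∧ φ.IsSpecialComponent d (zeroSet f₂)) := by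
  have hF0 : F ≠ 0 := by
    rintro rfl
    exact h.resultant_ne_zero hP hQ (by rw [hFG.1, zero_mul])
  have hc₁ := (hf.component_iff (zeroSet f₁)).2 (Or.inl rfl)
  obtain ⟨m, g, hH, hg, hm⟩ := h.exists_eq_pow_mul hP hQ hf.irreducible_fst hc₁
  -- Multiplicity two would make the component of `f₁` special, but a special component is defined
  -- by `f₂`.
  obtain rfl : m = 1 := by
    rcases hm with hm | hm
    · exact hm.1
    · have := hf.special _ hm.2
      exact absurd this.2 (hf.distinct this.1)
  obtain ⟨w, hFw, hw⟩ := hFG.exists_eq_pow_mul hf.irreducible_fst hc₁.1.2 hH hg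
  rw [pow_one] at hFw
  have hkF {k : PolyXY} (hk : Irreducible k) (hd : k ∣ F) :
      Associated k f₁ ∨ (f₂ ≠ 1 ∧ Associated k f₂) := by
    refine hf.irreducible_cases h hk ?_
    rw [← hFG.2.1]
    exact zeroSet_subset_of_dvd hd
  by_cases h2 : f₂ = 1
  · have hw0 : w ≠ 0 := by
      rintro rfl
      exact hF0 (by rw [hFw, mul_zero])
    have hu : IsUnit w := isUnit_of_forall_irreducible hw0 fun k hk hd => by
      rcases hkF hk (hFw ▸ hd.mul_left _) with ha | ⟨hne, -⟩
      · exact hw (ha.symm.dvd.trans hd)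
      · exact hne h2
    obtain ⟨c, hc, rfl⟩ := isUnit_iff_eq_C.1 hu
    exact ⟨c, 0, hc, by rw [hFw, h2]; ring, fun hne => absurd h2 hne⟩
  · have hc₂ := (hf.component_iff (zeroSet f₂)).2 (Or.inr ⟨h2, rfl⟩)
    have hirr := hf.irreducible_snd h2
    obtain ⟨n, g', hH', hg', hn⟩ := h.exists_eq_pow_mul hP hQ hirr hc₂
    obtain ⟨w', hFw', hw'⟩ := hFG.exists_eq_pow_mul hirr hc₂.1.2 hH' hg'
    have hcop : ¬ f₁ ∣ f₂ ^ n := fun hd => hf.not_dvd h2 (hf.irreducible_fst.prime.dvd_of_dvd_pow hd)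
    obtain ⟨u, rfl⟩ : f₁ ∣ w' := by
      refine (hf.irreducible_fst.prime.dvd_or_dvd ?_).resolve_left hcop
      rw [← hFw', hFw]
      exact dvd_mul_right _ _
    have hwu : w = f₂ ^ n * u := by
      apply mul_left_cancel₀ hf.irreducible_fst.ne_zero
      rw [← hFw, hFw']; ring
    have hu0 : u ≠ 0 := by
      rintro rfl
      exact hF0 (by rw [hFw', mul_zero, mul_zero])
    have hu : IsUnit u := isUnit_of_forall_irreducible hu0 fun k hk hd => by
      rcases hkF hk (hFw' ▸ (hd.mul_left _).mul_left _) with ha | ⟨-, ha⟩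
      · exact hw (hwu ▸ (ha.symm.dvd.trans hd).mul_left _)
      · exact hw' ((ha.symm.dvd.trans hd).mul_left _)
    obtain ⟨c, hc, rfl⟩ := isUnit_iff_eq_C.1 hu
    exact ⟨c, n, hc, by rw [hFw']; ring, fun _ => hn⟩

theorem IsComponentEquations.squarefree_mul {f₁ f₂ : PolyXY}
    (hf : φ.IsComponentEquations d f₁ f₂) : Squarefree (f₁ * f₂) := by
  by_cases h2 : f₂ = 1
  · rw [h2, mul_one]
    exact hf.irreducible_fst.squarefree
  · exact squarefree_mul_of_irreducible hf.irreducible_fst (hf.irreducible_snd h2) (hf.not_dvd h2)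

end RatParam

end Offset
end

theorem theorem2 (φ : Offset.RatParam) (d : ℝ) (hd : 0 < d)
    (hline : ¬ Offset.IsLine φ.curve) (hcircle : ¬ Offset.IsCircle φ.curve)
    (hproper : φ.IsProper) :
    (∃ f₁ f₂ : Offset.PolyXY, φ.IsComponentEquations d f₁ f₂) ∧
    ∀ P Q : Offset.PolyXYT,
      Offset.IsPrimitivePartT φ.normalPoly P →
      Offset.IsPrimitivePartT (φ.circlePoly d) Q →
      (∃ F G : Offset.PolyXY, φ.IsNonExtraneousPart d (Polynomial.resultant P Q) F G) ∧
      ∀ F G : Offset.PolyXY, φ.IsNonExtraneousPart d (Polynomial.resultant P Q) F G →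
      ∀ f₁ f₂ : Offset.PolyXY, φ.IsComponentEquations d f₁ f₂ →
        (¬ φ.HasSpecialComponent d →
          (∃ c : ℂ, c ≠ 0 ∧ F = MvPolynomial.C c * (f₁ * f₂)) ∧ Squarefree F) ∧
        (φ.HasSpecialComponent d →
          ∃ c : ℂ, c ≠ 0 ∧ F = MvPolynomial.C c * (f₁ * f₂ ^ 2)) := by
  have h : φ.IsAdmissible d := ⟨hd, hline, hcircle, hproper⟩
  refine ⟨h.exists_isComponentEquations, fun P Q hP hQ =>
    ⟨h.exists_isNonExtraneousPart hP hQ.1, fun F G hFG f₁ f₂ hf => ?_⟩⟩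
  obtain ⟨c, n, hc, hF, hn⟩ := hFG.exists_eq_C_mul h hP hQ.1 hf
  constructor
  · intro hno
    have hF' : F = MvPolynomial.C c * (f₁ * f₂) := by
      -- For `f₂ = 1` the exponent `n` carries no information and is immaterial.
      by_cases h2 : f₂ = 1
      · rw [hF, h2, one_pow]
      · rcases hn h2 with h3 | h3
        · rw [hF, h3.1, pow_one]
        · exact absurd ⟨_, h3.2⟩ hno
    refine ⟨⟨c, hc, hF'⟩, ?_⟩
    rw [hF']
    exact Offset.squarefree_C_mul hc hf.squarefree_mul
  · rintro ⟨D, hD⟩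
    obtain ⟨h2, rfl⟩ := hf.special D hD
    rcases hn h2 with h3 | h3
    · exact absurd hD h3.2
    · exact ⟨c, hc, by rw [hF, h3.1]⟩
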